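/- Let $K$ be an algebraic number field with ring of integers $\mathfrak o$, class number $h_K=1$ and at most one real place. Let $\mathbb A_f$ be the ring of finite adeles, $\mathbb A=K_\infty\times\mathbb A_f$ the ring of adeles, $\hat{\mathfrak o}=\prod_\nu\mathfrak o_\nu\subset\mathbb A_f$ (product over the finite places), and let $U=\overline{K^\times K_{\infty,+}^\times}\subset\mathbb A^*$, where $K_{\infty,+}^\times$ is the connected component of $1$ in $K_\infty^\times$; $\mathbb A_f^*$ is embedded in $\mathbb A^*$ with $1$ at the infinite places. Let $X=\mathbb A^*/U\times_{\hat{\mathfrak o}^*}\mathbb A_f$ be the quotient of $\mathbb A^*/U\times\mathbb A_f$ by $(x,y)\sim(rx,r^{-1}y)$ for $r\in\hat{\mathfrak o}^*$, let $Y\subset X$ be the image of $\mathbb A^*/U\times\hat{\mathfrak o}$, and let $\mathbb A_f^*/\hat{\mathfrak o}^*$ act on $X$ by $z\cdot[(x,y)]=[(z^{-1}x,zy)]$. Let $y\sim y'$ in $\mathbb A_f$ if and only if $y\in(\hat{\mathfrak o}^*\cap U)\,y'$, and let $\varphi^*:\mathbb A_f/\!\sim\;\to X$, $[y]\mapsto[(1,y)]$.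 All crossed products are full crossed products by discrete groups, and $f\delta_g$ denotes their standard elements. Then $Y\subset X$ and $\hat{\mathfrak o}/\!\sim\;\subset\mathbb A_f/\!\sim$ are compact and open and closed; put $\mathcal A=1_Y\big(C_0(X)\rtimes\mathbb A_f^*/\hat{\mathfrak o}^*\big)1_Y$. Put $G=K^\times$ if $K$ has no real place, and $G=K^\times_{>0}=\{\lambda\in K^\times:\sigma(\lambda)>0\}$ if $K$ has a real place, with real embedding $\sigma$; let $G/(G\cap\mathfrak o^*)$ act on $\mathbb A_f/\!\sim$ by multiplication. Then: (1) $\varphi^*$ is a homeomorphism and induces a *-isomorphism $$C_0(X)\rtimes\mathbb A_f^*/\hat{\mathfrak o}^*\;\cong\;C_0(\mathbb A_f/\!\sim)\rtimes G/(G\cap\mathfrak o^*),\qquad f\,\delta_{[\lambda]}\mapsto(f\circ\varphi^*)\,\delta_{[\lambda]}\quad(f\in C_0(X),\ \lambda\in G),$$ which restricts to a *-isomorphism $$\mathcal A\;\cong\;1_{\hat{\mathfrak o}/\sim}\big(C_0(\mathbb A_f/\!\sim)\rtimes G/(G\cap\mathfrak o^*)\big)1_{\hat{\mathfrak o}/\sim}.$$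 (2) $\mathcal A$ embeds into $\mathfrak A[\mathfrak o]$, the universal C*-algebra generated by isometries $s_m$ ($0\ne m\in\mathfrak o$) and unitaries $u^n$ ($n\in\mathfrak o$) with the relations $s_ks_m=s_{km}$, $u^lu^n=u^{l+n}$, $s_mu^n=u^{mn}s_m$ and $\sum_{n+(m)\in\mathfrak o/(m)}u^ns_ms_m^*u^{-n}=1$. More precisely, there are a group homomorphism $\tau:\mathbb A_f^*/\hat{\mathfrak o}^*\to K^\times$ with values in $G$ and $[\tau(z)]=z$ for all $z$, a unital *-homomorphism $\alpha:C(\hat{\mathfrak o})\to\mathfrak A[\mathfrak o]$ with $\alpha(1_{n+m\hat{\mathfrak o}})=u^ns_ms_m^*u^{-n}$ for all $m\ne0$ and $n$ in $\mathfrak o$, and an injective *-homomorphism $\Phi:\mathcal A\to\mathfrak A[\mathfrak o]$ such that $$\Phi\big(1_Y(f\delta_z)1_Y\big)=\alpha\big(y\mapsto f([(1,y)])\big)\,s_b^*s_a$$ for all $f\in C_0(X)$, all $z\in\mathbb A_f^*/\hat{\mathfrak o}^*$ and all nonzero $a,b\in\mathfrak o$ with $\tau(z)=a/b$. -/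

import Mathlib

open scoped ENNReal NumberField ZeroAtInfty nonZeroDivisors
open NumberField IsDedekindDomain

noncomputable section

universe u

namespace BostConnes

/-! ### Full crossed products by discrete groups -/

/-- A covariant representation of a C*-dynamical system `(A, G, α)` with `G` discrete, on a complex
Hilbert space `H`. -/
structure CovariantRep {A G : Type u} [NonUnitalCStarAlgebra A] [Group G]
    (α : G →* (A →⋆ₙₐ[ℂ] A)) : Type (u + 1) where
  H : Type u
  [normed : NormedAddCommGroup H]
  [inner : InnerProductSpace ℂ H]
  [complete : CompleteSpace H]
  π : A →⋆ₙₐ[ℂ] (H →L[ℂ] H)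
  V : G →* unitary (H →L[ℂ] H)
  covariant : ∀ (g : G) (a : A),
    (V g : H →L[ℂ] H) * π a * star (V g : H →L[ℂ] H) = π (α g a)

attribute [instance] CovariantRep.normed CovariantRep.inner CovariantRep.complete

section CrossedProduct

variable {A G : Type u} [NonUnitalCStarAlgebra A] [Group G] (α : G →* (A →⋆ₙₐ[ℂ] A))

/-- The `ℓ^∞`-direct sum of the algebras of bounded operators, over all covariant
representations. -/
abbrev CovariantRep.Ambient : Type (u + 1) :=
  lp (fun ρ : CovariantRep α => ρ.H →L[ℂ] ρ.H) ∞

/-- The element `a δ_g` in the direct sum of all covariant representations. -/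
def CovariantRep.elt (a : A) (g : G) : CovariantRep.Ambient α :=
  ⟨fun ρ => ρ.π a * (ρ.V g : ρ.H →L[ℂ] ρ.H), by
    refine memℓp_infty ⟨‖a‖, ?_⟩
    rintro _ ⟨ρ, rfl⟩
    show ‖ρ.π a * (ρ.V g : ρ.H →L[ℂ] ρ.H)‖ ≤ ‖a‖
    rw [CStarRing.norm_mul_coe_unitary]
    exact NonUnitalStarAlgHom.norm_apply_le ρ.π a⟩

/-- The C*-subalgebra generated by the elements `a δ_g` in the direct sum of all covariant
representations. -/
def crossedProductSubalgebra : NonUnitalStarSubalgebra ℂ (CovariantRep.Ambient α) :=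
  (NonUnitalStarAlgebra.adjoin ℂ
    {x | ∃ (a : A) (g : G), x = CovariantRep.elt α a g}).topologicalClosure

/-- The full crossed product `A ⋊ G`: the C*-algebra generated by the elements `a δ_g` in the
direct sum of all covariant representations. -/
def CrossedProduct : Type (u + 1) := crossedProductSubalgebra α

instance : NonUnitalCStarAlgebra (CrossedProduct α) :=
  NonUnitalStarSubalgebra.nonUnitalCStarAlgebra (crossedProductSubalgebra α)
    (h_closed := isClosed_closure)

/-- The element `a δ_g` of the full crossed product. -/
def CrossedProduct.mk (a : A) (g : G) : CrossedProduct α :=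
  ⟨CovariantRep.elt α a g, NonUnitalStarSubalgebra.le_topologicalClosure _
    (NonUnitalStarAlgebra.subset_adjoin ℂ _ ⟨a, g, rfl⟩)⟩

end CrossedProduct

/-- The corner `e B e` of a C*-algebra `B` at a projection `e`. -/
def corner {B : Type*} [NonUnitalCStarAlgebra B] (e : B) (he : IsStarProjection e) :
    NonUnitalStarSubalgebra ℂ B where
  carrier := {x | ∃ b : B, x = e * b * e}
  add_mem' := by
    rintro _ _ ⟨b, rfl⟩ ⟨c, rfl⟩
    exact ⟨b + c, by simp [mul_add, add_mul]⟩
  zero_mem' := ⟨0, by simp⟩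
  mul_mem' := by
    rintro _ _ ⟨b, rfl⟩ ⟨c, rfl⟩
    exact ⟨b * e * e * c, by simp only [mul_assoc]⟩
  smul_mem' := by
    rintro t _ ⟨b, rfl⟩
    exact ⟨t • b, by rw [mul_smul_comm, smul_mul_assoc]⟩
  star_mem' := by
    rintro _ ⟨b, rfl⟩
    exact ⟨star b, by simp [star_mul, he.isSelfAdjoint.star_eq, mul_assoc]⟩

/-! ### Crossed products of `C₀(X)` -/

section Functions

variable {X G : Type u} [TopologicalSpace X] [Group G]

/-- The action `(g f)(x) = f (g⁻¹ x)` on `C₀(X)` induced by an action of `G` on `X` by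
homeomorphisms. -/
def translation (ρ : G →* (X ≃ₜ X)) : G →* (C₀(X, ℂ) →⋆ₙₐ[ℂ] C₀(X, ℂ)) where
  toFun g :=
    { toFun := fun f => f.comp (Homeomorph.toCocompactMap (ρ g⁻¹))
      map_smul' := fun _ _ => rfl
      map_zero' := rfl
      map_add' := fun _ _ => rfl
      map_mul' := fun _ _ => rfl
      map_star' := fun _ => rfl }
  map_one' := by
    ext f x
    show f (ρ 1⁻¹ x) = f x
    simp
  map_mul' g h := by
    ext f x
    show f (ρ (g * h)⁻¹ x) = f (ρ h⁻¹ (ρ g⁻¹ x))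
    simp [mul_inv_rev]

/-- The indicator function of a compact open and closed set `S` as an element of `C₀(X)`
(for other sets the value is `0`). -/
def indicatorC₀ (S : Set X) : C₀(X, ℂ) := by
  classical
  exact
  if h : IsClopen S ∧ IsCompact S then
    { toFun := S.indicator 1
      continuous_toFun := (continuous_const (y := (1 : ℂ))).indicator (by simp [h.1.frontier_eq])
      zero_at_infty' := by
        refine tendsto_const_nhds.congr' ?_
        filter_upwards [h.2.compl_mem_cocompact] with x hx
        exact (Set.indicator_of_notMem hx _).symm }
  else 0

theorem indicatorC₀_mul_self (S : Set X) : indicatorC₀ S * indicatorC₀ S = indicatorC₀ S := by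
  classical
  unfold indicatorC₀
  split_ifs with h
  · ext x
    by_cases hx : x ∈ S <;> simp [hx]
  · simp

theorem star_indicatorC₀ (S : Set X) : star (indicatorC₀ S) = indicatorC₀ S := by
  classical
  unfold indicatorC₀
  split_ifs with h
  · ext x
    by_cases hx : x ∈ S <;> simp [hx]
  · simp

/-- The image `1_S δ_1` of the indicator function of `S` in `C₀(X) ⋊ G`. -/
def indicatorElt (ρ : G →* (X ≃ₜ X)) (S : Set X) : CrossedProduct (translation ρ) :=
  CrossedProduct.mk (translation ρ) (indicatorC₀ S) 1

theorem isStarProjection_indicatorElt (ρ : G →* (X ≃ₜ X)) (S : Set X) :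
    IsStarProjection (indicatorElt ρ S) := by
  constructor
  · apply Subtype.ext
    apply lp.ext
    funext τ
    show (τ.π (indicatorC₀ S) * (τ.V 1 : τ.H →L[ℂ] τ.H)) *
      (τ.π (indicatorC₀ S) * (τ.V 1 : τ.H →L[ℂ] τ.H)) =
      τ.π (indicatorC₀ S) * (τ.V 1 : τ.H →L[ℂ] τ.H)
    simp only [map_one, OneMemClass.coe_one, mul_one]
    rw [← map_mul, indicatorC₀_mul_self]
  · apply Subtype.ext
    apply lp.ext
    funext τ
    show star (τ.π (indicatorC₀ S) * (τ.V 1 : τ.H →L[ℂ] τ.H)) =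
      τ.π (indicatorC₀ S) * (τ.V 1 : τ.H →L[ℂ] τ.H)
    simp only [map_one, OneMemClass.coe_one, mul_one]
    rw [← map_star, star_indicatorC₀]

/-- The corner `1_S (C₀(X) ⋊ G) 1_S`. -/
def indicatorCorner (ρ : G →* (X ≃ₜ X)) (S : Set X) :
    NonUnitalStarSubalgebra ℂ (CrossedProduct (translation ρ)) :=
  corner (indicatorElt ρ S) (isStarProjection_indicatorElt ρ S)

end Functions

/-! ### The ring C*-algebra -/

/-- A representation, on a nonzero Hilbert space, of the generators and relations of the ring
C*-algebra of an integral domain `R` in which every nonzero principal ideal has finite index: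
isometries `s m` for nonzero `m`, unitaries `u n`, with
`s k * s m = s (k * m)`, `u l * u n = u (l + n)`, `s m * u n = u (m * n) * s m` and
`∑ u n * s m * (s m)* * u (-n) = 1`, the sum being over the cosets `n + (m)`. By the other
relations its terms do not depend on the representatives, here chosen by `Quotient.out`. -/
structure RingRep (R : Type u) [CommRing R] : Type (u + 1) where
  H : Type u
  [normed : NormedAddCommGroup H]
  [inner : InnerProductSpace ℂ H]
  [complete : CompleteSpace H]
  [nontrivial : Nontrivial H]
  s : R⁰ → (H →L[ℂ] H)
  u : R → (H →L[ℂ] H)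
  isometry_s : ∀ m, star (s m) * s m = 1
  unitary_u : ∀ n, u n ∈ unitary (H →L[ℂ] H)
  s_mul : ∀ k m, s k * s m = s (k * m)
  u_mul : ∀ l n, u l * u n = u (l + n)
  s_mul_u : ∀ (m : R⁰) (n : R), s m * u n = u (m * n) * s m
  sum_eq_one : ∀ m : R⁰,
    ∑ᶠ c : R ⧸ Ideal.span {(m : R)},
      u (Quotient.out c) * (s m * star (s m)) * u (-Quotient.out c) = 1

attribute [instance] RingRep.normed RingRep.inner RingRep.complete RingRep.nontrivial

section RingAlgebra

variable (R : Type u) [CommRing R]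

/-- The `ℓ^∞`-direct sum of the algebras of bounded operators, over all representations of the
generators and relations. -/
abbrev RingRep.Ambient : Type (u + 1) := lp (fun ρ : RingRep R => ρ.H →L[ℂ] ρ.H) ∞

instance : CStarAlgebra (RingRep.Ambient R) where

variable {R}

theorem RingRep.norm_s_le (ρ : RingRep R) (m : R⁰) : ‖ρ.s m‖ ≤ 1 := by
  have h := CStarRing.norm_star_mul_self (x := ρ.s m)
  rw [ρ.isometry_s m, norm_one] at h
  nlinarith [norm_nonneg (ρ.s m)]

/-- The isometry `s_m` in the direct sum of all representations. -/
def RingRep.sElt (m : R⁰) : RingRep.Ambient R :=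
  ⟨fun ρ => ρ.s m, memℓp_infty ⟨1, by rintro _ ⟨ρ, rfl⟩; exact ρ.norm_s_le m⟩⟩

/-- The unitary `u^n` in the direct sum of all representations. -/
def RingRep.uElt (n : R) : RingRep.Ambient R :=
  ⟨fun ρ => ρ.u n, memℓp_infty ⟨1, by
    rintro _ ⟨ρ, rfl⟩; exact (CStarRing.norm_of_mem_unitary (ρ.unitary_u n)).le⟩⟩

variable (R)

/-- The C*-subalgebra generated by the `s_m` and `u^n` in the direct sum of all
representations. -/
def ringSubalgebra : StarSubalgebra ℂ (RingRep.Ambient R) :=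
  (StarAlgebra.adjoin ℂ (Set.range RingRep.sElt ∪ Set.range RingRep.uElt)).topologicalClosure

/-- The universal C*-algebra `𝔄[R]` generated by isometries `s_m` and unitaries `u^n` with the
relations of `RingRep`. -/
def RingCStarAlgebra : Type (u + 1) := ringSubalgebra R

instance : CStarAlgebra (RingCStarAlgebra R) :=
  StarSubalgebra.cstarAlgebra (ringSubalgebra R) (h_closed := isClosed_closure)

variable {R}

/-- The isometry `s_m` of `𝔄[R]`. -/
def RingCStarAlgebra.s (m : R⁰) : RingCStarAlgebra R :=
  ⟨RingRep.sElt m, StarSubalgebra.le_topologicalClosure _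
    (StarAlgebra.subset_adjoin ℂ _ (Or.inl ⟨m, rfl⟩))⟩

/-- The unitary `u^n` of `𝔄[R]`. -/
def RingCStarAlgebra.u (n : R) : RingCStarAlgebra R :=
  ⟨RingRep.uElt n, StarSubalgebra.le_topologicalClosure _
    (StarAlgebra.subset_adjoin ℂ _ (Or.inr ⟨n, rfl⟩))⟩

end RingAlgebra

/-! ### Adeles and ideles -/

section Adeles

variable (K : Type u) [Field K] [NumberField K]

/-- The finite adeles `𝔸_f`. -/
abbrev FinAdele : Type u := FiniteAdeleRing (𝓞 K) K

/-- The adeles `𝔸 = K_∞ × 𝔸_f`. -/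
abbrev Adele : Type u := AdeleRing (𝓞 K) K

/-- The subring `ô = ∏ o_ν` of the finite adeles. -/
def integralAdeles : Subring (FinAdele K) where
  carrier := {y | ∀ v, y v ∈ v.adicCompletionIntegers K}
  zero_mem' := fun v => zero_mem (v.adicCompletionIntegers K)
  one_mem' := fun v => one_mem (v.adicCompletionIntegers K)
  add_mem' := fun ha hb v => add_mem (ha v) (hb v)
  mul_mem' := fun ha hb v => mul_mem (ha v) (hb v)
  neg_mem' := fun ha v => neg_mem (ha v)

/-- The unit group `ô^* = ∏ o_ν^*` of `ô`, as a subgroup of the finite ideles. -/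
def integralIdeles : Subgroup (FinAdele K)ˣ := (integralAdeles K).toSubmonoid.units

/-- The embedding `K_∞^× → 𝔸^*`, with `1` at the finite places. -/
def infIdele : (InfiniteAdeleRing K)ˣ →* (Adele K)ˣ :=
  Units.map
    { toFun := fun x => ((x, 1) : InfiniteAdeleRing K × FinAdele K)
      map_one' := rfl
      map_mul' := fun _ _ => Prod.ext rfl (mul_one _).symm }

/-- The embedding `𝔸_f^* → 𝔸^*`, with `1` at the infinite places. -/
def finIdele : (FinAdele K)ˣ →* (Adele K)ˣ :=
  Units.map
    { toFun := fun z => ((1, z) : InfiniteAdeleRing K × FinAdele K)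
      map_one' := rfl
      map_mul' := fun _ _ => Prod.ext (mul_one _).symm rfl }

/-- The diagonal embedding `K^× → 𝔸^*`. -/
def diagIdele : Kˣ →* (Adele K)ˣ := Units.map (algebraMap K (Adele K) : K →* Adele K)

/-- The diagonal embedding `K^× → 𝔸_f^*`. -/
def diagFin : Kˣ →* (FinAdele K)ˣ := FiniteAdeleRing.unitEmbedding (𝓞 K) K

/-- The diagonal embedding `K^× → K_∞^×`. -/
def diagInf : Kˣ →* (InfiniteAdeleRing K)ˣ :=
  Units.map (algebraMap K (InfiniteAdeleRing K) : K →* InfiniteAdeleRing K)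

/-- `U`, the closure of `K^× K_{∞,+}^×` in the ideles, where `K_{∞,+}^×` is the connected
component of the identity in `K_∞^×`. -/
def ideleU : Subgroup (Adele K)ˣ :=
  ((diagIdele K).range ⊔
    (Subgroup.connectedComponentOfOne (InfiniteAdeleRing K)ˣ).map (infIdele K)).topologicalClosure

/-- The topological group `𝔸^*/U`. -/
def IdeleClassQuot : Type u := (Adele K)ˣ ⧸ ideleU K

instance : CommGroup (IdeleClassQuot K) := inferInstanceAs (CommGroup ((Adele K)ˣ ⧸ ideleU K))

instance : TopologicalSpace (IdeleClassQuot K) :=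
  inferInstanceAs (TopologicalSpace ((Adele K)ˣ ⧸ ideleU K))

instance : IsTopologicalGroup (IdeleClassQuot K) :=
  inferInstanceAs (IsTopologicalGroup ((Adele K)ˣ ⧸ ideleU K))

/-- The quotient map `𝔸^* → 𝔸^*/U`. -/
def ideleClass : (Adele K)ˣ →* IdeleClassQuot K := QuotientGroup.mk' (ideleU K)

/-- The unit group `o^*` of the ring of integers, as a subgroup of `K^×`. -/
def intUnits : Subgroup Kˣ := (Units.map (algebraMap (𝓞 K) K : 𝓞 K →* K)).range

/-! ### The spaces -/

/-- The equivalence relation on `𝔸^*/U × 𝔸_f` given by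
`(x, y) ∼ (r x, r⁻¹ y)` for `r ∈ ô^*`. -/
def spaceXSetoid : Setoid (IdeleClassQuot K × FinAdele K) where
  r p q := ∃ r ∈ integralIdeles K,
    (ideleClass K (finIdele K r) * p.1, ((r⁻¹ : (FinAdele K)ˣ) : FinAdele K) * p.2) = q
  iseqv :=
    { refl := fun p => ⟨1, one_mem _, by simp⟩
      symm := by
        rintro p _ ⟨r, hr, rfl⟩
        exact ⟨r⁻¹, inv_mem hr, by ext1 <;> simp⟩
      trans := by
        rintro p _ _ ⟨r, hr, rfl⟩ ⟨t, ht, rfl⟩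
        exact ⟨t * r, mul_mem ht hr, by ext1 <;> simp [mul_assoc, mul_comm, mul_left_comm]⟩ }

/-- The space `X = 𝔸^*/U ×_{ô^*} 𝔸_f`, with the quotient topology. -/
abbrev SpaceX : Type u := Quotient (spaceXSetoid K)

/-- The image `Y` of `𝔸^*/U × ô` in `X`. -/
def subsetY : Set (SpaceX K) := {p | ∃ x, ∃ y ∈ integralAdeles K, p = Quotient.mk _ (x, y)}

/-- The equivalence relation on `𝔸_f` given by multiplication with elements of `ô^* ∩ U`. -/
def adeleSetoid : Setoid (FinAdele K) where
  r y y' := ∃ z ∈ integralIdeles K, finIdele K z ∈ ideleU K ∧ y = z * y'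
  iseqv :=
    { refl := fun y => ⟨1, one_mem _, by simp [one_mem], by simp⟩
      symm := by
        rintro _ y ⟨z, hz, hU, rfl⟩
        exact ⟨z⁻¹, inv_mem hz, by rw [map_inv]; exact inv_mem hU, by simp⟩
      trans := by
        rintro _ _ y ⟨z, hz, hU, rfl⟩ ⟨w, hw, hwU, rfl⟩
        exact ⟨z * w, mul_mem hz hw, by rw [map_mul]; exact mul_mem hU hwU, by simp [mul_assoc]⟩ }

/-- The quotient space `𝔸_f / ∼_{ô^* ∩ U}`. -/
abbrev AdeleQuot : Type u := Quotient (adeleSetoid K)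

/-- The image of `ô` in `𝔸_f / ∼_{ô^* ∩ U}`. -/
def integralQuot : Set (AdeleQuot K) := {p | ∃ y ∈ integralAdeles K, p = Quotient.mk _ y}

/-- The map `φ^* : 𝔸_f / ∼_{ô^* ∩ U} → X`, `[y] ↦ [(1, y)]`. -/
def phiStar : AdeleQuot K → SpaceX K :=
  Quotient.lift (fun y => Quotient.mk (spaceXSetoid K) (1, y)) (by
    rintro _ y ⟨z, hz, hU, rfl⟩
    refine Quotient.sound ⟨z, hz, ?_⟩
    ext1
    · exact (mul_one _).trans ((QuotientGroup.eq_one_iff (finIdele K z)).2 hU)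
    · simp)

/-! ### The actions -/

/-- Multiplication by the finite idele `z` on `X`: `(x, y) ↦ (z⁻¹ x, z y)`. -/
def actX (z : (FinAdele K)ˣ) : SpaceX K → SpaceX K :=
  Quotient.map
    (fun p => ((ideleClass K (finIdele K z))⁻¹ * p.1, (z : FinAdele K) * p.2)) (by
      rintro p _ ⟨r, hr, rfl⟩
      exact ⟨r, hr, by ext1 <;> simp [mul_left_comm]⟩)

theorem continuous_actX (z : (FinAdele K)ˣ) : Continuous (actX K z) := by
  have h : Continuous fun p : IdeleClassQuot K × FinAdele K =>
      ((ideleClass K (finIdele K z))⁻¹ * p.1, (z : FinAdele K) * p.2) := by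
    fun_prop
  exact h.quotient_map' _

theorem actX_one : actX K 1 = id := by
  funext p
  induction p using Quotient.inductionOn with
  | h p => exact congrArg (Quotient.mk _) (by ext1 <;> simp)

theorem actX_mul (z w : (FinAdele K)ˣ) (p : SpaceX K) :
    actX K (z * w) p = actX K z (actX K w p) := by
  induction p using Quotient.inductionOn with
  | h p => exact congrArg (Quotient.mk _) (by ext1 <;> simp [mul_comm, mul_left_comm])

/-- The action of the finite ideles on `X` by homeomorphisms. -/
def finIdeleActX : (FinAdele K)ˣ →* (SpaceX K ≃ₜ SpaceX K) where
  toFun z :=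
    { toFun := actX K z
      invFun := actX K z⁻¹
      left_inv := fun p => by rw [← actX_mul, inv_mul_cancel, actX_one]; rfl
      right_inv := fun p => by rw [← actX_mul, mul_inv_cancel, actX_one]; rfl
      continuous_toFun := continuous_actX K z
      continuous_invFun := continuous_actX K z⁻¹ }
  map_one' := by ext p; exact congrFun (actX_one K) p
  map_mul' z w := by ext p; exact actX_mul K z w p

/-- The group `𝔸_f^*/ô^*`. -/
abbrev IdealGroup : Type u := (FinAdele K)ˣ ⧸ integralIdeles K

/-- The action of `𝔸_f^*/ô^*` on `X`. -/
def idealActX : IdealGroup K →* (SpaceX K ≃ₜ SpaceX K) :=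
  QuotientGroup.lift (integralIdeles K) (finIdeleActX K) (by
    intro z hz
    ext p
    induction p using Quotient.inductionOn with
    | h p => exact Quotient.sound ⟨z, hz, by ext1 <;> simp⟩)

/-- Multiplication by the finite idele `z` on `𝔸_f / ∼_{ô^* ∩ U}`. -/
def actQuot (z : (FinAdele K)ˣ) : AdeleQuot K → AdeleQuot K :=
  Quotient.map (fun y => (z : FinAdele K) * y) (by
    rintro _ y ⟨w, hw, hU, rfl⟩
    exact ⟨w, hw, hU, by simp [mul_left_comm]⟩)

theorem continuous_actQuot (z : (FinAdele K)ˣ) : Continuous (actQuot K z) :=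
  Continuous.quotient_map' (continuous_const.mul continuous_id) _

theorem actQuot_one : actQuot K 1 = id := by
  funext p
  induction p using Quotient.inductionOn with
  | h y => exact congrArg (Quotient.mk _) (by simp)

theorem actQuot_mul (z w : (FinAdele K)ˣ) (p : AdeleQuot K) :
    actQuot K (z * w) p = actQuot K z (actQuot K w p) := by
  induction p using Quotient.inductionOn with
  | h y => exact congrArg (Quotient.mk _) (by simp [mul_assoc])

/-- The action of the finite ideles on `𝔸_f / ∼_{ô^* ∩ U}` by homeomorphisms. -/
def finIdeleActQuot : (FinAdele K)ˣ →* (AdeleQuot K ≃ₜ AdeleQuot K) where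
  toFun z :=
    { toFun := actQuot K z
      invFun := actQuot K z⁻¹
      left_inv := fun p => by rw [← actQuot_mul, inv_mul_cancel, actQuot_one]; rfl
      right_inv := fun p => by rw [← actQuot_mul, mul_inv_cancel, actQuot_one]; rfl
      continuous_toFun := continuous_actQuot K z
      continuous_invFun := continuous_actQuot K z⁻¹ }
  map_one' := by ext p; exact congrFun (actQuot_one K) p
  map_mul' z w := by ext p; exact actQuot_mul K z w p

variable {K}

/-- All elements of the subgroup `G` of `K^×` are positive under every real embedding of `K`. -/
def IsTotallyPositive (G : Subgroup Kˣ) : Prop :=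
  ∀ x ∈ G, ∀ σ : K →+* ℝ, 0 < σ x

/-- The part of the completion at `v` that consists of the positive elements if `v` is real, and of
the nonzero elements if `v` is complex. -/
def positivePart (v : InfinitePlace K) : Set v.Completion :=
  {t | t ≠ 0 ∧ ∀ hv : v.IsReal, 0 < InfinitePlace.Completion.extensionEmbeddingOfIsReal hv t}

theorem isPreconnected_positivePart (v : InfinitePlace K) : IsPreconnected (positivePart v) := by
  by_cases hv : v.IsReal
  · let e := InfinitePlace.Completion.isometryEquivRealOfIsReal hv
    have he : ∀ t, e t = InfinitePlace.Completion.extensionEmbeddingOfIsReal hv t := fun _ => rfl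
    have h : positivePart v = e.symm '' Set.Ioi 0 := by
      ext t
      constructor
      · rintro ⟨-, h⟩
        exact ⟨e t, h hv, e.symm_apply_apply t⟩
      · rintro ⟨r, hr, rfl⟩
        have h1 : 0 < InfinitePlace.Completion.extensionEmbeddingOfIsReal hv (e.symm r) := by
          rw [← he, e.apply_symm_apply]
          exact hr
        refine ⟨?_, fun _ => h1⟩
        intro h0
        rw [h0, map_zero] at h1
        exact lt_irrefl _ h1
    rw [h]
    exact isPreconnected_Ioi.image _ e.symm.continuous.continuousOn
  · have hc : v.IsComplex := InfinitePlace.not_isReal_iff_isComplex.1 hv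
    let e := InfinitePlace.Completion.isometryEquivComplexOfIsComplex hc
    have he : ∀ t, e t = InfinitePlace.Completion.extensionEmbedding v t := fun _ => rfl
    have h : positivePart v = e.symm '' {0}ᶜ := by
      ext t
      constructor
      · rintro ⟨h, -⟩
        refine ⟨e t, ?_, e.symm_apply_apply t⟩
        simpa [he] using h
      · rintro ⟨r, hr, rfl⟩
        refine ⟨?_, fun h => absurd h hv⟩
        intro h0
        apply hr
        have := congrArg e h0
        rwa [e.apply_symm_apply, he, map_zero] at this
    rw [h]
    refine IsPreconnected.image ?_ _ e.symm.continuous.continuousOn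
    exact (isConnected_compl_singleton_of_one_lt_rank (by simp) 0).isPreconnected

theorem diagInf_mem_connectedComponent (x : Kˣ) (hx : ∀ σ : K →+* ℝ, 0 < σ x) :
    diagInf K x ∈ Subgroup.connectedComponentOfOne (InfiniteAdeleRing K)ˣ := by
  have hpre : ∀ v : InfinitePlace K, PreconnectedSpace (positivePart v) := fun v =>
    isPreconnected_iff_preconnectedSpace.1 (isPreconnected_positivePart v)
  let f : (∀ v : InfinitePlace K, positivePart v) → (InfiniteAdeleRing K)ˣ := fun s =>
    { val := fun v => (s v : v.Completion)
      inv := fun v => (s v : v.Completion)⁻¹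
      val_inv := funext fun v => mul_inv_cancel₀ (s v).2.1
      inv_val := funext fun v => inv_mul_cancel₀ (s v).2.1 }
  have hf : Continuous f := by
    refine Units.continuous_iff.2 ⟨?_, ?_⟩
    · exact continuous_pi fun v => continuous_subtype_val.comp (continuous_apply v)
    · exact continuous_pi fun v =>
        (continuous_subtype_val.comp (continuous_apply v)).inv₀ fun s => (s v).2.1
  refine (isPreconnected_range hf).subset_connectedComponent ?_ ?_
  · refine ⟨fun v => ⟨1, one_ne_zero, fun hv => by simp⟩, ?_⟩
    exact Units.ext rfl
  · refine ⟨fun v => ⟨((x : K) : v.Completion), ?_, fun hv => ?_⟩, ?_⟩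
    · exact (map_ne_zero (algebraMap K v.Completion)).2 x.ne_zero
    · have h := InfinitePlace.Completion.extensionEmbeddingOfIsReal_coe hv
        ((WithAbs.equiv v.1).symm (x : K))
      exact (hx (InfinitePlace.embedding_of_isReal hv)).trans_eq h.symm
    · exact Units.ext rfl

theorem finIdele_diagFin_mem (x : Kˣ) (hx : ∀ σ : K →+* ℝ, 0 < σ x) :
    finIdele K (diagFin K x) ∈ ideleU K := by
  refine Subgroup.le_topologicalClosure _ ?_
  have h : finIdele K (diagFin K x) = diagIdele K x * infIdele K (diagInf K x)⁻¹ := by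
    apply Units.ext
    refine Prod.ext ?_ ?_
    · exact ((diagInf K x).mul_inv).symm
    · exact (mul_one (diagFin K x : FinAdele K)).symm
  rw [h]
  exact mul_mem (Subgroup.mem_sup_left ⟨x, rfl⟩) (Subgroup.mem_sup_right
    ⟨_, inv_mem (diagInf_mem_connectedComponent x hx), rfl⟩)

theorem diagFin_mem_integralIdeles (x : Kˣ) (hx : x ∈ intUnits K) :
    diagFin K x ∈ integralIdeles K := by
  obtain ⟨t, rfl⟩ := hx
  refine ⟨fun v => ?_, fun v => ?_⟩
  · exact v.coe_mem_adicCompletionIntegers (K := K) (t : 𝓞 K)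
  · exact v.coe_mem_adicCompletionIntegers (K := K) ((t⁻¹ : (𝓞 K)ˣ) : 𝓞 K)

variable (G : Subgroup Kˣ)

/-- The group `G / (G ∩ o^*)` for a subgroup `G` of `K^×`. -/
abbrev ScalarGroup : Type u := G ⧸ (intUnits K).subgroupOf G

/-- The action of `G / (G ∩ o^*)` on `𝔸_f / ∼_{ô^* ∩ U}` by multiplication. -/
def scalarAct (hG : IsTotallyPositive G) : ScalarGroup G →* (AdeleQuot K ≃ₜ AdeleQuot K) :=
  QuotientGroup.lift ((intUnits K).subgroupOf G)
    ((finIdeleActQuot K).comp ((diagFin K).comp G.subtype)) (by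
      intro x hx
      ext p
      induction p using Quotient.inductionOn with
      | h y =>
        exact Quotient.sound ⟨diagFin K x, diagFin_mem_integralIdeles _ hx,
          finIdele_diagFin_mem _ (hG x x.2), rfl⟩)

end Adeles

section Comparison

variable (K : Type u) [Field K] [NumberField K]

/-- The generalized Bost-Connes algebra `𝒜 = 1_Y (C₀(X) ⋊ 𝔸_f^*/ô^*) 1_Y`. -/
abbrev bostConnesAlgebra :
    NonUnitalStarSubalgebra ℂ (CrossedProduct (translation (idealActX K))) :=
  indicatorCorner (idealActX K) (subsetY K)

variable {K}

/-- The element `1_Y (f δ_z) 1_Y` of the generalized Bost-Connes algebra. -/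
def bostConnesElt (f : C₀(SpaceX K, ℂ)) (z : IdealGroup K) : bostConnesAlgebra K :=
  ⟨indicatorElt (idealActX K) (subsetY K) * CrossedProduct.mk _ f z *
    indicatorElt (idealActX K) (subsetY K), _, rfl⟩

/-- The subgroup `K^×_{>0}` of elements that are positive under a real embedding `σ`. -/
def positiveScalars (σ : K →+* ℝ) : Subgroup Kˣ where
  carrier := {x | 0 < σ x}
  one_mem' := by simp
  mul_mem' {x y} hx hy := by
    show 0 < σ ((x * y : Kˣ) : K)
    rw [Units.val_mul, map_mul]
    exact mul_pos hx hy
  inv_mem' {x} hx := by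
    show 0 < σ ((x⁻¹ : Kˣ) : K)
    rw [Units.val_inv_eq_inv_val, map_inv₀]
    exact inv_pos.2 hx

/-- The real place defined by a real embedding. -/
def realPlace (σ : K →+* ℝ) : {w : InfinitePlace K // w.IsReal} :=
  ⟨InfinitePlace.mk (Complex.ofRealHom.comp σ), _, by
    refine ComplexEmbedding.isReal_iff.2 ?_
    ext x
    simp [ComplexEmbedding.conjugate], rfl⟩

theorem realPlace_injective : Function.Injective (realPlace (K := K)) := by
  intro σ τ h
  have h' : (Complex.ofRealHom.comp σ : K →+* ℂ) = Complex.ofRealHom.comp τ := by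
    rcases InfinitePlace.mk_eq_iff.1 (congrArg Subtype.val h) with h | h
    · exact h
    · rw [← h]
      ext x
      simp [ComplexEmbedding.conjugate]
  ext x
  exact Complex.ofReal_injective (DFunLike.congr_fun h' x)

theorem isTotallyPositive_top (h : InfinitePlace.nrRealPlaces K = 0) :
    IsTotallyPositive (⊤ : Subgroup Kˣ) := by
  classical
  intro _ _ σ
  exact ((Fintype.card_eq_zero_iff.1 h).false (realPlace σ)).elim

theorem isTotallyPositive_positiveScalars (h : InfinitePlace.nrRealPlaces K ≤ 1) (σ : K →+* ℝ) :
    IsTotallyPositive (positiveScalars σ) := by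
  classical
  intro x hx τ
  rw [realPlace_injective (Fintype.card_le_one_iff.1 h (realPlace τ) (realPlace σ))]
  exact hx

/-- `φ^*` is a homeomorphism and induces *-isomorphisms
`C₀(X) ⋊ 𝔸_f^*/ô^* ≅ C₀(𝔸_f/∼) ⋊ G/(G ∩ o^*)`, with `f δ_[λ] ↦ (f ∘ φ^*) δ_[λ]`, and, by
restriction, `𝒜 ≅ 1_{ô/∼} (C₀(𝔸_f/∼) ⋊ G/(G ∩ o^*)) 1_{ô/∼}`. -/
def PhiStarInducesIsos (G : Subgroup Kˣ) (hG : IsTotallyPositive G) : Prop :=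
  ∃ φ : AdeleQuot K ≃ₜ SpaceX K, (∀ p, φ p = phiStar K p) ∧
  ∃ Ψ : CrossedProduct (translation (idealActX K)) ≃⋆ₐ[ℂ]
      CrossedProduct (translation (scalarAct G hG)),
    (∀ (f : C₀(SpaceX K, ℂ)) (l : G),
      Ψ (CrossedProduct.mk _ f (diagFin K l : IdealGroup K)) =
        CrossedProduct.mk _ (f.comp φ.toCocompactMap) (l : ScalarGroup G)) ∧
    ∃ Ψ' : bostConnesAlgebra K ≃⋆ₐ[ℂ] indicatorCorner (scalarAct G hG) (integralQuot K),
      ∀ a : bostConnesAlgebra K,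
        (Ψ' a : CrossedProduct (translation (scalarAct G hG))) = Ψ a

/-- The restriction to `ô` of the function `y ↦ f [(1, y)]` on `𝔸_f`. -/
def restrictToIntegral (f : C₀(SpaceX K, ℂ)) : C(integralAdeles K, ℂ) where
  toFun y := f (Quotient.mk (spaceXSetoid K) (1, y))
  continuous_toFun :=
    f.continuous.comp (continuous_quotient_mk'.comp (by fun_prop))

/-- The coset `n + m ô` in `ô`. -/
def integralCoset (m : (𝓞 K)⁰) (n : 𝓞 K) : Set (integralAdeles K) :=
  {y | ∃ w ∈ integralAdeles K,
    (y : FinAdele K) = algebraMap (𝓞 K) (FinAdele K) n + algebraMap (𝓞 K) (FinAdele K) m * w}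

/-- `𝒜` embeds into `𝔄[o]`. The embedding `Φ` is the one which on functions is given by
`C(ô) → 𝔄[o]`, `1_{n + m ô} ↦ u^n s_m s_m^* u^{-n}`, and on group elements by a
multiplicative choice `σ z = a / b` in `G` (with `a, b ∈ o`) of representatives of the classes
`z ∈ 𝔸_f^*/ô^*`, with `z` corresponding to `s_b^* s_a`. -/
def EmbedsInRingCStarAlgebra (G : Subgroup Kˣ) : Prop :=
  ∃ σ : IdealGroup K →* Kˣ, (∀ z, σ z ∈ G ∧ (diagFin K (σ z) : IdealGroup K) = z) ∧
  ∃ α : C(integralAdeles K, ℂ) →⋆ₐ[ℂ] RingCStarAlgebra (𝓞 K),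
    (∀ (m : (𝓞 K)⁰) (n : 𝓞 K) (g : C(integralAdeles K, ℂ)),
      (∀ y, g y = (integralCoset m n).indicator 1 y) →
        α g = RingCStarAlgebra.u n * (RingCStarAlgebra.s m * star (RingCStarAlgebra.s m)) *
          RingCStarAlgebra.u (-n)) ∧
  ∃ Φ : bostConnesAlgebra K →⋆ₙₐ[ℂ] RingCStarAlgebra (𝓞 K), Function.Injective Φ ∧
    ∀ (f : C₀(SpaceX K, ℂ)) (z : IdealGroup K) (a b : (𝓞 K)⁰),
      (σ z : K) = ((a : 𝓞 K) : K) / ((b : 𝓞 K) : K) →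
        Φ (bostConnesElt f z) = α (restrictToIntegral f) *
          (star (RingCStarAlgebra.s b) * RingCStarAlgebra.s a)

end Comparison

end BostConnes

end

/-!
Since `h_K = 1`, every idele is a product of a principal idele, an integral unit and an infinite
idele; `K` has at most one real place, so a sign change makes the infinite part positive. Thus
`ô^* → 𝔸^*/U` is onto and every point of `X` has the form `[(1, y)]`, which makes `φ^*` a
homeomorphism; the same argument for ideals gives `𝔸_f^*/ô^* ≅ G/(G ∩ o^*)` and, after fixing
generators of the prime ideals, a multiplicative section `σ` with values in `G`.

The subsets `n + m ô` generate `C(ô)`, so Gelfand duality turns the commuting projections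
`u^n s_m s_m^* u^{-n}` into a representation of `C(ô)`. Restriction of functions from `X` to `ô`,
together with the isometries `s_{σ z}` for integral `σ z`, satisfies the covariance relations of the
crossed product on a semigroup that generates the group. The group is abelian, hence amenable, and
averaging over Følner sets compresses an honest covariant representation on `ℓ²(G, H)` to this pair
up to an arbitrarily small error, so the pair extends to the full crossed product by a contraction,
which is multiplicative on the corner.

Averaging over the dual action of the compact group of characters gives a faithful conditional
expectation of the crossed product onto its coefficient algebra. The extension is therefore
injective on the corner as soon as it dominates the coefficient at the unit; that coefficient can be
read off the diagonal matrix entries in the representation of `𝔄[o]` on `ℓ²(ô)`.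
-/

noncomputable section

universe u

namespace BostConnes

namespace CrossedProduct

section Group

variable {A G : Type u} [NonUnitalCStarAlgebra A] [Group G] {α : G →* (A →⋆ₙₐ[ℂ] A)}

/-- The representation of the full crossed product defined by a covariant representation. -/
def eval (ρ : CovariantRep α) : CrossedProduct α →⋆ₙₐ[ℂ] (ρ.H →L[ℂ] ρ.H) where
  toFun x := x.1.1 ρ
  map_smul' _ _ := rfl
  map_zero' := rfl
  map_add' _ _ := rfl
  map_mul' _ _ := rfl
  map_star' _ := rfl

theorem eval_mk (ρ : CovariantRep α) (a : A) (g : G) :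
    eval ρ (mk α a g) = ρ.π a * (ρ.V g : ρ.H →L[ℂ] ρ.H) := rfl

theorem norm_eval_le (ρ : CovariantRep α) (x : CrossedProduct α) : ‖eval ρ x‖ ≤ ‖x‖ :=
  NonUnitalStarAlgHom.norm_apply_le (eval ρ) x

theorem ext_eval {x y : CrossedProduct α} (h : ∀ ρ, eval ρ x = eval ρ y) : x = y :=
  Subtype.ext (lp.ext (funext h))

theorem norm_le_of_forall_eval {x : CrossedProduct α} {C : ℝ} (hC : 0 ≤ C)
    (h : ∀ ρ, ‖eval ρ x‖ ≤ C) : ‖x‖ ≤ C :=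
  lp.norm_le_of_forall_le hC h

theorem V_mul_π (ρ : CovariantRep α) (g : G) (a : A) :
    (ρ.V g : ρ.H →L[ℂ] ρ.H) * ρ.π a = ρ.π (α g a) * (ρ.V g : ρ.H →L[ℂ] ρ.H) := by
  rw [← ρ.covariant g a, mul_assoc, Unitary.coe_star_mul_self, mul_one]

theorem mk_mul_mk (a b : A) (g h : G) : mk α a g * mk α b h = mk α (a * α g b) (g * h) := by
  refine ext_eval fun ρ => ?_
  rw [map_mul, eval_mk, eval_mk, eval_mk, map_mul, map_mul, Submonoid.coe_mul, mul_assoc,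
    ← mul_assoc (ρ.V g : ρ.H →L[ℂ] ρ.H), V_mul_π]
  simp only [mul_assoc]

theorem star_mk (a : A) (g : G) : star (mk α a g) = mk α (α g⁻¹ (star a)) g⁻¹ := by
  refine ext_eval fun ρ => ?_
  rw [map_star, eval_mk, eval_mk, star_mul, ← map_star, ← V_mul_π, map_inv,
    ← Unitary.star_eq_inv, Unitary.coe_star]

theorem norm_mk_le (a : A) (g : G) : ‖mk α a g‖ ≤ ‖a‖ :=
  norm_le_of_forall_eval (norm_nonneg a) fun ρ => by
    rw [eval_mk, CStarRing.norm_mul_coe_unitary]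
    exact NonUnitalStarAlgHom.norm_apply_le ρ.π a

/-- The finite sums `∑ a_g δ_g` in the crossed product. -/
def ofFinsupp (α : G →* (A →⋆ₙₐ[ℂ] A)) : (G →₀ A) →ₗ[ℂ] CrossedProduct α :=
  Finsupp.lsum ℂ fun g =>
    { toFun a := mk α a g
      map_add' a b := ext_eval fun ρ => by
        rw [map_add, eval_mk, eval_mk, eval_mk, map_add, add_mul]
      map_smul' t a := ext_eval fun ρ => by
        rw [RingHom.id_apply, map_smul, eval_mk, eval_mk, map_smul, smul_mul_assoc] }

@[simp]
theorem ofFinsupp_single (g : G) (a : A) : ofFinsupp α (Finsupp.single g a) = mk α a g := by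
  rw [ofFinsupp, Finsupp.lsum_single]
  rfl

theorem ofFinsupp_eq_sum (c : G →₀ A) : ofFinsupp α c = ∑ g ∈ c.support, mk α (c g) g := by
  simp [ofFinsupp, Finsupp.sum]

/-- The dense *-subalgebra of finite sums `∑ a_g δ_g`, the algebraic crossed product. -/
def finiteSums (α : G →* (A →⋆ₙₐ[ℂ] A)) : NonUnitalStarSubalgebra ℂ (CrossedProduct α) where
  carrier := Set.range (ofFinsupp α)
  add_mem' := by
    rintro _ _ ⟨c, rfl⟩ ⟨d, rfl⟩
    exact ⟨c + d, map_add _ _ _⟩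
  zero_mem' := ⟨0, map_zero _⟩
  smul_mem' := by
    rintro t _ ⟨c, rfl⟩
    exact ⟨t • c, map_smul _ _ _⟩
  mul_mem' := by
    rintro _ _ ⟨c, rfl⟩ ⟨d, rfl⟩
    refine ⟨∑ g ∈ c.support, ∑ h ∈ d.support, Finsupp.single (g * h) (c g * α g (d h)), ?_⟩
    rw [ofFinsupp_eq_sum c, ofFinsupp_eq_sum d]
    simp only [map_sum, ofFinsupp_single, Finset.sum_mul_sum, mk_mul_mk]
  star_mem' := by
    rintro _ ⟨c, rfl⟩
    refine ⟨∑ g ∈ c.support, Finsupp.single g⁻¹ (α g⁻¹ (star (c g))), ?_⟩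
    rw [ofFinsupp_eq_sum c]
    simp only [map_sum, ofFinsupp_single, star_sum, star_mk]

theorem denseRange_ofFinsupp : DenseRange (ofFinsupp α) := by
  intro x
  let T : NonUnitalStarSubalgebra ℂ (CovariantRep.Ambient α) :=
    (finiteSums α).map (NonUnitalStarSubalgebraClass.subtype (crossedProductSubalgebra α))
  have hT : NonUnitalStarAlgebra.adjoin ℂ {x | ∃ (a : A) (g : G), x = CovariantRep.elt α a g}
      ≤ T := by
    refine NonUnitalStarAlgebra.adjoin_le ?_
    rintro _ ⟨a, g, rfl⟩
    exact ⟨mk α a g, ⟨Finsupp.single g a, ofFinsupp_single g a⟩, rfl⟩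
  have hx : x.1 ∈ closure (T : Set (CovariantRep.Ambient α)) := closure_mono hT x.2
  refine closure_subtype.2 (closure_mono ?_ hx)
  rintro _ ⟨y, hy, rfl⟩
  exact ⟨y, hy, rfl⟩

theorem continuous_starHom {B : Type*} [NonUnitalCStarAlgebra B]
    (f : CrossedProduct α →⋆ₙₐ[ℂ] B) : Continuous f :=
  open scoped CStarAlgebra in map_continuous f

theorem eq_of_forall_mk {E F F' : Type*} [AddCommMonoid E] [TopologicalSpace E] [T2Space E]
    [FunLike F (CrossedProduct α) E] [AddMonoidHomClass F (CrossedProduct α) E]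
    [FunLike F' (CrossedProduct α) E] [AddMonoidHomClass F' (CrossedProduct α) E]
    {f : F} {g : F'} (hf : Continuous f) (hg : Continuous g)
    (h : ∀ a k, f (mk α a k) = g (mk α a k)) (x : CrossedProduct α) : f x = g x := by
  refine congrFun (denseRange_ofFinsupp.equalizer hf hg (funext fun c => ?_)) x
  simp only [Function.comp_apply, ofFinsupp_eq_sum, map_sum, h]

section Functoriality

variable {A' G' : Type u} [NonUnitalCStarAlgebra A'] [Group G'] {α' : G' →* (A' →⋆ₙₐ[ℂ] A')}

/-- The inclusion of the circle into the unitary group of `ℂ`. -/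
def circleToUnitary : Circle →* unitary ℂ where
  toFun z := ⟨z, Unitary.mem_iff.2 (by simp [Complex.mul_conj, ← Complex.normSq_eq_conj_mul_self])⟩
  map_one' := rfl
  map_mul' _ _ := rfl

/-- The pullback of a covariant representation along a morphism `(φ, γ)` of dynamical systems,
with its unitaries multiplied by a character of the group. -/
def pullback (φ : A →⋆ₙₐ[ℂ] A') (γ : G →* G') (χ : G →* Circle)
    (h : ∀ g a, φ (α g a) = α' (γ g) (φ a)) (ρ : CovariantRep α') : CovariantRep α where
  H := ρ.H
  π := ρ.π.comp φ
  V :=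
    { toFun g := circleToUnitary (χ g) • ρ.V (γ g)
      map_one' := by simp only [map_one, one_smul]
      map_mul' g k := Subtype.ext <| by
        rw [map_mul, map_mul, map_mul, map_mul]
        exact (smul_mul_smul_comm (circleToUnitary (χ g) : ℂ) (ρ.V (γ g) : ρ.H →L[ℂ] ρ.H)
          (circleToUnitary (χ k) : ℂ) (ρ.V (γ k) : ρ.H →L[ℂ] ρ.H)).symm }
  covariant g a := by
    change ((circleToUnitary (χ g) : ℂ) • (ρ.V (γ g) : ρ.H →L[ℂ] ρ.H)) * ρ.π (φ a) *
      star ((circleToUnitary (χ g) : ℂ) • (ρ.V (γ g) : ρ.H →L[ℂ] ρ.H)) = ρ.π (φ (α g a))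
    rw [star_smul, smul_mul_assoc, smul_mul_smul_comm,
      Unitary.mul_star_self_of_mem (circleToUnitary (χ g)).2, one_smul, ρ.covariant, h]

/-- The *-homomorphism `a δ_g ↦ χ(g) φ(a) δ_{γ g}` of crossed products. -/
def map (φ : A →⋆ₙₐ[ℂ] A') (γ : G →* G') (χ : G →* Circle)
    (h : ∀ g a, φ (α g a) = α' (γ g) (φ a)) : CrossedProduct α →⋆ₙₐ[ℂ] CrossedProduct α' := by
  let Ψ : CrossedProduct α →⋆ₙₐ[ℂ] CovariantRep.Ambient α' :=
    { toFun x := ⟨fun ρ => eval (pullback φ γ χ h ρ) x, memℓp_infty ⟨‖x‖, by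
        rintro _ ⟨ρ, rfl⟩
        exact norm_eval_le (pullback φ γ χ h ρ) x⟩⟩
      map_smul' _ _ := rfl
      map_zero' := rfl
      map_add' _ _ := rfl
      map_mul' _ _ := rfl
      map_star' _ := rfl }
  have mk_mem : ∀ a g, Ψ (mk α a g) ∈ crossedProductSubalgebra α' := by
    intro a g
    have heq : Ψ (mk α a g) = ((χ g : ℂ) • mk α' (φ a) (γ g) : CrossedProduct α').1 :=
      lp.ext (funext fun ρ => mul_smul_comm (χ g : ℂ) (ρ.π (φ a)) (ρ.V (γ g) : ρ.H →L[ℂ] ρ.H))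
    exact heq ▸ Subtype.prop _
  refine NonUnitalStarAlgHom.codRestrict Ψ (crossedProductSubalgebra α') fun x => ?_
  refine denseRange_ofFinsupp.induction_on x
    (isClosed_closure.preimage (continuous_starHom Ψ)) fun c => ?_
  simp only [ofFinsupp_eq_sum, map_sum]
  exact sum_mem fun g _ => mk_mem (c g) g

theorem map_mk (φ : A →⋆ₙₐ[ℂ] A') (γ : G →* G') (χ : G →* Circle)
    (h : ∀ g a, φ (α g a) = α' (γ g) (φ a)) (a : A) (g : G) :
    map φ γ χ h (mk α a g) = (χ g : ℂ) • mk α' (φ a) (γ g) :=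
  ext_eval fun ρ => mul_smul_comm (χ g : ℂ) (ρ.π (φ a)) (ρ.V (γ g) : ρ.H →L[ℂ] ρ.H)

/-- The isomorphism of crossed products induced by an isomorphism of dynamical systems. -/
def congr (φ : A ≃⋆ₐ[ℂ] A') (γ : G ≃* G') (h : ∀ g a, φ (α g a) = α' (γ g) (φ a)) :
    CrossedProduct α ≃⋆ₐ[ℂ] CrossedProduct α' := by
  let f := map (α := α) (α' := α') (φ : A →⋆ₙₐ[ℂ] A') γ.toMonoidHom 1 h
  let f' := map (α := α') (α' := α) (φ.symm : A' →⋆ₙₐ[ℂ] A) γ.symm.toMonoidHom 1 fun g a =>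
    φ.injective <| by
      have := h (γ.symm g) (φ.symm a)
      rw [γ.apply_symm_apply, φ.apply_symm_apply] at this
      exact (φ.apply_symm_apply _).trans this.symm
  have hl : Function.LeftInverse f' f :=
    eq_of_forall_mk (f := f'.comp f) (g := NonUnitalStarAlgHom.id ℂ _)
      (continuous_starHom _) continuous_id fun a k => by
        simp [f, f', map_mk]
  have hr : Function.RightInverse f' f :=
    eq_of_forall_mk (f := f.comp f') (g := NonUnitalStarAlgHom.id ℂ _)
      (continuous_starHom _) continuous_id fun a k => by
        simp [f, f', map_mk]
  exact StarAlgEquiv.ofBijective f ⟨hl.injective, hr.surjective⟩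

theorem congr_mk (φ : A ≃⋆ₐ[ℂ] A') (γ : G ≃* G') (h : ∀ g a, φ (α g a) = α' (γ g) (φ a))
    (a : A) (g : G) : congr φ γ h (mk α a g) = mk α' (φ a) (γ g) :=
  (map_mk (α := α) (α' := α') (φ : A →⋆ₙₐ[ℂ] A') γ.toMonoidHom 1 h a g).trans (one_smul ℂ _)

end Functoriality

end Group

end CrossedProduct

section Characters

variable {G : Type*} [CommGroup G]

theorem exists_circle_character_ne_one {g : G} (hg : g ≠ 1) : ∃ χ : G →* Circle, χ g ≠ 1 := by
  let j : AddCircle (1 : ℚ) →+ AddCircle (1 : ℝ) :=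
    QuotientAddGroup.map _ _ (Rat.castHom ℝ).toAddMonoidHom <|
      AddSubgroup.zmultiples_le.2 <| AddSubgroup.mem_zmultiples_iff.2 ⟨1, by simp⟩
  have j_eq_zero : ∀ t, j t = 0 → t = 0 := by
    intro t ht
    induction t using QuotientAddGroup.induction_on with
    | H q =>
      obtain ⟨n, hn⟩ := (AddCircle.coe_eq_zero_iff (1 : ℝ)).1
        (ht : (((q : ℚ) : ℝ) : AddCircle (1 : ℝ)) = 0)
      exact (AddCircle.coe_eq_zero_iff (1 : ℚ)).2 ⟨n, by
        rw [zsmul_one] at hn ⊢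
        exact Rat.cast_injective (α := ℝ) ((Rat.cast_intCast n).trans hn)⟩
  obtain ⟨c, hc⟩ := CharacterModule.exists_character_apply_ne_zero_of_ne_zero
    (show Additive.ofMul g ≠ 0 from hg)
  refine ⟨MonoidHom.mk' (fun x => AddCircle.toCircle (j (c (Additive.ofMul x)))) fun x y => ?_,
    fun h => hc (j_eq_zero _ (AddCircle.injective_toCircle one_ne_zero ?_))⟩
  · rw [ofMul_mul, map_add, map_add, AddCircle.toCircle_add]
  · rw [AddCircle.toCircle_zero]
    exact h

variable [TopologicalSpace G]

local instance : MeasurableSpace (PontryaginDual G) := borel _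

local instance : BorelSpace (PontryaginDual G) := ⟨rfl⟩

theorem continuous_coe_character (g : G) : Continuous fun χ : PontryaginDual G => (χ g : ℂ) :=
  continuous_induced_dom.comp (continuous_eval_const (F := G →ₜ* Circle) g)

variable [DiscreteTopology G]

variable (G) in
/-- The normalised Haar measure of the compact group of characters of a discrete group. -/
def characterHaar : MeasureTheory.Measure (PontryaginDual G) :=
  MeasureTheory.Measure.haarMeasure ⊤

instance : MeasureTheory.IsProbabilityMeasure (characterHaar G) :=
  ⟨MeasureTheory.Measure.haarMeasure_self⟩

instance : MeasureTheory.Measure.IsHaarMeasure (characterHaar G) :=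
  MeasureTheory.Measure.isHaarMeasure_haarMeasure ⊤

theorem integral_character_eq_zero {g : G} (hg : g ≠ 1) :
    ∫ χ : PontryaginDual G, (χ g : ℂ) ∂characterHaar G = 0 := by
  obtain ⟨ψ, hψ⟩ := exists_circle_character_ne_one hg
  let ψ' : PontryaginDual G := (⟨ψ, continuous_of_discreteTopology⟩ : G →ₜ* Circle)
  have invariance : (ψ g : ℂ) * ∫ χ : PontryaginDual G, (χ g : ℂ) ∂characterHaar G =
      ∫ χ : PontryaginDual G, (χ g : ℂ) ∂characterHaar G := by
    rw [← MeasureTheory.integral_const_mul]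
    exact MeasureTheory.integral_mul_left_eq_self
      (fun χ : PontryaginDual G => (χ g : ℂ)) ψ'
  refine (mul_left_eq_self₀.1 invariance).resolve_left fun h => hψ (Circle.ext h)

end Characters

namespace CrossedProduct

section Expectation

variable {A G : Type u} [NonUnitalCStarAlgebra A] [CommGroup G] {α : G →* (A →⋆ₙₐ[ℂ] A)}

/-- The dual action `a δ_g ↦ χ(g) a δ_g` of the characters `χ` of the group. -/
def dual (χ : G →* Circle) : CrossedProduct α →⋆ₙₐ[ℂ] CrossedProduct α :=
  map (NonUnitalStarAlgHom.id ℂ A) (MonoidHom.id G) χ fun _ _ => rfl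

theorem dual_mk (χ : G →* Circle) (a : A) (g : G) : dual χ (mk α a g) = (χ g : ℂ) • mk α a g :=
  map_mk _ _ _ _ a g

theorem dual_one (x : CrossedProduct α) : dual 1 x = x :=
  eq_of_forall_mk (f := dual 1) (g := NonUnitalStarAlgHom.id ℂ _) (continuous_starHom _)
    continuous_id (fun a g => by simp [dual_mk]) x

theorem norm_dual_le (χ : G →* Circle) (x : CrossedProduct α) : ‖dual χ x‖ ≤ ‖x‖ :=
  NonUnitalStarAlgHom.norm_apply_le _ x

theorem dual_mk_one_mul (χ : G →* Circle) (a : A) (x : CrossedProduct α) :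
    dual χ (mk α a 1 * x) = mk α a 1 * dual χ x := by
  rw [map_mul, dual_mk, map_one, Circle.coe_one, one_smul]

/-- The functional `x ↦ ⟪ξ, x ξ⟫` defined by a vector of a covariant representation. -/
def vectorFunctional (ρ : CovariantRep α) (ξ : ρ.H) : CrossedProduct α →L[ℂ] ℂ :=
  (innerSL ℂ ξ).comp <| (ContinuousLinearMap.apply ℂ ρ.H ξ).comp
    ⟨(eval ρ : CrossedProduct α →ₗ[ℂ] ρ.H →L[ℂ] ρ.H), continuous_starHom (eval ρ)⟩

theorem vectorFunctional_star_mul_self (ρ : CovariantRep α) (ξ : ρ.H) (x : CrossedProduct α) :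
    vectorFunctional ρ ξ (star x * x) = ((‖eval ρ x ξ‖ ^ 2 : ℝ) : ℂ) := by
  change inner ℂ ξ (eval ρ (star x * x) ξ) = _
  rw [map_mul, map_star, ContinuousLinearMap.star_eq_adjoint, mul_apply_eq_comp,
    ContinuousLinearMap.adjoint_inner_right, inner_self_eq_norm_sq_to_K]
  norm_cast

variable [TopologicalSpace G]

local instance : MeasurableSpace (PontryaginDual G) := borel _

local instance : BorelSpace (PontryaginDual G) := ⟨rfl⟩

theorem continuous_dual_apply (x : CrossedProduct α) :
    Continuous fun χ : PontryaginDual G => dual (χ : G →* Circle) x := by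
  refine continuous_of_uniform_approx_of_continuous fun U hU => ?_
  obtain ⟨ε, hε, hεU⟩ := Metric.mem_uniformity_dist.1 hU
  obtain ⟨c, hc⟩ := denseRange_ofFinsupp.exists_dist_lt x hε
  refine ⟨fun χ => dual (χ : G →* Circle) (ofFinsupp α c), ?_, fun χ => hεU ?_⟩
  · simp only [ofFinsupp_eq_sum, map_sum, dual_mk]
    exact continuous_finsetSum _ fun g _ => (continuous_coe_character g).smul continuous_const
  · rw [dist_eq_norm, ← map_sub]
    exact (norm_dual_le _ _).trans_lt (dist_eq_norm x _ ▸ hc)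

variable [DiscreteTopology G]

theorem integrable_dual_apply (x : CrossedProduct α) : MeasureTheory.Integrable
    (fun χ : PontryaginDual G => dual (χ : G →* Circle) x) (characterHaar G) :=
  (continuous_dual_apply x).integrable_of_hasCompactSupport (HasCompactSupport.of_compactSpace _)

/-- The canonical conditional expectation onto the coefficient algebra, as the average over the
dual action. -/
def expectation : CrossedProduct α →L[ℂ] CrossedProduct α :=
  LinearMap.mkContinuous
    { toFun x := ∫ χ : PontryaginDual G, dual (χ : G →* Circle) x ∂characterHaar G
      map_add' x y := by
        simp only [map_add]
        exact MeasureTheory.integral_add (integrable_dual_apply x) (integrable_dual_apply y)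
      map_smul' t x := by
        simp only [map_smul]
        exact MeasureTheory.integral_smul t _ }
    1 fun x => by
      refine (MeasureTheory.norm_integral_le_of_norm_le_const
        (Filter.Eventually.of_forall fun χ : PontryaginDual G => norm_dual_le _ x)).trans_eq ?_
      rw [MeasureTheory.probReal_univ, mul_one, one_mul]

theorem expectation_apply (x : CrossedProduct α) : expectation x =
    ∫ χ : PontryaginDual G, dual (χ : G →* Circle) x ∂characterHaar G := rfl

theorem expectation_ofFinsupp (c : G →₀ A) :
    expectation (ofFinsupp α c) = mk α (c 1) 1 := by
  classical
  have expectation_mk : ∀ (a : A) (g : G),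
      expectation (mk α a g) = if g = 1 then mk α a g else 0 := by
    intro a g
    simp only [expectation_apply, dual_mk, integral_smul_const]
    change (∫ χ : PontryaginDual G, (χ g : ℂ) ∂characterHaar G) • mk α a g = _
    split_ifs with hg
    · simp [hg]
    · rw [integral_character_eq_zero hg, zero_smul]
  rw [ofFinsupp_eq_sum, map_sum]
  simp only [expectation_mk, Finset.sum_ite_eq']
  split_ifs with h
  · rfl
  · rw [Finsupp.notMem_support_iff.1 h, ← ofFinsupp_single, Finsupp.single_zero, map_zero]

theorem expectation_mk_one_mul (a : A) (x : CrossedProduct α) :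
    expectation (mk α a 1 * x) = mk α a 1 * expectation x := by
  simp only [expectation_apply, dual_mk_one_mul]
  exact (ContinuousLinearMap.mul ℂ _ (mk α a 1)).integral_comp_comm (integrable_dual_apply x)

theorem eq_zero_of_expectation_star_mul_self {x : CrossedProduct α}
    (h : expectation (star x * x) = 0) : x = 0 := by
  refine ext_eval fun ρ => ContinuousLinearMap.ext fun ξ => ?_
  let f : PontryaginDual G → ℝ := fun χ => ‖eval ρ (dual (χ : G →* Circle) x) ξ‖ ^ 2
  have f_continuous : Continuous f :=
    ((continuous_eval_const ξ).comp
      ((continuous_starHom (eval ρ)).comp (continuous_dual_apply x))).norm.pow 2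
  have integral_f : ∫ χ, f χ ∂characterHaar G = 0 := by
    refine Complex.ofReal_injective ?_
    calc ((∫ χ, f χ ∂characterHaar G : ℝ) : ℂ)
        = ∫ χ : PontryaginDual G, vectorFunctional ρ ξ
            (dual (χ : G →* Circle) (star x * x)) ∂characterHaar G := by
          rw [← integral_complex_ofReal]
          simp only [map_mul, map_star, vectorFunctional_star_mul_self]
          rfl
      _ = vectorFunctional ρ ξ (expectation (star x * x)) :=
          ContinuousLinearMap.integral_comp_comm _ (integrable_dual_apply _)
      _ = ((0 : ℝ) : ℂ) := by rw [h, map_zero, Complex.ofReal_zero]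
  have f_eq_zero : f = 0 := (f_continuous.ae_eq_iff_eq _ continuous_const).1 <|
    (MeasureTheory.integral_eq_zero_iff_of_nonneg (fun χ => by positivity)
      (f_continuous.integrable_of_hasCompactSupport (HasCompactSupport.of_compactSpace _))).1
      integral_f
  have : ‖eval ρ (dual 1 x) ξ‖ ^ 2 = 0 := congrFun f_eq_zero 1
  rwa [dual_one, sq_eq_zero_iff, norm_eq_zero] at this

end Expectation

theorem injective_of_norm_coeff_le {A G : Type u} {B : Type*} [NonUnitalCStarAlgebra A]
    [CommGroup G] {α : G →* (A →⋆ₙₐ[ℂ] A)} [NonUnitalCStarAlgebra B] {e : A}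
    (he : IsStarProjection (mk α e 1)) (L : CrossedProduct α →L[ℂ] B)
    (Φ : corner (mk α e 1) he →⋆ₙₐ[ℂ] B) (hΦ : ∀ x, Φ x = L x)
    (hc : ∀ c : G →₀ A, ‖e * c 1‖ ≤ ‖L (ofFinsupp α c)‖) : Function.Injective Φ := by
  let _ : TopologicalSpace G := ⊥
  have : DiscreteTopology G := ⟨rfl⟩
  have norm_expectation_le : ∀ y, ‖mk α e 1 * expectation y‖ ≤ ‖L y‖ := by
    intro y
    refine denseRange_ofFinsupp.induction_on (p := fun y => ‖mk α e 1 * expectation y‖ ≤ ‖L y‖) y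
      (isClosed_le (by fun_prop) (by fun_prop)) fun c => ?_
    rw [expectation_ofFinsupp, mk_mul_mk, map_one, one_mul]
    exact (norm_mk_le _ _).trans (hc c)
  refine (injective_iff_map_eq_zero Φ).2 fun x hx => Subtype.ext ?_
  obtain ⟨b, hb⟩ := (star x * x).2
  have mul_eq :
      mk α e 1 * (star (x : CrossedProduct α) * x) = star (x : CrossedProduct α) * x := by
    rw [show star (x : CrossedProduct α) * x = mk α e 1 * b * mk α e 1 from hb, ← mul_assoc,
      ← mul_assoc, he.isIdempotentElem]
  have map_eq_zero : L (star (x : CrossedProduct α) * x) = 0 := by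
    rw [← show Φ (star x * x) = L (star (x : CrossedProduct α) * x) from hΦ (star x * x), map_mul,
      hx, mul_zero]
  refine eq_zero_of_expectation_star_mul_self (norm_le_zero_iff.1 ?_)
  rw [← mul_eq, expectation_mk_one_mul]
  exact (norm_expectation_le _).trans_eq (by rw [map_eq_zero, norm_zero])

end CrossedProduct

section SquareSummable

variable {Ω Ω' H : Type*} [NormedAddCommGroup H] [InnerProductSpace ℂ H]

/-- Composition with an injective map `j`, as an operator between spaces of square summable
functions. -/
def l2Comp (H : Type*) [NormedAddCommGroup H] [InnerProductSpace ℂ H] (j : Ω → Ω')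
    (hj : Function.Injective j) :
    lp (fun _ : Ω' => H) 2 →L[ℂ] lp (fun _ : Ω => H) 2 :=
  LinearMap.mkContinuous
    { toFun ζ := ⟨fun ω => ζ (j ω), memℓp_gen
        (((lp.memℓp ζ).summable (by norm_num)).comp_injective hj)⟩
      map_add' _ _ := rfl
      map_smul' _ _ := rfl } 1 fun ζ => by
    rw [one_mul]
    refine lp.norm_le_of_tsum_le (by norm_num) (norm_nonneg _) ?_
    rw [lp.norm_rpow_eq_tsum (by norm_num)]
    have hs := (lp.memℓp ζ).summable (p := 2) (by norm_num)
    exact (hs.comp_injective hj).tsum_le_tsum_of_inj j hj (fun _ _ => by positivity)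
      (fun _ => le_rfl) hs

@[simp]
theorem l2Comp_apply (j : Ω → Ω') (hj : Function.Injective j) (ζ : lp (fun _ : Ω' => H) 2)
    (ω : Ω) : l2Comp H j hj ζ ω = ζ (j ω) := rfl

/-- The unitary operator on square summable functions defined by a permutation. -/
def l2Perm (H : Type*) [NormedAddCommGroup H] [InnerProductSpace ℂ H] (e : Ω ≃ Ω) :
    lp (fun _ : Ω => H) 2 ≃ₗᵢ[ℂ] lp (fun _ : Ω => H) 2 where
  toFun := l2Comp H e.symm e.symm.injective
  invFun := l2Comp H e e.injective
  map_add' := map_add _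
  map_smul' := map_smul _
  left_inv ζ := lp.ext (funext fun ω => by simp)
  right_inv ζ := lp.ext (funext fun ω => by simp)
  norm_map' ζ := by
    have h2 : (0 : ℝ) < (2 : ℝ≥0∞).toReal := by norm_num
    refine (Real.rpow_left_inj (norm_nonneg _) (norm_nonneg _) h2.ne').1 ?_
    rw [lp.norm_rpow_eq_tsum h2, lp.norm_rpow_eq_tsum h2]
    exact e.symm.tsum_eq fun ω => ‖ζ ω‖ ^ (2 : ℝ≥0∞).toReal

/-- The diagonal operator on square summable functions defined by a bounded family of operators. -/
def diagonalOp (T : Ω → H →L[ℂ] H) {C : ℝ} (hC : ∀ ω, ‖T ω‖ ≤ C) :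
    lp (fun _ : Ω => H) 2 →L[ℂ] lp (fun _ : Ω => H) 2 :=
  have norm_le : ∀ ω v, ‖T ω v‖ ≤ ‖C • v‖ := fun ω v => by
    rw [norm_smul]
    exact (T ω).le_of_opNorm_le ((hC ω).trans (le_abs_self C)) v
  LinearMap.mkContinuous
    { toFun ζ := ⟨fun ω => T ω (ζ ω), (lp.memℓp (C • ζ)).mono' fun ω => norm_le ω (ζ ω)⟩
      map_add' ζ ζ' := lp.ext (funext fun ω => map_add (T ω) (ζ ω) (ζ' ω))
      map_smul' t ζ := lp.ext (funext fun ω => map_smul (T ω) t (ζ ω)) } ‖C‖ fun ζ =>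
    (lp.norm_mono two_ne_zero (y := C • ζ) fun ω => norm_le ω (ζ ω)).trans_eq (norm_smul C ζ)

/-- The direct sum of a family of representations on the same Hilbert space. -/
def diagonalRep {A : Type*} [NonUnitalCStarAlgebra A] [CompleteSpace H]
    (β : Ω → A →⋆ₙₐ[ℂ] (H →L[ℂ] H)) :
    A →⋆ₙₐ[ℂ] (lp (fun _ : Ω => H) 2 →L[ℂ] lp (fun _ : Ω => H) 2) where
  toFun a := diagonalOp (fun ω => β ω a) fun ω => NonUnitalStarAlgHom.norm_apply_le (β ω) a
  map_smul' t a := ContinuousLinearMap.ext fun ζ => lp.ext <| funext fun ω =>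
    congr($(map_smul (β ω) t a) (ζ ω))
  map_zero' := ContinuousLinearMap.ext fun ζ => lp.ext <| funext fun ω =>
    congr($(map_zero (β ω)) (ζ ω))
  map_add' a b := ContinuousLinearMap.ext fun ζ => lp.ext <| funext fun ω =>
    congr($(map_add (β ω) a b) (ζ ω))
  map_mul' a b := ContinuousLinearMap.ext fun ζ => lp.ext <| funext fun ω =>
    congr($(map_mul (β ω) a b) (ζ ω))
  map_star' a := by
    rw [ContinuousLinearMap.star_eq_adjoint]
    refine (ContinuousLinearMap.eq_adjoint_iff _ _).2 fun ζ ζ' => ?_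
    rw [lp.inner_eq_tsum, lp.inner_eq_tsum]
    refine tsum_congr fun ω => ?_
    change inner ℂ (β ω (star a) (ζ ω)) (ζ' ω) = inner ℂ (ζ ω) (β ω a (ζ' ω))
    rw [map_star, ContinuousLinearMap.star_eq_adjoint, ContinuousLinearMap.adjoint_inner_left]

end SquareSummable

section Foelner

open scoped Pointwise

variable {G : Type*} [CommGroup G] [DecidableEq G]

theorem exists_exponents_of_mem_pow {M : Type*} [CommMonoid M] [DecidableEq M] (E : Finset M)
    (n : ℕ) : ∀ x ∈ E ^ n, ∃ e : M → ℕ, (∀ z, e z ≤ n) ∧ x = ∏ z ∈ E, z ^ e z := by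
  induction n with
  | zero =>
    intro x hx
    rw [pow_zero, Finset.mem_one] at hx
    exact ⟨0, fun _ => le_rfl, by simp [hx]⟩
  | succ n ih =>
    intro x hx
    rw [pow_succ, Finset.mem_mul] at hx
    obtain ⟨y, hy, w, hw, rfl⟩ := hx
    obtain ⟨e, he, rfl⟩ := ih y hy
    refine ⟨e + Pi.single w 1, fun z => add_le_add (he z) ?_, ?_⟩
    · rw [Pi.single_apply]
      split_ifs <;> simp
    · simp only [Pi.add_apply, pow_add, Finset.prod_mul_distrib, Pi.single_apply, pow_ite, pow_one,
        pow_zero, Finset.prod_ite_eq', if_pos hw]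

theorem card_pow_le_succ_pow {M : Type*} [CommMonoid M] [DecidableEq M] (E : Finset M) (n : ℕ) :
    (E ^ n).card ≤ (n + 1) ^ E.card := by
  choose! e he hx using exists_exponents_of_mem_pow E n
  calc (E ^ n).card ≤ (Fintype.piFinset fun _ : E => Finset.range (n + 1)).card := by
        refine Finset.card_le_card_of_injOn (fun x z => e x z) (fun x hx => ?_) ?_
        · exact Fintype.mem_piFinset.2 fun z => Finset.mem_range.2 (Nat.lt_succ_of_le (he x hx z))
        · intro x hx' y hy' hxy
          rw [hx x hx', hx y hy']
          exact Finset.prod_congr rfl fun z hz => congrArg (z ^ ·) (congrFun hxy ⟨z, hz⟩)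
    _ = (n + 1) ^ E.card := by simp

theorem exists_one_sub_mul_card_pow_succ_le {M : Type*} [CommMonoid M] [DecidableEq M]
    (E : Finset M) {ε : ℝ} (hε : 0 < ε) :
    ∃ n, (1 - ε) * ((E ^ (n + 1)).card : ℝ) ≤ (E ^ n).card := by
  by_contra! h
  have hε1 : 0 < 1 - ε := pos_of_mul_pos_left ((Nat.cast_nonneg _).trans_lt (h 0))
    (Nat.cast_nonneg _)
  have one_le : ∀ n, 1 ≤ (1 - ε) ^ n * (E ^ n).card := by
    intro n
    induction n with
    | zero => simp
    | succ n ih =>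
      rw [pow_succ, mul_assoc]
      exact ih.trans (mul_le_mul_of_nonneg_left (h n).le (by positivity))
  have tendsto_zero := (tendsto_pow_const_mul_const_pow_of_abs_lt_one E.card (r := 1 - ε)
    (abs_lt.2 ⟨by linarith, by linarith⟩)).comp (Filter.tendsto_add_atTop_nat 1)
  obtain ⟨n, hn⟩ := (tendsto_zero.eventually (gt_mem_nhds hε1)).exists
  have hcard : ((E ^ n).card : ℝ) ≤ ((n + 1 : ℕ) : ℝ) ^ E.card := by
    exact_mod_cast card_pow_le_succ_pow E n
  have : 1 - ε ≤ ((n + 1 : ℕ) : ℝ) ^ E.card * (1 - ε) ^ (n + 1) := by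
    calc 1 - ε ≤ (1 - ε) * ((1 - ε) ^ n * (E ^ n).card) :=
          le_mul_of_one_le_right hε1.le (one_le n)
      _ ≤ (1 - ε) * ((1 - ε) ^ n * ((n + 1 : ℕ) : ℝ) ^ E.card) := by gcongr
      _ = _ := by ring
  exact this.not_gt hn

theorem card_pow_le_card_filter_inv_pow_succ {E : Finset G} {p q : G} (hp : p ∈ E) (hq : q ∈ E)
    (n : ℕ) : (E ^ n).card ≤
      ((E ^ (n + 1))⁻¹.filter fun h => (p * q⁻¹)⁻¹ * h ∈ (E ^ (n + 1))⁻¹).card := by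
  refine Finset.card_le_card_of_injOn (fun c => (c * q)⁻¹) (fun c hc => ?_)
    fun c _ d _ hcd => mul_right_cancel (inv_injective hcd)
  have hmul : ((p * q⁻¹)⁻¹ * (c * q)⁻¹)⁻¹ = c * p := by
    rw [mul_inv_rev, inv_inv, inv_inv, mul_assoc, mul_comm q, inv_mul_cancel_right]
  rw [Finset.mem_coe, Finset.mem_filter, Finset.mem_inv', Finset.mem_inv', inv_inv, hmul, pow_succ]
  exact ⟨Finset.mul_mem_mul hc hq, Finset.mul_mem_mul hc hp⟩

theorem exists_foelner_inv_mem (P : Submonoid G) (hP : ∀ g : G, ∃ p ∈ P, ∃ q ∈ P, g = p * q⁻¹)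
    (F : Finset G) {ε : ℝ} (hε : 0 < ε) :
    ∃ T : Finset G, T.Nonempty ∧ (∀ h ∈ T, h⁻¹ ∈ P) ∧
      ∀ g ∈ F, (1 - ε) * (T.card : ℝ) ≤ ((T.filter fun h => g⁻¹ * h ∈ T).card : ℝ) := by
  choose p hp q hq hpq using hP
  let E : Finset G := insert 1 (F.image p ∪ F.image q)
  have E_subset : ∀ x ∈ E, x ∈ P := by
    intro x hx
    simp only [E, Finset.mem_insert, Finset.mem_union, Finset.mem_image] at hx
    rcases hx with rfl | ⟨g, _, rfl⟩ | ⟨g, _, rfl⟩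
    exacts [one_mem P, hp g, hq g]
  obtain ⟨n, hn⟩ := exists_one_sub_mul_card_pow_succ_le E hε
  refine ⟨(E ^ (n + 1))⁻¹, (Finset.Nonempty.pow ⟨1, Finset.mem_insert_self _ _⟩).inv,
    fun h hh => ?_, fun g hg => ?_⟩
  · obtain ⟨e, -, he⟩ := exists_exponents_of_mem_pow E _ _ (Finset.mem_inv'.1 hh)
    exact he ▸ prod_mem fun z hz => pow_mem (E_subset z hz) _
  · have hpE : p g ∈ E := by simp [E, Finset.mem_image_of_mem p hg]
    have hqE : q g ∈ E := by simp [E, Finset.mem_image_of_mem q hg]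
    have hle := card_pow_le_card_filter_inv_pow_succ hpE hqE n
    rw [← hpq] at hle
    rw [Finset.card_inv]
    exact hn.trans (Nat.cast_le.2 hle)

theorem norm_sum_le_of_forall_weights {ι E : Type*} [SeminormedAddCommGroup E] [NormedSpace ℝ E]
    {F : Finset ι} {x : ι → E} {C : ℝ}
    (h : ∀ ε > 0, ∃ w : ι → ℝ, (∀ i ∈ F, 1 - ε ≤ w i ∧ w i ≤ 1) ∧ ‖∑ i ∈ F, w i • x i‖ ≤ C) :
    ‖∑ i ∈ F, x i‖ ≤ C := by
  choose w hw hC using fun n : ℕ => h (1 / ((n : ℝ) + 1)) (by positivity)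
  have tendsto_one : ∀ i ∈ F, Filter.Tendsto (fun n => w n i) Filter.atTop (nhds 1) := by
    intro i hi
    refine tendsto_of_tendsto_of_tendsto_of_le_of_le ?_ tendsto_const_nhds
      (fun n => (hw n i hi).1) fun n => (hw n i hi).2
    simpa using (tendsto_one_div_add_atTop_nhds_zero_nat (𝕜 := ℝ)).const_sub 1
  have tendsto_sum : Filter.Tendsto (fun n => ∑ i ∈ F, w n i • x i) Filter.atTop
      (nhds (∑ i ∈ F, x i)) := by
    refine tendsto_finsetSum _ fun i hi => ?_
    simpa using (tendsto_one i hi).smul_const (x i)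
  exact le_of_tendsto' tendsto_sum.norm hC

end Foelner

section CovariantPairs

theorem star_mul_eq_star_mul_of_mul_eq_mul {M B : Type*} [CommMagma M] [Monoid B] [StarMul B]
    {S : M → B} (isometry : ∀ p, star (S p) * S p = 1)
    (isometry_mul : ∀ p q, S (p * q) = S p * S q) {a b a' b' : M} (h : a * b' = a' * b) :
    star (S b) * S a = star (S b') * S a' :=
  calc star (S b) * S a = star (S b) * (star (S b') * S b') * S a := by rw [isometry, mul_one]
    _ = star (S (b' * b)) * S (b' * a) := by
        rw [isometry_mul, isometry_mul, star_mul]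
        simp only [mul_assoc]
    _ = star (S (b * b')) * S (b * a') := by rw [mul_comm b' a, h, mul_comm a' b, mul_comm b' b]
    _ = star (S b') * (star (S b) * S b) * S a' := by
        rw [isometry_mul, isometry_mul, star_mul]
        simp only [mul_assoc]
    _ = star (S b') * S a' := by rw [isometry, mul_one]

/-- A representation `β` of `A` together with a representation `S` by isometries of a submonoid
`P` of the group `G` acting on `A`, such that `S p` implements the action of `p ∈ P` and the range
projection of `S p` is the image of `p e`. -/
structure IsCovariantPair {A G : Type*} [NonUnitalCStarAlgebra A] [CommGroup G]
    (α : G →* (A →⋆ₙₐ[ℂ] A)) (P : Submonoid G) (e : A) {B : Type*} [CStarAlgebra B]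
    (β : A →⋆ₙₐ[ℂ] B) (S : G → B) : Prop where
  exists_fraction : ∀ g : G, ∃ p ∈ P, ∃ q ∈ P, g = p * q⁻¹
  isometry : ∀ p ∈ P, star (S p) * S p = 1
  isometry_mul : ∀ p ∈ P, ∀ q ∈ P, S (p * q) = S p * S q
  covariant : ∀ p ∈ P, ∀ a, β (α p a) * S p = S p * β a
  range_proj : ∀ p ∈ P, S p * star (S p) = β (α p e)
  proj_mul : ∀ a, β (e * a) = β a
  proj_comm : ∀ a, a * e = e * a
  proj_idem : e * e = e

namespace IsCovariantPair

section Fractions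

variable {A G : Type*} [NonUnitalCStarAlgebra A] [CommGroup G] {α : G →* (A →⋆ₙₐ[ℂ] A)}
  {P : Submonoid G} {e : A} {B : Type*} [CStarAlgebra B] {β : A →⋆ₙₐ[ℂ] B} {S : G → B}

theorem comp (h : IsCovariantPair α P e β S) {B' : Type*} [CStarAlgebra B'] (f : B →⋆ₐ[ℂ] B') :
    IsCovariantPair α P e ((f : B →⋆ₙₐ[ℂ] B').comp β) fun g => f (S g) where
  exists_fraction := h.exists_fraction
  isometry p hp := by rw [← map_star, ← map_mul, h.isometry p hp, map_one]
  isometry_mul p hp q hq := by rw [h.isometry_mul p hp q hq, map_mul]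
  covariant p hp a := by
    have := congrArg f (h.covariant p hp a)
    rwa [map_mul, map_mul] at this
  range_proj p hp := by
    rw [← map_star, ← map_mul, h.range_proj p hp]
    rfl
  proj_mul a := congrArg f (h.proj_mul a)
  proj_comm := h.proj_comm
  proj_idem := h.proj_idem

/-- The partial isometry `(S q)* S p` attached to a fraction `g = p q⁻¹`; it does not depend on the
choice of the fraction. -/
def fracIsometry (h : IsCovariantPair α P e β S) (g : G) : B :=
  star (S (h.exists_fraction g).choose_spec.2.choose) * S (h.exists_fraction g).choose

theorem fracIsometry_mul_inv (h : IsCovariantPair α P e β S) {p q : G} (hp : p ∈ P) (hq : q ∈ P) :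
    h.fracIsometry (p * q⁻¹) = star (S q) * S p :=
  have hfrac := (h.exists_fraction (p * q⁻¹)).choose_spec
  star_mul_eq_star_mul_of_mul_eq_mul (S := fun p : P => S p) (a := ⟨_, hfrac.1⟩)
    (b := ⟨_, hfrac.2.choose_spec.1⟩) (a' := ⟨p, hp⟩) (b' := ⟨q, hq⟩)
    (fun p => h.isometry p p.2) (fun p q => h.isometry_mul p p.2 q q.2)
    (Subtype.ext (mul_inv_eq_mul_inv_iff_mul_eq_mul.1 hfrac.2.choose_spec.2.symm))

theorem comp_fracIsometry (h : IsCovariantPair α P e β S) {B' : Type*} [CStarAlgebra B']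
    (f : B →⋆ₐ[ℂ] B') (g : G) : (h.comp f).fracIsometry g = f (h.fracIsometry g) := by
  obtain ⟨p, hp, q, hq, rfl⟩ := h.exists_fraction g
  rw [fracIsometry_mul_inv _ hp hq, fracIsometry_mul_inv _ hp hq, map_mul, map_star]

theorem star_mul_map (h : IsCovariantPair α P e β S) {p : G} (hp : p ∈ P) (a : A) :
    star (S p) * β (α p a) = β a * star (S p) := by
  have := congrArg star (h.covariant p hp (star a))
  simpa only [star_mul, map_star, star_star] using this

theorem fracIsometry_mul_map (h : IsCovariantPair α P e β S) (g : G) (b : A) :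
    h.fracIsometry g * β b = β (α g (e * b)) * h.fracIsometry g := by
  obtain ⟨p, hp, q, hq, rfl⟩ := h.exists_fraction g
  have act_eq : α p (e * b) = α q (α (p * q⁻¹) (e * b)) := by
    conv_lhs => rw [← inv_mul_cancel_right p q, mul_comm, map_mul α]
    rfl
  rw [h.fracIsometry_mul_inv hp hq, mul_assoc, ← h.proj_mul b, ← h.covariant p hp, act_eq,
    ← mul_assoc, h.star_mul_map hq, mul_assoc]

theorem fracIsometry_mul (h : IsCovariantPair α P e β S) (g k : G) :
    h.fracIsometry g * h.fracIsometry k = β (α g e) * h.fracIsometry (g * k) := by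
  obtain ⟨p, hp, q, hq, rfl⟩ := h.exists_fraction g
  obtain ⟨r, hr, s, hs, rfl⟩ := h.exists_fraction k
  have hqs := mul_mem hq hs
  have hps := mul_mem hp hs
  have hpr := mul_mem hp hr
  have left_frac : p * q⁻¹ = p * s * (q * s)⁻¹ := by
    rw [mul_inv_rev, mul_assoc, mul_inv_cancel_left]
  have right_frac : r * s⁻¹ = p * r * (p * s)⁻¹ := by
    rw [mul_comm p r, mul_comm p s, mul_inv_rev, mul_assoc, mul_inv_cancel_left]
  have mul_frac : p * q⁻¹ * (r * s⁻¹) = p * r * (q * s)⁻¹ := by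
    rw [mul_inv_rev, mul_mul_mul_comm, mul_comm q⁻¹]
  have act_eq : α (p * s) e = α (q * s) (α (p * q⁻¹) e) := by
    have : p * s = q * s * (p * q⁻¹) := by
      rw [left_frac, mul_comm (q * s), inv_mul_cancel_right]
    rw [this, map_mul]
    rfl
  rw [mul_frac, h.fracIsometry_mul_inv hpr hqs, ← mul_assoc, ← h.star_mul_map hqs, ← act_eq,
    ← h.range_proj _ hps, right_frac, h.fracIsometry_mul_inv hpr hps, left_frac,
    h.fracIsometry_mul_inv hps hqs]
  simp only [mul_assoc]

theorem star_fracIsometry (h : IsCovariantPair α P e β S) (g : G) :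
    star (h.fracIsometry g) = h.fracIsometry g⁻¹ := by
  obtain ⟨p, hp, q, hq, rfl⟩ := h.exists_fraction g
  rw [mul_inv_rev, inv_inv, h.fracIsometry_mul_inv hp hq, h.fracIsometry_mul_inv hq hp, star_mul,
    star_star]

theorem map_mul_fracIsometry (h : IsCovariantPair α P e β S) (g : G) :
    β (α g e) * h.fracIsometry g = h.fracIsometry g := by
  obtain ⟨p, hp, q, hq, rfl⟩ := h.exists_fraction g
  have act_eq : α p e = α q (α (p * q⁻¹) e) := by
    conv_lhs => rw [← inv_mul_cancel_right p q, mul_comm, map_mul α]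
    rfl
  rw [h.fracIsometry_mul_inv hp hq, ← mul_assoc, ← h.star_mul_map hq, ← act_eq,
    ← h.range_proj p hp, mul_assoc, mul_assoc, h.isometry p hp, mul_one]

theorem fracIsometry_inv_mul (h : IsCovariantPair α P e β S) {g k : G} (hk : k⁻¹ ∈ P)
    (hgk : (g⁻¹ * k)⁻¹ ∈ P) : h.fracIsometry g = star (S k⁻¹) * S (g⁻¹ * k)⁻¹ := by
  rw [← h.fracIsometry_mul_inv hgk hk, inv_inv, mul_inv_rev, inv_inv, mul_comm,
    mul_inv_cancel_left]

/-- The linear extension of `a δ_g ↦ β a (S q)* S p`, where `g = p q⁻¹`, to finite sums. -/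
def finsuppSum (h : IsCovariantPair α P e β S) : (G →₀ A) →ₗ[ℂ] B :=
  Finsupp.lsum ℂ fun g => (LinearMap.mulRight ℂ (h.fracIsometry g)).comp (β : A →ₗ[ℂ] B)

theorem finsuppSum_apply (h : IsCovariantPair α P e β S) (c : G →₀ A) :
    h.finsuppSum c = ∑ g ∈ c.support, β (c g) * h.fracIsometry g := rfl

theorem comp_finsuppSum (h : IsCovariantPair α P e β S) {B' : Type*} [CStarAlgebra B']
    (f : B →⋆ₐ[ℂ] B') (c : G →₀ A) : (h.comp f).finsuppSum c = f (h.finsuppSum c) := by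
  rw [finsuppSum_apply, finsuppSum_apply, map_sum]
  exact Finset.sum_congr rfl fun g _ => by
    rw [h.comp_fracIsometry, map_mul]
    rfl

end Fractions

section FoelnerVector

variable {G H : Type*} [Group G] [NormedAddCommGroup H] [InnerProductSpace ℂ H]

open Classical in
/-- The function `k ↦ (S k⁻¹) ξ` on `T`, extended by zero. -/
def foelnerVector (S : G → (H →L[ℂ] H)) (T : Finset G) (ξ : H) : lp (fun _ : G => H) 2 :=
  ∑ k ∈ T, lp.single 2 k (S k⁻¹ ξ)

open Classical in
theorem foelnerVector_apply (S : G → (H →L[ℂ] H)) (T : Finset G) (ξ : H) (k : G) :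
    foelnerVector S T ξ k = if k ∈ T then S k⁻¹ ξ else 0 := by
  simp only [foelnerVector, lp.coeFn_sum, Finset.sum_apply, lp.single_apply, Pi.single_apply]
  exact Finset.sum_ite_eq T k fun l => S l⁻¹ ξ

theorem inner_foelnerVector_left (S : G → (H →L[ℂ] H)) (T : Finset G) (η : H)
    (ζ : lp (fun _ : G => H) 2) :
    inner ℂ (foelnerVector S T η) ζ = ∑ k ∈ T, inner ℂ (S k⁻¹ η) (ζ k) := by
  simp only [foelnerVector, sum_inner, lp.inner_single_left]

end FoelnerVector

section Dilation

variable {A G : Type u} [NonUnitalCStarAlgebra A] [CommGroup G] {α : G →* (A →⋆ₙₐ[ℂ] A)}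
  {H : Type u} [NormedAddCommGroup H] [InnerProductSpace ℂ H] [CompleteSpace H]

/-- Left translations on the square summable functions on a group. -/
def l2Translation (G H : Type*) [Group G] [NormedAddCommGroup H] [InnerProductSpace ℂ H]
    [CompleteSpace H] :
    G →* unitary (lp (fun _ : G => H) 2 →L[ℂ] lp (fun _ : G => H) 2) where
  toFun g := Unitary.linearIsometryEquiv.symm (l2Perm H (Equiv.mulLeft g))
  map_one' := by
    refine Subtype.ext (ContinuousLinearMap.ext fun ζ => lp.ext (funext fun k => ?_))
    change ζ ((1 : G)⁻¹ * k) = ζ k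
    rw [inv_one, one_mul]
  map_mul' g g' := by
    refine Subtype.ext (ContinuousLinearMap.ext fun ζ => lp.ext (funext fun k => ?_))
    change ζ ((g * g')⁻¹ * k) = ζ (g'⁻¹ * (g⁻¹ * k))
    rw [mul_inv_rev, mul_assoc]

/-- The covariant representation on `ℓ²(G, H)` induced by a representation `β` of `A` on `H`. -/
def inducedRep (α : G →* (A →⋆ₙₐ[ℂ] A)) (β : A →⋆ₙₐ[ℂ] (H →L[ℂ] H)) : CovariantRep α where
  H := lp (fun _ : G => H) 2
  π := diagonalRep fun k => β.comp (α k⁻¹)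
  V := l2Translation G H
  covariant g a := by
    rw [← Unitary.coe_star, Unitary.star_eq_inv, ← map_inv]
    refine ContinuousLinearMap.ext fun ζ => lp.ext (funext fun k => ?_)
    change β (α (g⁻¹ * k)⁻¹ a) (ζ (g⁻¹⁻¹ * (g⁻¹ * k))) = β (α k⁻¹ (α g a)) (ζ k)
    rw [inv_inv, mul_inv_cancel_left, mul_inv_rev, inv_inv, map_mul]
    rfl

/-- The representation of the crossed product on `ℓ²(G, H)` induced by a representation `β` of `A`
on `H`. -/
def inducedHom (α : G →* (A →⋆ₙₐ[ℂ] A)) (β : A →⋆ₙₐ[ℂ] (H →L[ℂ] H)) :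
    CrossedProduct α →⋆ₙₐ[ℂ] (lp (fun _ : G => H) 2 →L[ℂ] lp (fun _ : G => H) 2) :=
  CrossedProduct.eval (inducedRep α β)

theorem norm_inducedHom_le (β : A →⋆ₙₐ[ℂ] (H →L[ℂ] H)) (x : CrossedProduct α) :
    ‖inducedHom α β x‖ ≤ ‖x‖ :=
  CrossedProduct.norm_eval_le (inducedRep α β) x

theorem inducedHom_mk_apply (β : A →⋆ₙₐ[ℂ] (H →L[ℂ] H)) (a : A) (g : G)
    (ζ : lp (fun _ : G => H) 2) (k : G) :
    inducedHom α β (CrossedProduct.mk α a g) ζ k = β (α k⁻¹ a) (ζ (g⁻¹ * k)) := rfl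

variable {P : Submonoid G} {e : A} {β : A →⋆ₙₐ[ℂ] (H →L[ℂ] H)} {S : G → (H →L[ℂ] H)}

theorem norm_apply_eq (h : IsCovariantPair α P e β S) {p : G} (hp : p ∈ P) (ξ : H) :
    ‖S p ξ‖ = ‖ξ‖ :=
  (ContinuousLinearMap.norm_map_iff_adjoint_comp_self (S p)).2 (h.isometry p hp) ξ

theorem norm_foelnerVector (h : IsCovariantPair α P e β S) {T : Finset G}
    (hT : ∀ k ∈ T, k⁻¹ ∈ P) (ξ : H) : ‖foelnerVector S T ξ‖ = √T.card * ‖ξ‖ := by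
  classical
  have norm_sq : ‖foelnerVector S T ξ‖ ^ 2 = T.card * ‖ξ‖ ^ 2 := by
    have := lp.norm_sum_single (p := 2) (by norm_num) (fun k => S k⁻¹ ξ) T
    simp only [ENNReal.toReal_ofNat, Real.rpow_ofNat] at this
    rw [foelnerVector, this, Finset.sum_congr rfl fun k hk => by rw [h.norm_apply_eq (hT k hk)],
      Finset.sum_const, nsmul_eq_mul]
  rw [← Real.sqrt_sq (norm_nonneg (foelnerVector S T ξ)), norm_sq,
    Real.sqrt_mul (Nat.cast_nonneg _), Real.sqrt_sq (norm_nonneg _)]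

theorem inner_foelnerVector_inducedHom_mk [DecidableEq G] (h : IsCovariantPair α P e β S)
    {T : Finset G} (hT : ∀ k ∈ T, k⁻¹ ∈ P) (a : A) (g : G) (ξ η : H) :
    inner ℂ (foelnerVector S T η)
        (inducedHom α β (CrossedProduct.mk α a g) (foelnerVector S T ξ)) =
      ((T.filter fun k => g⁻¹ * k ∈ T).card : ℂ) * inner ℂ η (β a (h.fracIsometry g ξ)) := by
  rw [inner_foelnerVector_left, Finset.card_filter, Nat.cast_sum, Finset.sum_mul]
  refine Finset.sum_congr rfl fun k hk => ?_
  rw [inducedHom_mk_apply, foelnerVector_apply]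
  split_ifs with hgk
  · have compress : β a * h.fracIsometry g =
        star (S k⁻¹) * (β (α k⁻¹ a) * S (g⁻¹ * k)⁻¹) := by
      rw [h.fracIsometry_inv_mul (hT k hk) (hT _ hgk), ← mul_assoc, ← h.star_mul_map (hT k hk),
        mul_assoc]
    have compress_apply : β a (h.fracIsometry g ξ) =
        star (S k⁻¹) (β (α k⁻¹ a) (S (g⁻¹ * k)⁻¹ ξ)) := congr($compress ξ)
    rw [Nat.cast_one, one_mul, compress_apply, ContinuousLinearMap.star_eq_adjoint,
      ContinuousLinearMap.adjoint_inner_right]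
  · simp

theorem norm_sum_card_mul_inner_le [DecidableEq G] (h : IsCovariantPair α P e β S) {T : Finset G}
    (hT : ∀ k ∈ T, k⁻¹ ∈ P) (c : G →₀ A) (ξ η : H) :
    ‖∑ g ∈ c.support, ((T.filter fun k => g⁻¹ * k ∈ T).card : ℂ) *
        inner ℂ η (β (c g) (h.fracIsometry g ξ))‖ ≤
      T.card * (‖CrossedProduct.ofFinsupp α c‖ * ‖ξ‖ * ‖η‖) := by
  have coefficient_eq : ∑ g ∈ c.support, ((T.filter fun k => g⁻¹ * k ∈ T).card : ℂ) *
      inner ℂ η (β (c g) (h.fracIsometry g ξ)) = inner ℂ (foelnerVector S T η)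
        (inducedHom α β (CrossedProduct.ofFinsupp α c)
          (foelnerVector S T ξ)) := by
    rw [CrossedProduct.ofFinsupp_eq_sum, map_sum, sum_apply, inner_sum]
    exact Finset.sum_congr rfl fun g _ => (h.inner_foelnerVector_inducedHom_mk hT _ g ξ η).symm
  rw [coefficient_eq]
  calc _ ≤ ‖foelnerVector S T η‖ * (‖CrossedProduct.ofFinsupp α c‖ * ‖foelnerVector S T ξ‖) := by
        refine (norm_inner_le_norm _ _).trans ?_
        gcongr
        exact ContinuousLinearMap.le_of_opNorm_le _ (norm_inducedHom_le β _) _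
    _ = (√T.card * √T.card) * (‖CrossedProduct.ofFinsupp α c‖ * ‖ξ‖ * ‖η‖) := by
        rw [h.norm_foelnerVector hT, h.norm_foelnerVector hT]
        ring
    _ = _ := by rw [Real.mul_self_sqrt (Nat.cast_nonneg _)]

theorem norm_sum_inner_le (h : IsCovariantPair α P e β S) (c : G →₀ A) (ξ η : H) :
    ‖∑ g ∈ c.support, inner ℂ η (β (c g) (h.fracIsometry g ξ))‖ ≤
      ‖CrossedProduct.ofFinsupp α c‖ * ‖ξ‖ * ‖η‖ := by
  classical
  refine norm_sum_le_of_forall_weights fun ε hε => ?_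
  obtain ⟨T, hT_nonempty, hTP, hT⟩ := exists_foelner_inv_mem P h.exists_fraction c.support hε
  have card_pos : (0 : ℝ) < T.card := Nat.cast_pos.2 hT_nonempty.card_pos
  refine ⟨fun g => ((T.filter fun k => g⁻¹ * k ∈ T).card : ℝ) / T.card, fun g hg =>
    ⟨(le_div_iff₀ card_pos).2 (hT g hg), (div_le_one card_pos).2 ?_⟩, ?_⟩
  · exact Nat.cast_le.2 (Finset.card_filter_le _ _)
  · have weighted_sum_eq : ∑ g ∈ c.support,
        (((T.filter fun k => g⁻¹ * k ∈ T).card : ℝ) / T.card) •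
          (inner ℂ η (β (c g) (h.fracIsometry g ξ)) : ℂ) =
        (T.card : ℂ)⁻¹ * ∑ g ∈ c.support, ((T.filter fun k => g⁻¹ * k ∈ T).card : ℂ) *
          inner ℂ η (β (c g) (h.fracIsometry g ξ)) := by
      rw [Finset.mul_sum]
      refine Finset.sum_congr rfl fun g _ => ?_
      rw [Complex.real_smul, Complex.ofReal_div, Complex.ofReal_natCast, Complex.ofReal_natCast]
      ring
    rw [weighted_sum_eq, norm_mul, norm_inv, Complex.norm_natCast, inv_mul_le_iff₀ card_pos]
    exact h.norm_sum_card_mul_inner_le hTP c ξ η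

/-- Averaging over a Følner set compresses the induced covariant representation, which is defined
on the whole of `G`, approximately to the given pair. -/
theorem norm_finsuppSum_le (h : IsCovariantPair α P e β S) (c : G →₀ A) :
    ‖h.finsuppSum c‖ ≤ ‖CrossedProduct.ofFinsupp α c‖ := by
  refine ContinuousLinearMap.opNorm_le_of_re_inner_le (norm_nonneg _) fun ξ η hξ hη => ?_
  have inner_eq : inner ℂ η (h.finsuppSum c ξ) =
      ∑ g ∈ c.support, inner ℂ η (β (c g) (h.fracIsometry g ξ)) := by
    rw [finsuppSum_apply, sum_apply, inner_sum]
    rfl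
  calc _ = RCLike.re (inner ℂ η (h.finsuppSum c ξ)) := by rw [← inner_re_symm]
    _ ≤ ‖inner ℂ η (h.finsuppSum c ξ)‖ := RCLike.re_le_norm _
    _ ≤ ‖CrossedProduct.ofFinsupp α c‖ := by
      simpa only [inner_eq, hξ, hη, mul_one] using h.norm_sum_inner_le c ξ η

end Dilation

section Corner

variable {A G : Type u} [NonUnitalCStarAlgebra A] [CommGroup G] {α : G →* (A →⋆ₙₐ[ℂ] A)}
  {P : Submonoid G} {e : A} {B : Type*} [CStarAlgebra B] {β : A →⋆ₙₐ[ℂ] B} {S : G → B}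

/-- The continuous linear extension of `a δ_g ↦ β a (S q)* S p`, where `g = p q⁻¹`, to the crossed
product. It has this property only if the linear extension to finite sums is contractive. -/
def integratedForm (h : IsCovariantPair α P e β S) : CrossedProduct α →L[ℂ] B :=
  h.finsuppSum.extendOfNorm (CrossedProduct.ofFinsupp α)

theorem integratedForm_ofFinsupp (h : IsCovariantPair α P e β S)
    (hnorm : ∀ c, ‖h.finsuppSum c‖ ≤ ‖CrossedProduct.ofFinsupp α c‖) (c : G →₀ A) :
    h.integratedForm (CrossedProduct.ofFinsupp α c) = h.finsuppSum c :=
  LinearMap.extendOfNorm_eq CrossedProduct.denseRange_ofFinsupp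
    ⟨1, fun c => (hnorm c).trans_eq (one_mul _).symm⟩ c

theorem integratedForm_mk (h : IsCovariantPair α P e β S)
    (hnorm : ∀ c, ‖h.finsuppSum c‖ ≤ ‖CrossedProduct.ofFinsupp α c‖) (a : A) (g : G) :
    h.integratedForm (CrossedProduct.mk α a g) = β a * h.fracIsometry g := by
  rw [← CrossedProduct.ofFinsupp_single, h.integratedForm_ofFinsupp hnorm]
  exact Finsupp.lsum_single ℂ _ g a

theorem integratedForm_compress (h : IsCovariantPair α P e β S)
    (hnorm : ∀ c, ‖h.finsuppSum c‖ ≤ ‖CrossedProduct.ofFinsupp α c‖) (x : CrossedProduct α) :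
    h.integratedForm (CrossedProduct.mk α e 1 * x * CrossedProduct.mk α e 1) =
      h.integratedForm x := by
  refine CrossedProduct.eq_of_forall_mk
    (f := h.integratedForm.comp ((ContinuousLinearMap.mul ℂ _).flip (CrossedProduct.mk α e 1) ∘L
      ContinuousLinearMap.mul ℂ _ (CrossedProduct.mk α e 1)))
    (g := h.integratedForm) (ContinuousLinearMap.continuous _) h.integratedForm.continuous
    (fun a g => ?_) x
  change h.integratedForm (CrossedProduct.mk α e 1 * CrossedProduct.mk α a g *
    CrossedProduct.mk α e 1) = h.integratedForm (CrossedProduct.mk α a g)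
  rw [CrossedProduct.mk_mul_mk, CrossedProduct.mk_mul_mk, h.integratedForm_mk hnorm,
    h.integratedForm_mk hnorm, one_mul, mul_one, map_one, NonUnitalStarAlgHom.coe_one, id,
    map_mul, h.proj_mul, mul_assoc, h.map_mul_fracIsometry]

theorem integratedForm_mk_mul_mk (h : IsCovariantPair α P e β S)
    (hnorm : ∀ c, ‖h.finsuppSum c‖ ≤ ‖CrossedProduct.ofFinsupp α c‖) (a b : A) (g k : G) :
    h.integratedForm (CrossedProduct.mk α a g * (CrossedProduct.mk α e 1 *
        CrossedProduct.mk α b k)) =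
      h.integratedForm (CrossedProduct.mk α a g) * h.integratedForm (CrossedProduct.mk α b k) := by
  rw [CrossedProduct.mk_mul_mk, CrossedProduct.mk_mul_mk, h.integratedForm_mk hnorm,
    h.integratedForm_mk hnorm, h.integratedForm_mk hnorm, one_mul, map_one,
    NonUnitalStarAlgHom.coe_one, id]
  have absorb : β (α g (e * b)) * β (α g e) = β (α g (e * b)) := by
    rw [← map_mul, ← map_mul, mul_assoc, h.proj_comm, ← mul_assoc, h.proj_idem]
  calc _ = β a * (β (α g (e * b)) * h.fracIsometry (g * k)) := by rw [map_mul, mul_assoc]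
    _ = β a * (β (α g (e * b)) * (h.fracIsometry g * h.fracIsometry k)) := by
        rw [h.fracIsometry_mul, ← mul_assoc (β (α g (e * b))), absorb]
    _ = β a * (h.fracIsometry g * β b * h.fracIsometry k) := by
        rw [h.fracIsometry_mul_map, mul_assoc]
    _ = _ := by simp only [mul_assoc]

theorem integratedForm_mul (h : IsCovariantPair α P e β S)
    (hnorm : ∀ c, ‖h.finsuppSum c‖ ≤ ‖CrossedProduct.ofFinsupp α c‖) (x y : CrossedProduct α) :
    h.integratedForm (x * CrossedProduct.mk α e 1 * y) =
      h.integratedForm x * h.integratedForm y := by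
  have mul_generator (a : A) (g : G) : h.integratedForm (CrossedProduct.mk α a g *
      (CrossedProduct.mk α e 1 * y)) =
      h.integratedForm (CrossedProduct.mk α a g) * h.integratedForm y :=
    CrossedProduct.eq_of_forall_mk
      (f := h.integratedForm.comp (ContinuousLinearMap.mul ℂ _ (CrossedProduct.mk α a g) ∘L
        ContinuousLinearMap.mul ℂ _ (CrossedProduct.mk α e 1)))
      (g := (ContinuousLinearMap.mul ℂ _ (h.integratedForm (CrossedProduct.mk α a g))).comp
        h.integratedForm)
      (ContinuousLinearMap.continuous _) (ContinuousLinearMap.continuous _)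
      (fun b k => h.integratedForm_mk_mul_mk hnorm a b g k) y
  rw [mul_assoc]
  exact CrossedProduct.eq_of_forall_mk
    (f := h.integratedForm.comp ((ContinuousLinearMap.mul ℂ _).flip
      (CrossedProduct.mk α e 1 * y)))
    (g := ((ContinuousLinearMap.mul ℂ B).flip (h.integratedForm y)).comp h.integratedForm)
    (ContinuousLinearMap.continuous _) (ContinuousLinearMap.continuous _) mul_generator x

theorem integratedForm_star (h : IsCovariantPair α P e β S)
    (hnorm : ∀ c, ‖h.finsuppSum c‖ ≤ ‖CrossedProduct.ofFinsupp α c‖) (x : CrossedProduct α) :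
    h.integratedForm (star x) = star (h.integratedForm x) := by
  refine CrossedProduct.eq_of_forall_mk
    (f := (h.integratedForm : CrossedProduct α →+ B).comp
      (starAddEquiv : CrossedProduct α ≃+ _).toAddMonoidHom)
    (g := (starAddEquiv : B ≃+ _).toAddMonoidHom.comp (h.integratedForm : CrossedProduct α →+ B))
    (h.integratedForm.continuous.comp continuous_star)
    (continuous_star.comp h.integratedForm.continuous) (fun a g => ?_) x
  change h.integratedForm (star (CrossedProduct.mk α a g)) =
    star (h.integratedForm (CrossedProduct.mk α a g))
  rw [CrossedProduct.star_mk, h.integratedForm_mk hnorm, h.integratedForm_mk hnorm, star_mul,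
    ← map_star, h.star_fracIsometry, h.fracIsometry_mul_map, ← h.proj_comm, map_mul,
    map_mul, mul_assoc, h.map_mul_fracIsometry]

/-- The *-homomorphism on the corner at `e` defined by a contractive covariant pair. -/
def cornerHom (h : IsCovariantPair α P e β S)
    (hnorm : ∀ c, ‖h.finsuppSum c‖ ≤ ‖CrossedProduct.ofFinsupp α c‖)
    (he : IsStarProjection (CrossedProduct.mk α e 1)) :
    corner (CrossedProduct.mk α e 1) he →⋆ₙₐ[ℂ] B where
  toFun x := h.integratedForm x
  map_smul' t x := map_smul h.integratedForm t (x : CrossedProduct α)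
  map_zero' := map_zero h.integratedForm
  map_add' x y := map_add h.integratedForm (x : CrossedProduct α) y
  map_mul' x y := by
    obtain ⟨b, hb⟩ := x.2
    have mul_proj : (x : CrossedProduct α) * CrossedProduct.mk α e 1 = x := by
      rw [hb, mul_assoc _ (CrossedProduct.mk α e 1), he.isIdempotentElem.eq]
    have map_mul_proj := h.integratedForm_mul hnorm x y
    rwa [mul_proj] at map_mul_proj
  map_star' x := h.integratedForm_star hnorm x

theorem cornerHom_apply (h : IsCovariantPair α P e β S)
    (hnorm : ∀ c, ‖h.finsuppSum c‖ ≤ ‖CrossedProduct.ofFinsupp α c‖)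
    (he : IsStarProjection (CrossedProduct.mk α e 1)) (x : corner (CrossedProduct.mk α e 1) he) :
    h.cornerHom hnorm he x = h.integratedForm x := rfl

theorem injective_cornerHom (h : IsCovariantPair α P e β S)
    (hnorm : ∀ c, ‖h.finsuppSum c‖ ≤ ‖CrossedProduct.ofFinsupp α c‖)
    (he : IsStarProjection (CrossedProduct.mk α e 1)) (hc : ∀ c, ‖e * c 1‖ ≤ ‖h.finsuppSum c‖) :
    Function.Injective (h.cornerHom hnorm he) :=
  CrossedProduct.injective_of_norm_coeff_le he h.integratedForm _ (h.cornerHom_apply hnorm he)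
    fun c => (h.integratedForm_ofFinsupp hnorm c).symm ▸ hc c

end Corner

end IsCovariantPair

end CovariantPairs

section LocalIntegers

open IsDedekindDomain.HeightOneSpectrum

variable {R : Type*} [CommRing R] [IsDedekindDomain R] {K : Type*} [Field K] [Algebra R K]
  [IsFractionRing R K]

theorem isOpen_adicCompletionIntegers (v : HeightOneSpectrum R) :
    IsOpen (v.adicCompletionIntegers K : Set (v.adicCompletion K)) :=
  Valued.isOpen_valuationSubring _

theorem valued_algebraMap (v : HeightOneSpectrum R) (k : K) :
    Valued.v (algebraMap K (v.adicCompletion K) k) = v.valuation K k :=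
  valuedAdicCompletion_eq_valuation' v k

theorem valued_algebraMap_coe (v : HeightOneSpectrum R) (n : R) :
    Valued.v (algebraMap K (v.adicCompletion K) (algebraMap R K n)) = v.intValuation n :=
  (valued_algebraMap v _).trans (v.valuation_of_algebraMap n)

theorem exists_valued_sub_algebraMap_le (v : HeightOneSpectrum R) (y : v.adicCompletion K)
    {t : v.adicCompletion K} (ht : t ≠ 0) :
    ∃ k : K, Valued.v (y - algebraMap K (v.adicCompletion K) k) ≤ Valued.v t := by
  have hcont : Continuous fun z : v.adicCompletion K => (y - z) * t⁻¹ :=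
    (continuous_const.sub continuous_id).mul continuous_const
  obtain ⟨_, hz, k, rfl⟩ := (denseRange_algebraMap K v).inter_open_nonempty _
    ((isOpen_adicCompletionIntegers v).preimage hcont) ⟨y, by
      rw [Set.mem_preimage, sub_self, zero_mul]
      exact zero_mem (v.adicCompletionIntegers K)⟩
  refine ⟨k, ?_⟩
  have hle : Valued.v ((y - algebraMap K (v.adicCompletion K) k) * t⁻¹) ≤ 1 := hz
  rw [map_mul, map_inv₀] at hle
  rwa [mul_inv_le_iff₀ (zero_lt_iff.2 ((Valuation.ne_zero_iff _).2 ht)), one_mul] at hle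

theorem exists_valued_sub_algebraMap_coe_le (v : HeightOneSpectrum R) {y : v.adicCompletion K}
    (hy : Valued.v y ≤ 1) {m : R} (hm : m ≠ 0) :
    ∃ n : R, Valued.v (y - algebraMap K (v.adicCompletion K) (algebraMap R K n)) ≤
      v.intValuation m := by
  have hm0 : v.intValuation m ≠ 0 := v.intValuation_ne_zero m hm
  obtain ⟨k, hk⟩ := exists_valued_sub_algebraMap_le v y
    (t := algebraMap K (v.adicCompletion K) (algebraMap R K m)) fun h => hm0 <| by
      rw [← valued_algebraMap_coe (K := K), h, map_zero]
  rw [valued_algebraMap_coe] at hk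
  have hk_int : v.valuation K k ≤ 1 := by
    rw [← valued_algebraMap, ← sub_sub_cancel y (algebraMap K (v.adicCompletion K) k)]
    exact (Valuation.map_sub _ _ _).trans (max_le hy (hk.trans (v.intValuation_le_one m)))
  obtain ⟨n, hn⟩ := v.exists_valuation_sub_lt_of_integer hk_int (Units.mk0 _ hm0)
  refine ⟨n, ?_⟩
  rw [← sub_sub_sub_cancel_right _ _ (algebraMap K (v.adicCompletion K) k), ← map_sub]
  refine (Valuation.map_sub _ _ _).trans (max_le hk ?_)
  rw [valued_algebraMap]
  exact hn.le

variable (K) in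
theorem residue_adicCompletionIntegers_eq_zero_iff (v : HeightOneSpectrum R)
    (x : v.adicCompletionIntegers K) :
    IsLocalRing.residue (v.adicCompletionIntegers K) x = 0 ↔
      Valued.v (x : v.adicCompletion K) < 1 := by
  rw [IsLocalRing.residue_eq_zero_iff, IsLocalRing.mem_maximalIdeal, mem_nonunits_iff,
    adicCompletionIntegers.isUnit_iff_valued_eq_one]
  exact ⟨fun h => lt_of_le_of_ne x.2 h, ne_of_lt⟩

variable (K) in
theorem surjective_residue_comp_algebraMap (v : HeightOneSpectrum R) :
    Function.Surjective ((IsLocalRing.residue (v.adicCompletionIntegers K)).comp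
      (algebraMap R (v.adicCompletionIntegers K))) := by
  intro x
  obtain ⟨y, rfl⟩ := IsLocalRing.residue_surjective x
  obtain ⟨m, hm, hm0⟩ := Submodule.exists_mem_ne_zero_of_ne_bot v.ne_bot
  obtain ⟨n, hn⟩ := exists_valued_sub_algebraMap_coe_le v y.2 hm0
  refine ⟨n, (sub_eq_zero.1 ?_).symm⟩
  rw [RingHom.comp_apply, ← map_sub, residue_adicCompletionIntegers_eq_zero_iff]
  exact hn.trans_lt ((v.intValuation_lt_one_iff_mem m).2 hm)

variable (K) in
theorem finite_residueField_adicCompletionIntegers (v : HeightOneSpectrum R)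
    [Finite (R ⧸ v.asIdeal)] :
    Finite (IsLocalRing.ResidueField (v.adicCompletionIntegers K)) := by
  have hvanish : ∀ a ∈ v.asIdeal, (IsLocalRing.residue (v.adicCompletionIntegers K)).comp
      (algebraMap R (v.adicCompletionIntegers K)) a = 0 := by
    intro a ha
    rw [RingHom.comp_apply, residue_adicCompletionIntegers_eq_zero_iff]
    exact (valued_algebraMap_coe v a).trans_lt ((v.intValuation_lt_one_iff_mem a).2 ha)
  exact Finite.of_surjective _ (Ideal.Quotient.lift_surjective_of_surjective _ hvanish
    (surjective_residue_comp_algebraMap K v))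

theorem finite_intValuation_lt_one {m : R} (hm : m ≠ 0) :
    {v : HeightOneSpectrum R | v.intValuation m < 1}.Finite := by
  simp_rw [intValuation_lt_one_iff_dvd]
  exact Ideal.finite_factors (by simpa using hm)

/-- Chinese remaindering over the finitely many places dividing `m`. -/
theorem exists_forall_valued_sub_algebraMap_coe_le
    {y : (v : HeightOneSpectrum R) → v.adicCompletion K} (hy : ∀ v, Valued.v (y v) ≤ 1) {m : R}
    (hm : m ≠ 0) :
    ∃ n : R, ∀ v : HeightOneSpectrum R,
      Valued.v (y v - algebraMap K (v.adicCompletion K) (algebraMap R K n)) ≤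
        v.intValuation m := by
  classical
  choose x hx using fun v => exists_valued_sub_algebraMap_coe_le v (hy v) hm
  have hpow : ∀ v : HeightOneSpectrum R, ∃ k : ℕ, v.intValuation m = WithZero.exp (-(k : ℤ)) :=
    fun v => ⟨_, v.intValuation_if_neg hm⟩
  choose e he using hpow
  obtain ⟨n, hn⟩ := IsDedekindDomain.exists_forall_sub_mem_ideal
    (s := (finite_intValuation_lt_one hm).toFinset)
    (fun v : HeightOneSpectrum R => v.asIdeal) e (fun v _ => v.prime)
    (fun v _ w _ hvw h => hvw (HeightOneSpectrum.ext h)) (fun v => x v)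
  refine ⟨n, fun v => ?_⟩
  by_cases hv : v.intValuation m < 1
  · have hnx := hn v (by simpa using hv)
    rw [← intValuation_le_pow_iff_mem, ← he v, ← valued_algebraMap_coe (K := K)] at hnx
    have hsplit : y v - algebraMap K (v.adicCompletion K) (algebraMap R K n) =
        (y v - algebraMap K (v.adicCompletion K) (algebraMap R K (x v))) -
          algebraMap K (v.adicCompletion K) (algebraMap R K (n - x v)) := by
      rw [map_sub, map_sub, sub_sub_sub_cancel_right]
    rw [hsplit]
    exact (Valuation.map_sub _ _ _).trans (max_le (hx v) hnx)
  · rw [le_antisymm (v.intValuation_le_one _) (not_lt.1 hv)]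
    exact (Valuation.map_sub _ _ _).trans
      (max_le (hy v) ((valued_algebraMap_coe v n).trans_le (v.intValuation_le_one n)))

end LocalIntegers

section IntegralScalars

variable {K : Type*} [Field K]

/-- A nonzero integer, as a unit of `K`. -/
def intUnit (m : (𝓞 K)⁰) : Kˣ :=
  Units.mk0 ((m : 𝓞 K) : K) (by simp)

@[simp]
theorem coe_intUnit (m : (𝓞 K)⁰) : (intUnit m : K) = ((m : 𝓞 K) : K) := rfl

theorem intUnit_mul (k m : (𝓞 K)⁰) : intUnit (k * m) = intUnit k * intUnit m :=
  Units.ext (by simp)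

theorem intUnit_injective : Function.Injective (intUnit (K := K)) := fun _ _ h =>
  Subtype.ext (RingOfIntegers.ext (congrArg Units.val h))

end IntegralScalars

section IntegralAdeles

open IsDedekindDomain.HeightOneSpectrum

variable {K : Type*} [Field K] [NumberField K]

instance compactSpace_adicCompletionIntegers (v : HeightOneSpectrum (𝓞 K)) :
    CompactSpace (v.adicCompletionIntegers K) := by
  have : Finite (𝓞 K ⧸ v.asIdeal) := Ideal.finiteQuotientOfFreeOfNeBot v.asIdeal v.ne_bot
  open Valued.integer in
  refine compactSpace_iff_completeSpace_and_isDiscreteValuationRing_and_finite_residueField.2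
    ⟨(Valued.isClosed_valuationSubring (v.adicCompletion K)).completeSpace_coe,
      inferInstanceAs (IsDiscreteValuationRing (v.adicCompletionIntegers K)),
      finite_residueField_adicCompletionIntegers K v⟩

instance : T2Space (FinAdele K) :=
  inferInstanceAs (T2Space (RestrictedProduct (fun v : HeightOneSpectrum (𝓞 K) =>
    v.adicCompletion K) (fun v => (v.adicCompletionIntegers K : Set (v.adicCompletion K)))
      Filter.cofinite))

theorem isOpen_integralAdeles : IsOpen (integralAdeles K : Set (FinAdele K)) :=
  RestrictedProduct.isOpen_forall_mem (R := fun v : HeightOneSpectrum (𝓞 K) => v.adicCompletion K)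
    (A := fun v => (v.adicCompletionIntegers K : Set (v.adicCompletion K)))
    isOpen_adicCompletionIntegers

theorem isCompact_integralAdeles : IsCompact (integralAdeles K : Set (FinAdele K)) := by
  have : ∀ v : HeightOneSpectrum (𝓞 K),
      CompactSpace (v.adicCompletionIntegers K : Set (v.adicCompletion K)) :=
    compactSpace_adicCompletionIntegers
  have h := isCompact_range (RestrictedProduct.isEmbedding_structureMap
    (R := fun v : HeightOneSpectrum (𝓞 K) => v.adicCompletion K)
    (A := fun v => (v.adicCompletionIntegers K : Set (v.adicCompletion K)))
    (𝓕 := Filter.cofinite)).continuous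
  rw [RestrictedProduct.range_structureMap] at h
  exact h

theorem isClopen_integralAdeles : IsClopen (integralAdeles K : Set (FinAdele K)) :=
  ⟨isCompact_integralAdeles.isClosed, isOpen_integralAdeles⟩

instance : CompactSpace (integralAdeles K) := isCompact_iff_compactSpace.1 isCompact_integralAdeles

theorem finAdele_mul_apply (x y : FinAdele K) (v : HeightOneSpectrum (𝓞 K)) :
    (x * y) v = x v * y v := rfl

/-- The diagonal image of an integer `n` in the finite adeles. -/
abbrev intAdele (n : 𝓞 K) : FinAdele K := algebraMap (𝓞 K) (FinAdele K) n

theorem intAdele_apply (n : 𝓞 K) (v : HeightOneSpectrum (𝓞 K)) :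
    intAdele n v = algebraMap K (v.adicCompletion K) n := rfl

theorem intAdele_mem_integralAdeles (n : 𝓞 K) : intAdele n ∈ integralAdeles K := fun v =>
  v.coe_mem_adicCompletionIntegers (K := K) n

theorem exists_algebraMap_eq_of_mem_integralAdeles {x : K}
    (hx : algebraMap K (FinAdele K) x ∈ integralAdeles K) :
    ∃ n : 𝓞 K, algebraMap (𝓞 K) K n = x := by
  refine HeightOneSpectrum.mem_integers_of_valuation_le_one K x fun v => ?_
  rw [← valued_algebraMap]
  exact hx v

theorem coe_diagFin_intUnit (m : (𝓞 K)⁰) :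
    ((diagFin K (intUnit m) : (FinAdele K)ˣ) : FinAdele K) = intAdele (m : 𝓞 K) := rfl

theorem diagFin_inv_apply (x : Kˣ) (v : HeightOneSpectrum (𝓞 K)) :
    (((diagFin K x)⁻¹ : (FinAdele K)ˣ) : FinAdele K) v =
      (algebraMap K (v.adicCompletion K) x)⁻¹ := by
  rw [← map_inv]
  change algebraMap K (v.adicCompletion K) ((x⁻¹ : Kˣ) : K) = _
  rw [Units.val_inv_eq_inv_val, map_inv₀]

theorem intAdele_mul_injective (m : (𝓞 K)⁰) :
    Function.Injective fun y : FinAdele K => intAdele (m : 𝓞 K) * y := by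
  rw [← coe_diagFin_intUnit]
  exact (diagFin K (intUnit m)).mulLeft_bijective.injective

theorem exists_eq_intAdele_add_mul {y : FinAdele K} (hy : y ∈ integralAdeles K) (m : (𝓞 K)⁰) :
    ∃ n : 𝓞 K, ∃ w ∈ integralAdeles K, y = intAdele n + intAdele (m : 𝓞 K) * w := by
  have hm0 : (m : 𝓞 K) ≠ 0 := nonZeroDivisors.ne_zero m.2
  obtain ⟨n, hn⟩ := exists_forall_valued_sub_algebraMap_coe_le hy hm0
  refine ⟨n, (((diagFin K (intUnit m))⁻¹ : (FinAdele K)ˣ) : FinAdele K) * (y - intAdele n),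
    fun v => ?_, ?_⟩
  · rw [finAdele_mul_apply, diagFin_inv_apply, mem_adicCompletionIntegers, map_mul, map_inv₀,
      coe_intUnit, valued_algebraMap_coe, mul_comm,
      mul_inv_le_iff₀ (zero_lt_iff.2 (v.intValuation_ne_zero _ hm0)), one_mul]
    exact hn v
  · rw [← coe_diagFin_intUnit, Units.mul_inv_cancel_left]
    ring

theorem dvd_of_intAdele_eq_mul {n : 𝓞 K} {m : (𝓞 K)⁰} {w : FinAdele K}
    (hw : w ∈ integralAdeles K) (h : intAdele n = intAdele (m : 𝓞 K) * w) : (m : 𝓞 K) ∣ n := by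
  have hm : ((m : 𝓞 K) : K) ≠ 0 := (intUnit m).ne_zero
  have hquot : algebraMap K (FinAdele K) ((n : K) / ((m : 𝓞 K) : K)) = w := by
    apply intAdele_mul_injective m
    change algebraMap K (FinAdele K) ((m : 𝓞 K) : K) * _ = _
    rw [← map_mul, mul_div_cancel₀ _ hm]
    exact h
  obtain ⟨k, hk⟩ := exists_algebraMap_eq_of_mem_integralAdeles (hquot ▸ hw)
  refine ⟨k, RingOfIntegers.ext ?_⟩
  change algebraMap (𝓞 K) K n = algebraMap (𝓞 K) K (m * k)
  rw [map_mul, hk, mul_div_cancel₀ _ hm]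

/-- The ideal `m ô` of `ô`. -/
def multiples (m : (𝓞 K)⁰) : Set (FinAdele K) :=
  (fun y => intAdele (m : 𝓞 K) * y) '' integralAdeles K

theorem isOpen_multiples (m : (𝓞 K)⁰) : IsOpen (multiples m) :=
  isOpenMap_smul (diagFin K (intUnit m)) _ isOpen_integralAdeles

theorem isCompact_multiples (m : (𝓞 K)⁰) : IsCompact (multiples m) :=
  isCompact_integralAdeles.image (continuous_const.mul continuous_id)

theorem eq_zero_of_forall_mem_multiples {y : FinAdele K} (h : ∀ m, y ∈ multiples m) : y = 0 := by
  refine FiniteAdeleRing.ext K fun v => ?_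
  change y v = 0
  by_contra hy
  obtain ⟨m, hm, hm0⟩ := Submodule.exists_mem_ne_zero_of_ne_bot v.ne_bot
  have hval : Valued.v (y v) ≠ 0 := (Valuation.ne_zero_iff Valued.v).2 hy
  obtain ⟨k, hk⟩ := exists_pow_lt₀ ((v.intValuation_lt_one_iff_mem m).2 hm) (Units.mk0 _ hval)
  obtain ⟨w, hw, hwy⟩ := h ⟨m ^ k, mem_nonZeroDivisors_of_ne_zero (pow_ne_zero k hm0)⟩
  have hval_le : Valued.v (y v) ≤ v.intValuation m ^ k := by
    rw [← hwy, finAdele_mul_apply, map_mul, intAdele_apply, valued_algebraMap_coe, map_pow]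
    exact mul_le_of_le_one_right' (hw v)
  exact absurd hk hval_le.not_gt

theorem multiples_mul_subset (k m : (𝓞 K)⁰) : multiples (k * m) ⊆ multiples k := by
  rintro _ ⟨y, hy, rfl⟩
  refine ⟨intAdele (m : 𝓞 K) * y, mul_mem (intAdele_mem_integralAdeles _) hy, ?_⟩
  simp [mul_assoc]

theorem exists_multiples_subset {U : Set (FinAdele K)} (hU : IsOpen U) (h0 : (0 : FinAdele K) ∈ U) :
    ∃ m : (𝓞 K)⁰, multiples m ⊆ U := by
  by_contra! hne
  obtain ⟨y, hy⟩ := IsCompact.nonempty_iInter_of_directed_nonempty_isCompact_isClosed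
    (fun m : (𝓞 K)⁰ => multiples m \ U)
    (fun k m => ⟨k * m, Set.sdiff_subset_sdiff_left (multiples_mul_subset k m), by
      rw [mul_comm k m]
      exact Set.sdiff_subset_sdiff_left (multiples_mul_subset m k)⟩)
    (fun m => Set.sdiff_nonempty.2 (hne m)) (fun m => (isCompact_multiples m).diff hU)
    (fun m => (isCompact_multiples m).isClosed.sdiff hU)
  rw [Set.mem_iInter] at hy
  have hy0 := eq_zero_of_forall_mem_multiples fun m => (hy m).1
  exact (hy 1).2 (hy0 ▸ h0)

end IntegralAdeles

section IdealGroup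

open IsDedekindDomain.HeightOneSpectrum

variable {K : Type*} [Field K] [NumberField K]

/-- The `v`-adic valuation of a finite idele. -/
def ideleVal (v : HeightOneSpectrum (𝓞 K)) : (FinAdele K)ˣ →* WithZero (Multiplicative ℤ) where
  toFun z := Valued.v ((z : FinAdele K) v)
  map_one' := map_one Valued.v
  map_mul' z w := by rw [Units.val_mul, finAdele_mul_apply, map_mul]

theorem ideleVal_ne_zero (v : HeightOneSpectrum (𝓞 K)) (z : (FinAdele K)ˣ) : ideleVal v z ≠ 0 :=
  ((Group.isUnit z).map (ideleVal v)).ne_zero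

theorem ideleVal_inv (v : HeightOneSpectrum (𝓞 K)) (z : (FinAdele K)ˣ) :
    ideleVal v z⁻¹ = (ideleVal v z)⁻¹ :=
  eq_inv_of_mul_eq_one_left (by rw [← map_mul, inv_mul_cancel, map_one])

theorem ideleVal_diagFin (v : HeightOneSpectrum (𝓞 K)) (x : Kˣ) :
    ideleVal v (diagFin K x) = v.valuation K (x : K) :=
  valued_algebraMap v (x : K)

theorem finite_ideleVal_ne_one (z : (FinAdele K)ˣ) : {v | ideleVal v z ≠ 1}.Finite :=
  (FiniteAdeleRing.isUnit_iff.1 z.isUnit).2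

theorem mem_integralIdeles_iff (z : (FinAdele K)ˣ) :
    z ∈ integralIdeles K ↔ ∀ v, ideleVal v z = 1 := by
  constructor
  · rintro ⟨hz, hz_inv⟩ v
    have hle : ideleVal v z⁻¹ ≤ 1 := hz_inv v
    rw [ideleVal_inv, inv_le_one₀ (zero_lt_iff.2 (ideleVal_ne_zero v z))] at hle
    exact le_antisymm (hz v) hle
  · intro h
    refine ⟨fun v => (h v).le, fun v => ?_⟩
    have hle : ideleVal v z⁻¹ ≤ 1 := by rw [ideleVal_inv, h v, inv_one]
    exact hle

theorem mem_intUnits_of_diagFin_mem {x : Kˣ} (hx : diagFin K x ∈ integralIdeles K) :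
    x ∈ intUnits K := by
  obtain ⟨n, hn⟩ := exists_algebraMap_eq_of_mem_integralAdeles (x := (x : K)) hx.1
  have hx_inv : algebraMap K (FinAdele K) ((x⁻¹ : Kˣ) : K) ∈ integralAdeles K := by
    have hmem : (((diagFin K x)⁻¹ : (FinAdele K)ˣ) : FinAdele K) ∈ integralAdeles K := hx.2
    rwa [← map_inv] at hmem
  obtain ⟨m, hm⟩ := exists_algebraMap_eq_of_mem_integralAdeles hx_inv
  have hnm : n * m = 1 := RingOfIntegers.ext <| by
    change algebraMap (𝓞 K) K (n * m) = algebraMap (𝓞 K) K 1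
    rw [map_mul, map_one, hn, hm, Units.mul_inv]
  exact ⟨⟨n, m, hnm, by rw [mul_comm, hnm]⟩, Units.ext hn⟩

theorem neg_mem_integralIdeles {z : (FinAdele K)ˣ} (hz : z ∈ integralIdeles K) :
    -z ∈ integralIdeles K := by
  have hval : ((-z : (FinAdele K)ˣ) : FinAdele K) ∈ integralAdeles K :=
    neg_mem (hz.1 : (z : FinAdele K) ∈ integralAdeles K)
  have hinv : (((-z)⁻¹ : (FinAdele K)ˣ) : FinAdele K) ∈ integralAdeles K := by
    rw [inv_neg]
    exact neg_mem (hz.2 : ((z⁻¹ : (FinAdele K)ˣ) : FinAdele K) ∈ integralAdeles K)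
  exact ⟨hval, hinv⟩

theorem exists_mem_forall_valuation_eq_ite [DecidableEq (HeightOneSpectrum (𝓞 K))]
    [IsPrincipalIdealRing (𝓞 K)]
    {G : Subgroup Kˣ} (hG : ∀ x : Kˣ, x ∈ G ∨ -x ∈ G) (v : HeightOneSpectrum (𝓞 K)) :
    ∃ x ∈ G, ∀ w : HeightOneSpectrum (𝓞 K),
      w.valuation K (x : K) = if w = v then WithZero.exp (-1 : ℤ) else 1 := by
  obtain ⟨r, hr⟩ := (IsPrincipalIdealRing.principal v.asIdeal).principal
  change v.asIdeal = Ideal.span {r} at hr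
  have hr0 : r ≠ 0 := by
    rintro rfl
    exact v.ne_bot (by simpa using hr)
  let x : Kˣ := Units.mk0 (r : K) (by simpa using hr0)
  have hx : ∀ w : HeightOneSpectrum (𝓞 K),
      w.valuation K (x : K) = if w = v then WithZero.exp (-1 : ℤ) else 1 := by
    intro w
    refine (w.valuation_of_algebraMap r).trans ?_
    split_ifs with hw
    · rw [hw, v.intValuation_singleton hr0 hr]
    · rw [intValuation_eq_one_iff]
      intro hmem
      have hle : v.asIdeal ≤ w.asIdeal := by
        rwa [hr, Ideal.span_singleton_le_iff_mem]
      exact hw (HeightOneSpectrum.ext (v.isMaximal.eq_of_le w.isPrime.ne_top hle).symm)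
  rcases hG x with hxG | hxG
  · exact ⟨x, hxG, hx⟩
  · exact ⟨-x, hxG, fun w => by rw [Units.val_neg, Valuation.map_neg, hx w]⟩

theorem hasFiniteMulSupport_zpow_log_ideleVal {M : Type*} [Group M]
    (ϖ : HeightOneSpectrum (𝓞 K) → M) (z : (FinAdele K)ˣ) :
    Function.HasFiniteMulSupport fun v => ϖ v ^ (-(ideleVal v z).log) := by
  refine (finite_ideleVal_ne_one z).subset fun v hv h => hv ?_
  simp only [h, WithZero.log_one, neg_zero, zpow_zero]

/-- The homomorphism `z ↦ ∏ᵥ ϖᵥ ^ v(z)` from finite ideles to scalars attached to a choice of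
scalars `ϖᵥ`; the valuations are multiplicative, so the additive exponent is `-log`. -/
def scalarOfIdele (ϖ : HeightOneSpectrum (𝓞 K) → Kˣ) : (FinAdele K)ˣ →* Kˣ where
  toFun z := ∏ᶠ v, ϖ v ^ (-(ideleVal v z).log)
  map_one' := finprod_eq_one_of_forall_eq_one fun v => by
    rw [map_one, WithZero.log_one, neg_zero, zpow_zero]
  map_mul' z w := by
    rw [← finprod_mul_distrib (hasFiniteMulSupport_zpow_log_ideleVal ϖ z)
      (hasFiniteMulSupport_zpow_log_ideleVal ϖ w)]
    refine finprod_congr fun v => ?_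
    rw [map_mul, WithZero.log_mul (ideleVal_ne_zero v z) (ideleVal_ne_zero v w), neg_add,
      zpow_add]

theorem scalarOfIdele_mem {ϖ : HeightOneSpectrum (𝓞 K) → Kˣ} {G : Subgroup Kˣ}
    (hϖ : ∀ v, ϖ v ∈ G) (z : (FinAdele K)ˣ) : scalarOfIdele ϖ z ∈ G :=
  finprod_induction (· ∈ G) (one_mem G) (fun _ _ => mul_mem) fun v => zpow_mem (hϖ v) _

theorem scalarOfIdele_eq_one (ϖ : HeightOneSpectrum (𝓞 K) → Kˣ) {z : (FinAdele K)ˣ}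
    (hz : z ∈ integralIdeles K) : scalarOfIdele ϖ z = 1 :=
  finprod_eq_one_of_forall_eq_one fun v => by
    rw [(mem_integralIdeles_iff z).1 hz v, WithZero.log_one, neg_zero, zpow_zero]

theorem valuation_scalarOfIdele [DecidableEq (HeightOneSpectrum (𝓞 K))]
    {ϖ : HeightOneSpectrum (𝓞 K) → Kˣ}
    (hϖ : ∀ v w : HeightOneSpectrum (𝓞 K),
      w.valuation K (ϖ v : K) = if w = v then WithZero.exp (-1 : ℤ) else 1)
    (z : (FinAdele K)ˣ) (v : HeightOneSpectrum (𝓞 K)) :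
    v.valuation K (scalarOfIdele ϖ z : K) = ideleVal v z := by
  have hzpow : ∀ (x : Kˣ) (n : ℤ),
      ideleVal v (diagFin K (x ^ n)) = v.valuation K (x : K) ^ n := fun x n => by
    rw [ideleVal_diagFin, Units.val_zpow_eq_zpow_val, map_zpow₀]
  rw [← ideleVal_diagFin]
  change (ideleVal v).comp (diagFin K) (∏ᶠ w, ϖ w ^ (-(ideleVal w z).log)) = _
  rw [MonoidHom.map_finprod _ (hasFiniteMulSupport_zpow_log_ideleVal ϖ z), finprod_eq_single _ v]
  · rw [MonoidHom.comp_apply, hzpow, hϖ, if_pos rfl, ← WithZero.exp_zsmul, smul_eq_mul,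
      neg_mul_neg, mul_one, WithZero.exp_log (ideleVal_ne_zero v z)]
  · intro w hw
    rw [MonoidHom.comp_apply, hzpow, hϖ, if_neg hw.symm, one_zpow]

/-- Fixing generators of the prime ideals makes the choice of representatives multiplicative. -/
theorem exists_section (hK : NumberField.classNumber K = 1) (G : Subgroup Kˣ)
    (hG : ∀ x : Kˣ, x ∈ G ∨ -x ∈ G) :
    ∃ σ : IdealGroup K →* Kˣ, ∀ z, σ z ∈ G ∧ (diagFin K (σ z) : IdealGroup K) = z := by
  classical
  have : IsPrincipalIdealRing (𝓞 K) := NumberField.classNumber_eq_one_iff.1 hK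
  choose ϖ hϖG hϖ using exists_mem_forall_valuation_eq_ite hG
  refine ⟨QuotientGroup.lift (integralIdeles K) (scalarOfIdele ϖ)
    fun z hz => scalarOfIdele_eq_one ϖ hz, fun z => ?_⟩
  obtain ⟨z, rfl⟩ := QuotientGroup.mk_surjective z
  refine ⟨scalarOfIdele_mem hϖG z, ?_⟩
  change ((diagFin K (scalarOfIdele ϖ z) : (FinAdele K)ˣ) : IdealGroup K) = z
  rw [QuotientGroup.eq, mem_integralIdeles_iff]
  intro v
  rw [map_mul, ideleVal_inv, ideleVal_diagFin, valuation_scalarOfIdele hϖ,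
    inv_mul_cancel₀ (ideleVal_ne_zero v z)]

/-- The embedding of `G / (G ∩ o^*)` into the ideal group. -/
def scalarGroupHom (G : Subgroup Kˣ) : ScalarGroup G →* IdealGroup K :=
  QuotientGroup.lift ((intUnits K).subgroupOf G)
    ((QuotientGroup.mk' (integralIdeles K)).comp ((diagFin K).comp G.subtype))
    fun _ hx => (QuotientGroup.eq_one_iff _).2 (diagFin_mem_integralIdeles _ hx)

theorem scalarGroupHom_coe {G : Subgroup Kˣ} (l : G) :
    scalarGroupHom G (l : ScalarGroup G) = (diagFin K l : IdealGroup K) := rfl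

theorem injective_scalarGroupHom (G : Subgroup Kˣ) : Function.Injective (scalarGroupHom G) := by
  rw [injective_iff_map_eq_one]
  intro x hx
  obtain ⟨l, rfl⟩ := QuotientGroup.mk_surjective x
  rw [scalarGroupHom_coe, QuotientGroup.eq_one_iff] at hx
  exact (QuotientGroup.eq_one_iff l).2 (mem_intUnits_of_diagFin_mem hx)

theorem exists_scalarGroup_mulEquiv (hK : NumberField.classNumber K = 1) (G : Subgroup Kˣ)
    (hG : ∀ x : Kˣ, x ∈ G ∨ -x ∈ G) :
    ∃ γ : IdealGroup K ≃* ScalarGroup G,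
      ∀ l : G, γ (diagFin K l : IdealGroup K) = (l : ScalarGroup G) := by
  obtain ⟨σ, hσ⟩ := exists_section hK G hG
  let γ : ScalarGroup G ≃* IdealGroup K := MulEquiv.ofBijective (scalarGroupHom G)
    ⟨injective_scalarGroupHom G, fun z => ⟨((⟨σ z, (hσ z).1⟩ : G) : ScalarGroup G), (hσ z).2⟩⟩
  exact ⟨γ.symm, fun l => γ.symm_apply_apply (l : ScalarGroup G)⟩

end IdealGroup

section InfiniteIdeles

variable {K : Type*} [Field K]

/-- The infinite ideles that are positive at all real places; they turn out to lie in the connected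
component `K_{∞,+}^×`. -/
def positiveIdeles (K : Type*) [Field K] : Set (InfiniteAdeleRing K)ˣ :=
  {x | ∀ (v : InfinitePlace K) (hv : v.IsReal),
    0 < InfinitePlace.Completion.extensionEmbeddingOfIsReal hv ((x : InfiniteAdeleRing K) v)}

theorem infIdele_apply_ne_zero (x : (InfiniteAdeleRing K)ˣ) (v : InfinitePlace K) :
    (x : InfiniteAdeleRing K) v ≠ 0 :=
  (x.isUnit.map (Pi.evalMonoidHom (fun v : InfinitePlace K => v.Completion) v)).ne_zero

theorem one_mem_positiveIdeles : 1 ∈ positiveIdeles K := fun _ hv =>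
  (map_one (InfinitePlace.Completion.extensionEmbeddingOfIsReal hv)).symm ▸ one_pos

variable [NumberField K]

theorem positiveIdeles_subset_connectedComponent :
    positiveIdeles K ⊆ Subgroup.connectedComponentOfOne (InfiniteAdeleRing K)ˣ := by
  intro x hx
  have hpre : ∀ v : InfinitePlace K, PreconnectedSpace (positivePart v) := fun v =>
    isPreconnected_iff_preconnectedSpace.1 (isPreconnected_positivePart v)
  let f : (∀ v : InfinitePlace K, positivePart v) → (InfiniteAdeleRing K)ˣ := fun s =>
    { val := fun v => (s v : v.Completion)
      inv := fun v => (s v : v.Completion)⁻¹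
      val_inv := funext fun v => mul_inv_cancel₀ (s v).2.1
      inv_val := funext fun v => inv_mul_cancel₀ (s v).2.1 }
  have hf : Continuous f := Units.continuous_iff.2
    ⟨continuous_pi fun v => continuous_subtype_val.comp (continuous_apply v),
      continuous_pi fun v =>
        (continuous_subtype_val.comp (continuous_apply v)).inv₀ fun s => (s v).2.1⟩
  have hrange : positiveIdeles K ⊆ Set.range f := fun y hy =>
    ⟨fun v => ⟨(y : InfiniteAdeleRing K) v, infIdele_apply_ne_zero y v, hy v⟩, Units.ext rfl⟩
  exact (isPreconnected_range hf).subset_connectedComponent (hrange one_mem_positiveIdeles)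
    (hrange hx)

theorem isOpen_positiveIdeles : IsOpen (positiveIdeles K) := by
  simp only [positiveIdeles, Set.ofPred_forall]
  exact isOpen_iInter_of_finite fun v => isOpen_iInter_of_finite fun hv =>
    isOpen_lt continuous_const
      ((InfinitePlace.Completion.isometry_extensionEmbeddingOfIsReal hv).continuous.comp
        ((continuous_apply v).comp Units.continuous_val))

theorem mem_or_neg_mem_positiveIdeles (hr : InfinitePlace.nrRealPlaces K ≤ 1)
    (x : (InfiniteAdeleRing K)ˣ) : x ∈ positiveIdeles K ∨ -x ∈ positiveIdeles K := by
  classical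
  refine or_iff_not_imp_left.2 fun hx => ?_
  simp only [positiveIdeles, Set.mem_ofPred_eq, not_forall, not_lt] at hx
  obtain ⟨v, hv, hle⟩ := hx
  intro w hw
  obtain rfl : w = v := congrArg Subtype.val
    (Fintype.card_le_one_iff.1 hr (⟨w, hw⟩ : {w : InfinitePlace K // w.IsReal}) ⟨v, hv⟩)
  change 0 < InfinitePlace.Completion.extensionEmbeddingOfIsReal hw (-(x : InfiniteAdeleRing K) w)
  rw [map_neg, neg_pos]
  exact lt_of_le_of_ne hle ((map_ne_zero _).2 (infIdele_apply_ne_zero x w))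

end InfiniteIdeles

section IdeleClasses

variable {K : Type u} [Field K] [NumberField K]

/-- The infinite component of an idele. -/
def ideleInf (K : Type u) [Field K] [NumberField K] : (Adele K)ˣ →* (InfiniteAdeleRing K)ˣ :=
  Units.map
    { toFun := fun a : Adele K => (a.1 : InfiniteAdeleRing K)
      map_one' := rfl
      map_mul' := fun _ _ => rfl }

/-- The finite component of an idele. -/
def ideleFin (K : Type u) [Field K] [NumberField K] : (Adele K)ˣ →* (FinAdele K)ˣ :=
  Units.map
    { toFun := fun a : Adele K => (a.2 : FinAdele K)
      map_one' := rfl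
      map_mul' := fun _ _ => rfl }

theorem continuous_ideleInf : Continuous (ideleInf K) :=
  Continuous.units_map _ continuous_fst

theorem continuous_ideleFin : Continuous (ideleFin K) :=
  Continuous.units_map _ continuous_snd

theorem infIdele_mul_finIdele (a : (Adele K)ˣ) :
    infIdele K (ideleInf K a) * finIdele K (ideleFin K a) = a :=
  Units.ext (Prod.ext (mul_one (a : Adele K).1) (one_mul (a : Adele K).2))

theorem infIdele_mem_ideleU {x : (InfiniteAdeleRing K)ˣ} (hx : x ∈ positiveIdeles K) :
    infIdele K x ∈ ideleU K :=
  Subgroup.le_topologicalClosure _ (Subgroup.mem_sup_right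
    ⟨x, positiveIdeles_subset_connectedComponent hx, rfl⟩)

theorem diagIdele_mem_ideleU (x : Kˣ) : diagIdele K x ∈ ideleU K :=
  Subgroup.le_topologicalClosure _ (Subgroup.mem_sup_left ⟨x, rfl⟩)

theorem ideleClass_eq_one {a : (Adele K)ˣ} (ha : a ∈ ideleU K) : ideleClass K a = 1 :=
  (QuotientGroup.eq_one_iff a).2 ha

/-- The map `ô^* → 𝔸^*/U`. -/
def unitClass (K : Type u) [Field K] [NumberField K] (r : integralIdeles K) : IdeleClassQuot K :=
  ideleClass K (finIdele K r)

theorem ideleClass_eq_unitClass {a : (Adele K)ˣ} (hinf : ideleInf K a ∈ positiveIdeles K)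
    {r : integralIdeles K} (hr : r = ideleFin K a) : ideleClass K a = unitClass K r := by
  rw [← infIdele_mul_finIdele a, map_mul, ideleClass_eq_one (infIdele_mem_ideleU hinf), one_mul,
    ← hr, unitClass]

theorem isOpen_integralIdeles : IsOpen (integralIdeles K : Set (FinAdele K)ˣ) :=
  (isOpen_integralAdeles.preimage Units.continuous_val).inter
    (isOpen_integralAdeles.preimage Units.continuous_coe_inv)

theorem isOpenMap_unitClass : IsOpenMap (unitClass K) := by
  intro W hW
  have hW' : IsOpen (Subtype.val '' W : Set (FinAdele K)ˣ) :=
    isOpen_integralIdeles.isOpenMap_subtype_val W hW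
  let P : Set (Adele K)ˣ := ideleInf K ⁻¹' positiveIdeles K ∩ ideleFin K ⁻¹' (Subtype.val '' W)
  have hP : IsOpen P := (isOpen_positiveIdeles.preimage continuous_ideleInf).inter
    (hW'.preimage continuous_ideleFin)
  have hPW : unitClass K '' W = (QuotientGroup.mk : (Adele K)ˣ → (Adele K)ˣ ⧸ ideleU K) '' P := by
    ext q
    constructor
    · rintro ⟨r, hr, rfl⟩
      exact ⟨finIdele K r, ⟨one_mem_positiveIdeles, r, hr, rfl⟩, rfl⟩
    · rintro ⟨a, ⟨ha, r, hr, hra⟩, rfl⟩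
      exact ⟨r, hr, (ideleClass_eq_unitClass ha hra).symm⟩
  rw [hPW]
  exact QuotientGroup.isOpenMap_coe P hP

theorem exists_diagIdele_mul_mem (hK : NumberField.classNumber K = 1)
    (hr : InfinitePlace.nrRealPlaces K ≤ 1) (a : (Adele K)ˣ) :
    ∃ l : Kˣ, ideleFin K (diagIdele K l * a) ∈ integralIdeles K ∧
      ideleInf K (diagIdele K l * a) ∈ positiveIdeles K := by
  obtain ⟨σ, hσ⟩ := exists_section hK (⊤ : Subgroup Kˣ) fun x => Or.inl trivial
  obtain ⟨l, hl⟩ : ∃ l : Kˣ, ideleFin K (diagIdele K l * a) ∈ integralIdeles K := by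
    refine ⟨(σ (ideleFin K a : IdealGroup K))⁻¹, ?_⟩
    have hgen := QuotientGroup.eq.1 (hσ (ideleFin K a : IdealGroup K)).2
    rwa [← map_inv] at hgen
  rcases mem_or_neg_mem_positiveIdeles hr (ideleInf K (diagIdele K l * a)) with hpos | hpos
  · exact ⟨l, hl, hpos⟩
  · have hneg : diagIdele K (-l) * a = -(diagIdele K l * a) := by
      rw [← neg_mul]
      exact congrArg (· * a) (Units.ext (map_neg (algebraMap K (Adele K)) (l : K)))
    have hfin : ideleFin K (-(diagIdele K l * a)) = -ideleFin K (diagIdele K l * a) :=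
      Units.ext rfl
    have hinf : ideleInf K (-(diagIdele K l * a)) = -ideleInf K (diagIdele K l * a) :=
      Units.ext rfl
    refine ⟨-l, ?_, ?_⟩
    · rw [hneg, hfin]
      exact neg_mem_integralIdeles hl
    · rwa [hneg, hinf]

theorem surjective_unitClass (hK : NumberField.classNumber K = 1)
    (hr : InfinitePlace.nrRealPlaces K ≤ 1) : Function.Surjective (unitClass K) := by
  intro q
  obtain ⟨a, rfl⟩ : ∃ a, ideleClass K a = q := QuotientGroup.mk_surjective q
  obtain ⟨l, hfin, hinf⟩ := exists_diagIdele_mul_mem hK hr a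
  refine ⟨⟨_, hfin⟩, ?_⟩
  rw [← ideleClass_eq_unitClass hinf rfl, map_mul, ideleClass_eq_one (diagIdele_mem_ideleU l),
    one_mul]

end IdeleClasses

section Homeomorphism

variable {K : Type u} [Field K] [NumberField K]

/-- The map `𝔸_f → X`, `y ↦ [(1, y)]`, through which `phiStar` factors. -/
def toX (y : FinAdele K) : SpaceX K := Quotient.mk (spaceXSetoid K) (1, y)

theorem continuous_toX : Continuous (toX (K := K)) :=
  continuous_quotient_mk'.comp (by fun_prop)

theorem toX_eq_iff (y y' : FinAdele K) : toX y = toX y' ↔ adeleSetoid K y y' := by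
  refine ⟨fun h => ?_, fun h => congrArg (phiStar K) (Quotient.sound h)⟩
  obtain ⟨r, hr, h⟩ := Quotient.exact h
  have hclass : ideleClass K (finIdele K r) * 1 = 1 := congrArg Prod.fst h
  have hy' : ((r⁻¹ : (FinAdele K)ˣ) : FinAdele K) * y = y' := congrArg Prod.snd h
  refine ⟨r, hr, (QuotientGroup.eq_one_iff _).1 (by rwa [mul_one] at hclass), ?_⟩
  rw [← hy', Units.mul_inv_cancel_left]

theorem mk_unitClass_eq_toX (r : integralIdeles K) (y : FinAdele K) :
    Quotient.mk (spaceXSetoid K) (unitClass K r, y) =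
      toX (((r : (FinAdele K)ˣ) : FinAdele K) * y) := by
  refine Quotient.sound ⟨(r : (FinAdele K)ˣ)⁻¹, inv_mem r.2, Prod.ext ?_ ?_⟩
  · change ideleClass K (finIdele K (r : (FinAdele K)ˣ)⁻¹) * ideleClass K (finIdele K r) = 1
    rw [← map_mul, ← map_mul, inv_mul_cancel, map_one, map_one]
  · rw [inv_inv]

theorem surjective_toX (hK : NumberField.classNumber K = 1)
    (hr : InfinitePlace.nrRealPlaces K ≤ 1) : Function.Surjective (toX (K := K)) := by
  intro p
  obtain ⟨⟨q, y⟩, rfl⟩ := Quotient.exists_rep p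
  obtain ⟨r, rfl⟩ := surjective_unitClass hK hr q
  exact ⟨_, (mk_unitClass_eq_toX r y).symm⟩

theorem isOpenMap_toX (hK : NumberField.classNumber K = 1)
    (hr : InfinitePlace.nrRealPlaces K ≤ 1) : IsOpenMap (toX (K := K)) := by
  intro O hO
  let W : Set (integralIdeles K × FinAdele K) :=
    {p | ((p.1 : (FinAdele K)ˣ) : FinAdele K) * p.2 ∈ O}
  have hW : IsOpen W := hO.preimage <|
    (Units.continuous_val.comp (continuous_subtype_val.comp continuous_fst)).mul continuous_snd
  have hpreimage : Quotient.mk (spaceXSetoid K) ⁻¹' (toX '' O) =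
      Prod.map (unitClass K) (id : FinAdele K → FinAdele K) '' W := by
    ext ⟨q, y⟩
    constructor
    · obtain ⟨r, rfl⟩ := surjective_unitClass hK hr q
      rintro ⟨y', hy', h⟩
      rw [mk_unitClass_eq_toX, toX_eq_iff] at h
      obtain ⟨z, hz, hzU, h⟩ := h
      refine ⟨(⟨z, hz⟩ * r, y), ?_, Prod.ext ?_ rfl⟩
      · change ((z * (r : (FinAdele K)ˣ) : (FinAdele K)ˣ) : FinAdele K) * y ∈ O
        rwa [Units.val_mul, mul_assoc, ← h]
      · change ideleClass K (finIdele K (z * r)) = ideleClass K (finIdele K r)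
        rw [map_mul, map_mul, ideleClass_eq_one hzU, one_mul]
    · rintro ⟨⟨r, y⟩, hry, h⟩
      exact ⟨_, hry, (mk_unitClass_eq_toX r y).symm.trans (congrArg _ h)⟩
  refine isQuotientMap_quotient_mk'.isOpen_preimage.1 ?_
  change IsOpen (Quotient.mk (spaceXSetoid K) ⁻¹' (toX '' O))
  rw [hpreimage]
  exact (isOpenMap_unitClass.prodMap IsOpenMap.id) W hW

theorem bijective_phiStar (hK : NumberField.classNumber K = 1)
    (hr : InfinitePlace.nrRealPlaces K ≤ 1) : Function.Bijective (phiStar K) := by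
  constructor
  · rintro ⟨y⟩ ⟨y'⟩ h
    exact Quotient.sound ((toX_eq_iff y y').1 h)
  · intro p
    obtain ⟨y, rfl⟩ := surjective_toX hK hr p
    exact ⟨Quotient.mk _ y, rfl⟩

theorem isOpenMap_phiStar (hK : NumberField.classNumber K = 1)
    (hr : InfinitePlace.nrRealPlaces K ≤ 1) : IsOpenMap (phiStar K) :=
  IsOpenMap.of_comp (f := Quotient.mk (adeleSetoid K)) continuous_quotient_mk'
    Quotient.mk_surjective (isOpenMap_toX hK hr)

/-- The homeomorphism `φ^*`. -/
def phiStarHomeomorph (hK : NumberField.classNumber K = 1)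
    (hr : InfinitePlace.nrRealPlaces K ≤ 1) : AdeleQuot K ≃ₜ SpaceX K :=
  (Equiv.ofBijective (phiStar K) (bijective_phiStar hK hr)).toHomeomorphOfContinuousOpen
    (continuous_toX.quotient_lift _) (isOpenMap_phiStar hK hr)

theorem mul_mem_integralAdeles_iff {z : (FinAdele K)ˣ} (hz : z ∈ integralIdeles K)
    (y : FinAdele K) : (z : FinAdele K) * y ∈ integralAdeles K ↔ y ∈ integralAdeles K := by
  refine ⟨fun h => ?_, fun h => mul_mem hz.1 h⟩
  have hmul : ((z⁻¹ : (FinAdele K)ˣ) : FinAdele K) * ((z : FinAdele K) * y) ∈ integralAdeles K :=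
    mul_mem hz.2 h
  rwa [Units.inv_mul_cancel_left] at hmul

theorem mk_mem_subsetY (q : IdeleClassQuot K) (y : FinAdele K) :
    Quotient.mk (spaceXSetoid K) (q, y) ∈ subsetY K ↔ y ∈ integralAdeles K := by
  refine ⟨?_, fun h => ⟨q, y, h, rfl⟩⟩
  rintro ⟨q', y', hy', h⟩
  obtain ⟨r, hr, h⟩ := Quotient.exact h
  obtain rfl : ((r⁻¹ : (FinAdele K)ˣ) : FinAdele K) * y = y' := congrArg Prod.snd h
  exact (mul_mem_integralAdeles_iff (inv_mem hr) y).1 hy'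

theorem toX_mem_subsetY (y : FinAdele K) : toX y ∈ subsetY K ↔ y ∈ integralAdeles K :=
  mk_mem_subsetY 1 y

theorem isClopen_subsetY : IsClopen (subsetY K) := by
  refine isQuotientMap_quotient_mk'.isClopen_preimage.1 ?_
  have hpreimage : Quotient.mk (spaceXSetoid K) ⁻¹' subsetY K =
      Prod.snd ⁻¹' (integralAdeles K) := by
    ext p
    exact mk_mem_subsetY p.1 p.2
  change IsClopen (Quotient.mk (spaceXSetoid K) ⁻¹' subsetY K)
  rw [hpreimage]
  exact isClopen_integralAdeles.preimage continuous_snd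

theorem isCompact_subsetY (hK : NumberField.classNumber K = 1)
    (hr : InfinitePlace.nrRealPlaces K ≤ 1) : IsCompact (subsetY K) := by
  have himage : subsetY K = toX '' (integralAdeles K) := by
    rw [← Set.image_preimage_eq (subsetY K) (surjective_toX hK hr)]
    exact congrArg (toX '' ·) (Set.ext toX_mem_subsetY)
  rw [himage]
  exact isCompact_integralAdeles.image continuous_toX

theorem mk_mem_integralQuot (y : FinAdele K) :
    Quotient.mk (adeleSetoid K) y ∈ integralQuot K ↔ y ∈ integralAdeles K := by
  refine ⟨?_, fun h => ⟨y, h, rfl⟩⟩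
  rintro ⟨y', hy', h⟩
  obtain ⟨z, hz, -, rfl⟩ := Quotient.exact h
  exact (mul_mem_integralAdeles_iff hz y').2 hy'

theorem isClopen_integralQuot : IsClopen (integralQuot K) := by
  refine isQuotientMap_quotient_mk'.isClopen_preimage.1 ?_
  have hpreimage : Quotient.mk (adeleSetoid K) ⁻¹' integralQuot K = integralAdeles K :=
    Set.ext mk_mem_integralQuot
  change IsClopen (Quotient.mk (adeleSetoid K) ⁻¹' integralQuot K)
  rw [hpreimage]
  exact isClopen_integralAdeles

theorem isCompact_integralQuot : IsCompact (integralQuot K) := by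
  have himage : integralQuot K = Quotient.mk (adeleSetoid K) '' (integralAdeles K) := by
    ext p
    exact ⟨fun ⟨y, hy, h⟩ => ⟨y, hy, h.symm⟩, fun ⟨y, hy, h⟩ => ⟨y, hy, h.symm⟩⟩
  rw [himage]
  exact isCompact_integralAdeles.image continuous_quotient_mk'

theorem phiStar_mem_subsetY (p : AdeleQuot K) :
    phiStar K p ∈ subsetY K ↔ p ∈ integralQuot K := by
  obtain ⟨y, rfl⟩ := Quotient.exists_rep p
  exact (toX_mem_subsetY y).trans (mk_mem_integralQuot y).symm

theorem idealActX_coe_toX {z : (FinAdele K)ˣ} (hz : finIdele K z ∈ ideleU K) (y : FinAdele K) :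
    idealActX K (z : IdealGroup K) (toX y) = toX ((z : FinAdele K) * y) := by
  refine congrArg (Quotient.mk (spaceXSetoid K)) (Prod.ext ?_ rfl)
  change (ideleClass K (finIdele K z))⁻¹ * 1 = 1
  rw [ideleClass_eq_one hz, inv_one, one_mul]

theorem phiStar_scalarAct {G : Subgroup Kˣ} (hG : IsTotallyPositive G) (l : G) (p : AdeleQuot K) :
    phiStar K (scalarAct G hG (l : ScalarGroup G) p) =
      idealActX K (diagFin K l : IdealGroup K) (phiStar K p) := by
  obtain ⟨y, rfl⟩ := Quotient.exists_rep p
  exact (idealActX_coe_toX (finIdele_diagFin_mem _ (hG l l.2)) y).symm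

end Homeomorphism

section Transport

theorem indicatorC₀_apply {X : Type u} [TopologicalSpace X] {S : Set X}
    (h : IsClopen S ∧ IsCompact S) (x : X) : indicatorC₀ S x = S.indicator 1 x := by
  rw [indicatorC₀, dif_pos h]
  rfl

/-- The isomorphism `C₀(X) ≅ C₀(X')` induced by a homeomorphism `X' ≅ X`. -/
def compHomeomorph {X X' : Type*} [TopologicalSpace X] [TopologicalSpace X'] (φ : X' ≃ₜ X) :
    C₀(X, ℂ) ≃⋆ₐ[ℂ] C₀(X', ℂ) where
  toFun f := f.comp φ.toCocompactMap
  invFun f := f.comp φ.symm.toCocompactMap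
  left_inv f := by
    ext x
    exact congrArg f (φ.apply_symm_apply x)
  right_inv f := by
    ext x
    exact congrArg f (φ.symm_apply_apply x)
  map_mul' _ _ := rfl
  map_add' _ _ := rfl
  map_star' _ := rfl
  map_smul' _ _ := rfl

theorem compHomeomorph_indicatorC₀ {X X' : Type u} [TopologicalSpace X] [TopologicalSpace X']
    (φ : X' ≃ₜ X) (S : Set X) :
    compHomeomorph φ (indicatorC₀ S) = indicatorC₀ (φ ⁻¹' S) := by
  have hiff : IsClopen (φ ⁻¹' S) ∧ IsCompact (φ ⁻¹' S) ↔ IsClopen S ∧ IsCompact S :=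
    and_congr φ.isQuotientMap.isClopen_preimage φ.isCompact_preimage
  by_cases hS : IsClopen S ∧ IsCompact S
  · ext x
    rw [indicatorC₀_apply (hiff.2 hS)]
    exact indicatorC₀_apply hS (φ x)
  · rw [indicatorC₀, indicatorC₀, dif_neg hS, dif_neg (mt hiff.1 hS), map_zero]

theorem compHomeomorph_translation {X X' G G' : Type u} [TopologicalSpace X] [TopologicalSpace X']
    [Group G] [Group G'] {φ : X' ≃ₜ X} {ρ : G →* (X ≃ₜ X)} {ρ' : G' →* (X' ≃ₜ X')} {γ : G ≃* G'}
    (h : ∀ g p, φ (ρ' (γ g) p) = ρ g (φ p)) (g : G) (f : C₀(X, ℂ)) :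
    compHomeomorph φ (translation ρ g f) = translation ρ' (γ g) (compHomeomorph φ f) := by
  ext p
  change f (ρ g⁻¹ (φ p)) = f (φ (ρ' (γ g)⁻¹ p))
  rw [← map_inv γ, h]

/-- The isomorphism of corners induced by an isomorphism matching the projections. -/
def cornerCongr {B B' : Type*} [NonUnitalCStarAlgebra B] [NonUnitalCStarAlgebra B']
    (Ψ : B ≃⋆ₐ[ℂ] B') {e : B} {e' : B'} (he : IsStarProjection e) (he' : IsStarProjection e')
    (h : Ψ e = e') : corner e he ≃⋆ₐ[ℂ] corner e' he' where
  toFun a := ⟨Ψ a, by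
    obtain ⟨_, b, rfl⟩ := a
    exact ⟨Ψ b, by rw [map_mul, map_mul, h]⟩⟩
  invFun a := ⟨Ψ.symm a, by
    obtain ⟨_, b, rfl⟩ := a
    exact ⟨Ψ.symm b, by rw [map_mul, map_mul, ← h, StarAlgEquiv.symm_apply_apply]⟩⟩
  left_inv _ := Subtype.ext (Ψ.symm_apply_apply _)
  right_inv _ := Subtype.ext (Ψ.apply_symm_apply _)
  map_mul' _ _ := Subtype.ext (map_mul Ψ _ _)
  map_add' _ _ := Subtype.ext (map_add Ψ _ _)
  map_star' _ := Subtype.ext (map_star Ψ _)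
  map_smul' c _ := Subtype.ext (map_smul Ψ c _)

variable {K : Type u} [Field K] [NumberField K]

theorem phiStarInducesIsos (hK : NumberField.classNumber K = 1)
    (hr : InfinitePlace.nrRealPlaces K ≤ 1) {G : Subgroup Kˣ} (hG : IsTotallyPositive G)
    (hG' : ∀ x : Kˣ, x ∈ G ∨ -x ∈ G) : PhiStarInducesIsos G hG := by
  obtain ⟨γ, hγ⟩ := exists_scalarGroup_mulEquiv hK G hG'
  let φ := phiStarHomeomorph hK hr
  have hequi : ∀ z p, φ (scalarAct G hG (γ z) p) = idealActX K z (φ p) := by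
    intro z p
    obtain ⟨l, hl⟩ := QuotientGroup.mk_surjective (γ z)
    obtain rfl : (diagFin K l : IdealGroup K) = z := γ.injective ((hγ l).trans hl)
    rw [hγ]
    exact phiStar_scalarAct hG l p
  let Ψ := CrossedProduct.congr (compHomeomorph φ) γ (compHomeomorph_translation hequi)
  have hΨe : Ψ (indicatorElt (idealActX K) (subsetY K)) =
      indicatorElt (scalarAct G hG) (integralQuot K) := by
    rw [indicatorElt, CrossedProduct.congr_mk, map_one, compHomeomorph_indicatorC₀, indicatorElt]
    exact congrArg (fun S => CrossedProduct.mk _ (indicatorC₀ S) 1) (Set.ext phiStar_mem_subsetY)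
  refine ⟨φ, fun _ => rfl, Ψ, fun f l => ?_, cornerCongr Ψ (isStarProjection_indicatorElt _ _)
    (isStarProjection_indicatorElt _ _) hΨe, fun _ => rfl⟩
  rw [CrossedProduct.congr_mk, hγ]
  rfl

end Transport

namespace RingCStarAlgebra

variable {R : Type u} [CommRing R]

/-- The representation of `𝔄[R]` defined by a representation of the generators and relations. -/
def eval (ρ : RingRep R) : RingCStarAlgebra R →⋆ₐ[ℂ] (ρ.H →L[ℂ] ρ.H) where
  toFun x := (x.1 : RingRep.Ambient R) ρ
  map_one' := rfl
  map_mul' _ _ := rfl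
  map_zero' := rfl
  map_add' _ _ := rfl
  commutes' _ := rfl
  map_star' _ := rfl

theorem eval_s (ρ : RingRep R) (m : R⁰) : eval ρ (s m) = ρ.s m := rfl

theorem eval_u (ρ : RingRep R) (n : R) : eval ρ (u n) = ρ.u n := rfl

theorem ext_eval {x y : RingCStarAlgebra R} (h : ∀ ρ, eval ρ x = eval ρ y) : x = y :=
  Subtype.ext (lp.ext (funext h))

theorem norm_le_of_forall_eval {x : RingCStarAlgebra R} {C : ℝ} (hC : 0 ≤ C)
    (h : ∀ ρ, ‖eval ρ x‖ ≤ C) : ‖x‖ ≤ C :=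
  lp.norm_le_of_forall_le hC h

theorem star_s_mul_s (m : R⁰) : star (s m) * s m = 1 :=
  ext_eval fun ρ => by rw [map_mul, map_star, eval_s, ρ.isometry_s, map_one]

theorem s_mul_s (k m : R⁰) : s k * s m = s (k * m) :=
  ext_eval fun ρ => by rw [map_mul, eval_s, eval_s, eval_s, ρ.s_mul]

theorem u_mul_u (l n : R) : u l * u n = u (l + n) :=
  ext_eval fun ρ => by rw [map_mul, eval_u, eval_u, eval_u, ρ.u_mul]

theorem star_u_mul_u (n : R) : star (u n) * u n = 1 :=
  ext_eval fun ρ => by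
    rw [map_mul, map_star, eval_u, map_one]
    exact (Unitary.mem_iff.1 (ρ.unitary_u n)).1

theorem s_mul_u (m : R⁰) (n : R) : s m * u n = u (m * n) * s m :=
  ext_eval fun ρ => by rw [map_mul, map_mul, eval_u, eval_s, eval_u, ρ.s_mul_u]

theorem u_zero : u (0 : R) = 1 := by
  have h := u_mul_u (0 : R) 0
  rw [add_zero] at h
  calc u (0 : R) = star (u 0) * u 0 * u 0 := by rw [star_u_mul_u, one_mul]
    _ = 1 := by rw [mul_assoc, h, star_u_mul_u]

theorem u_mul_u_neg (n : R) : u n * u (-n) = 1 := by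
  rw [u_mul_u, add_neg_cancel, u_zero]

theorem star_u (n : R) : star (u n) = u (-n) :=
  calc star (u n) = star (u n) * (u n * u (-n)) := by rw [u_mul_u_neg, mul_one]
    _ = u (-n) := by rw [← mul_assoc, star_u_mul_u, one_mul]

/-- The projection `u^n s_m s_m^* u^{-n}`, which corresponds to the coset `n + (m)`. -/
def proj (m : R⁰) (n : R) : RingCStarAlgebra R := u n * (s m * star (s m)) * u (-n)

theorem proj_zero (m : R⁰) : proj m 0 = s m * star (s m) := by
  rw [proj, neg_zero, u_zero, one_mul, mul_one]

theorem proj_eq_mul_star (m : R⁰) (n : R) : proj m n = (u n * s m) * star (u n * s m) := by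
  rw [proj, star_mul, star_u]
  simp only [mul_assoc]

theorem star_u_mul_s_mul_u_mul_s (m : R⁰) (n : R) : star (u n * s m) * (u n * s m) = 1 := by
  rw [star_mul, mul_assoc, ← mul_assoc (star (u n)), star_u_mul_u, one_mul, star_s_mul_s]

theorem isStarProjection_proj (m : R⁰) (n : R) : IsStarProjection (proj m n) := by
  rw [proj_eq_mul_star]
  refine ⟨?_, IsSelfAdjoint.mul_star_self _⟩
  rw [IsIdempotentElem, mul_assoc, ← mul_assoc (star _), star_u_mul_s_mul_u_mul_s, one_mul]

theorem u_add_mul_s (m : R⁰) (n k : R) : u (n + m * k) * s m = u n * s m * u k := by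
  rw [mul_assoc, s_mul_u, ← mul_assoc, u_mul_u]

theorem proj_congr {m : R⁰} {n n' : R} (h : (m : R) ∣ n - n') : proj m n = proj m n' := by
  obtain ⟨k, hk⟩ := h
  rw [← add_sub_cancel n' n, hk, proj_eq_mul_star, u_add_mul_s, star_mul, mul_assoc,
    ← mul_assoc (u k), star_u, u_mul_u_neg, one_mul, proj_eq_mul_star]

theorem proj_out (m : R⁰) (n : R) :
    proj m (Quotient.out (Ideal.Quotient.mk (Ideal.span {(m : R)}) n)) = proj m n := by
  refine proj_congr ?_
  rw [← Ideal.mem_span_singleton, ← Ideal.Quotient.eq]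
  exact Quotient.out_eq _

theorem sum_proj (m : R⁰) [Fintype (R ⧸ Ideal.span {(m : R)})] :
    ∑ c : R ⧸ Ideal.span {(m : R)}, proj m (Quotient.out c) = 1 :=
  ext_eval fun ρ => by
    rw [map_one, ← ρ.sum_eq_one m, finsum_eq_sum_of_fintype, map_sum]
    rfl

theorem proj_eq_sum (m k : R⁰) (n : R) [Fintype (R ⧸ Ideal.span {(k : R)})] :
    proj m n = ∑ c : R ⧸ Ideal.span {(k : R)}, proj (m * k) (n + m * Quotient.out c) := by
  have hterm (j : R) :
      proj (m * k) (n + m * j) = u n * s m * proj k j * star (u n * s m) := by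
    have hus : u (n + m * j) * s (m * k) = u n * s m * (u j * s k) := by
      rw [← s_mul_s, ← mul_assoc, u_add_mul_s]
      simp only [mul_assoc]
    rw [proj_eq_mul_star, proj_eq_mul_star, hus, star_mul (u n * s m)]
    simp only [mul_assoc]
  have hsum : ∑ c : R ⧸ Ideal.span {(k : R)}, u n * s m * proj k (Quotient.out c) *
        star (u n * s m) =
      u n * s m * (∑ c : R ⧸ Ideal.span {(k : R)}, proj k (Quotient.out c)) *
        star (u n * s m) :=
    (Finset.sum_mul _ _ _).symm.trans (congrArg (· * _) (Finset.mul_sum _ _ _).symm)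
  rw [Finset.sum_congr rfl fun c _ => hterm _, hsum, sum_proj, mul_one, proj_eq_mul_star]

theorem star_s_mul_proj_mul_s (c m : R⁰) (n : R) :
    star (s c) * proj (c * m) (c * n) * s c = proj m n := by
  have hus : u (c * n) * s (c * m) = s c * (u n * s m) := by
    rw [← s_mul_s, ← mul_assoc, ← mul_assoc, s_mul_u]
  rw [proj_eq_mul_star, hus, star_mul (s c)]
  calc _ = star (s c) * s c * (u n * s m * star (u n * s m)) * (star (s c) * s c) := by
        simp only [mul_assoc]
    _ = proj m n := by rw [star_s_mul_s, one_mul, mul_one, proj_eq_mul_star]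

end RingCStarAlgebra

theorem mul_eq_zero_of_isStarProjection_of_sum_eq_one {B ι : Type*} [CStarAlgebra B] [Fintype ι]
    {p : ι → B} (hp : ∀ i, IsStarProjection (p i)) (hsum : ∑ i, p i = 1) {i j : ι} (hij : i ≠ j) :
    p i * p j = 0 := by
  classical
  let _ := CStarAlgebra.spectralOrder B
  let _ := CStarAlgebra.spectralOrderedRing B
  have hidem : ∀ k, p k * p k = p k := fun k => (hp k).isIdempotentElem
  have hterm : ∀ k, star (p k * p j) * (p k * p j) = p j * p k * p j := fun k => by
    rw [star_mul, (hp j).isSelfAdjoint.star_eq, (hp k).isSelfAdjoint.star_eq, mul_assoc,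
      ← mul_assoc (p k), hidem, mul_assoc]
  -- Compressing `∑ k, p k = 1` by `p j` gives `p j = p j + ∑ k ≠ j, |p k * p j|²`.
  have hall : ∑ k, star (p k * p j) * (p k * p j) = p j := by
    simp only [hterm, ← Finset.sum_mul, ← Finset.mul_sum, hsum, mul_one, hidem]
  have hrest : ∑ k ∈ Finset.univ.erase j, star (p k * p j) * (p k * p j) = 0 := by
    rw [← Finset.add_sum_erase _ _ (Finset.mem_univ j), hterm j, hidem, hidem] at hall
    exact add_eq_left.1 hall
  rw [Finset.sum_eq_zero_iff_of_nonneg fun k _ => star_mul_self_nonneg _] at hrest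
  exact (CStarRing.star_mul_self_eq_zero_iff _).1
    (hrest i (Finset.mem_erase.2 ⟨hij, Finset.mem_univ i⟩))

namespace RingCStarAlgebra

variable {R : Type u} [CommRing R] [∀ m : R⁰, Finite (R ⧸ Ideal.span {(m : R)})]

theorem proj_mul_proj_of_not_dvd {m : R⁰} {n n' : R} (h : ¬ (m : R) ∣ n - n') :
    proj m n * proj m n' = 0 := by
  have := Fintype.ofFinite (R ⧸ Ideal.span {(m : R)})
  rw [← proj_out m n, ← proj_out m n']
  refine mul_eq_zero_of_isStarProjection_of_sum_eq_one
    (p := fun c : R ⧸ Ideal.span {(m : R)} => proj m (Quotient.out c))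
    (fun _ => isStarProjection_proj _ _) (sum_proj m) ?_
  rwa [Ne, Ideal.Quotient.eq, Ideal.mem_span_singleton]

theorem commute_proj (m m' : R⁰) (n n' : R) : Commute (proj m n) (proj m' n') := by
  have hsame : ∀ (m : R⁰) (n n' : R), Commute (proj m n) (proj m n') := fun m n n' => by
    by_cases h : (m : R) ∣ n - n'
    · rw [proj_congr h]
    · have h' : ¬ (m : R) ∣ n' - n := by rwa [← dvd_neg, neg_sub]
      exact (proj_mul_proj_of_not_dvd h).trans (proj_mul_proj_of_not_dvd h').symm
  have := Fintype.ofFinite (R ⧸ Ideal.span {(m : R)})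
  have := Fintype.ofFinite (R ⧸ Ideal.span {(m' : R)})
  rw [proj_eq_sum m m' n, proj_eq_sum m' m n', mul_comm m' m]
  exact Commute.sum_left _ _ _ fun c _ => Commute.sum_right _ _ _ fun c' _ => hsame _ _ _

theorem star_s_mul_u_mul_s_of_not_dvd {c : R⁰} {k : R} (h : ¬ (c : R) ∣ k) :
    star (s c) * u k * s c = 0 := by
  have horth : proj c 0 * proj c k = 0 :=
    proj_mul_proj_of_not_dvd (by rwa [zero_sub, dvd_neg])
  rw [proj_zero, proj_eq_mul_star] at horth
  calc star (s c) * u k * s c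
      = star (s c) * s c * (star (s c) * u k * s c) * (star (u k * s c) * (u k * s c)) := by
        rw [star_s_mul_s, star_u_mul_s_mul_u_mul_s, one_mul, mul_one]
    _ = star (s c) * (s c * star (s c) * (u k * s c * star (u k * s c))) * (u k * s c) := by
        simp only [mul_assoc]
    _ = 0 := by rw [horth, mul_zero, zero_mul]

theorem star_s_mul_proj_mul_s_of_not_dvd {c : R⁰} (m : R⁰) {k : R} (h : ¬ (c : R) ∣ k) :
    star (s c) * proj (c * m) k * s c = 0 := by
  rw [proj_eq_mul_star, ← s_mul_s]
  calc _ = star (s c) * u k * s c * (s m * star (u k * (s c * s m)) * s c) := by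
        simp only [mul_assoc]
    _ = 0 := by rw [star_s_mul_u_mul_s_of_not_dvd h, zero_mul]

end RingCStarAlgebra

section Cosets

variable {K : Type u} [Field K] [NumberField K]

instance finite_quotient_span (m : (𝓞 K)⁰) : Finite (𝓞 K ⧸ Ideal.span {(m : 𝓞 K)}) :=
  Ideal.finiteQuotientOfFreeOfNeBot _ <| by
    rw [Ne, Ideal.span_singleton_eq_bot]
    exact nonZeroDivisors.ne_zero m.2

theorem mem_integralCoset {m : (𝓞 K)⁰} {n : 𝓞 K} {y : integralAdeles K} :
    y ∈ integralCoset m n ↔ (y : FinAdele K) - intAdele n ∈ multiples m := by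
  constructor
  · rintro ⟨w, hw, h⟩
    exact ⟨w, hw, by rw [h, add_sub_cancel_left]⟩
  · rintro ⟨w, hw, h⟩
    exact ⟨w, hw, by rw [← sub_eq_iff_eq_add', ← h]⟩

theorem isClopen_integralCoset (m : (𝓞 K)⁰) (n : 𝓞 K) : IsClopen (integralCoset m n) := by
  have hpreimage : integralCoset m n =
      (fun y : integralAdeles K => (y : FinAdele K) - intAdele n) ⁻¹' multiples m := by
    ext y
    exact mem_integralCoset
  rw [hpreimage]
  exact IsClopen.preimage ⟨(isCompact_multiples m).isClosed, isOpen_multiples m⟩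
    (continuous_subtype_val.sub continuous_const)

theorem exists_mem_integralCoset (m : (𝓞 K)⁰) (y : integralAdeles K) :
    ∃ n, y ∈ integralCoset m n :=
  exists_eq_intAdele_add_mul y.2 m

theorem integralCoset_subset {m : (𝓞 K)⁰} (k : (𝓞 K)⁰) {n n' : 𝓞 K} (h : (m : 𝓞 K) ∣ n' - n) :
    integralCoset (m * k) n' ⊆ integralCoset m n := by
  rintro y ⟨w, hw, hy⟩
  obtain ⟨t, ht⟩ := h
  refine ⟨intAdele t + intAdele (k : 𝓞 K) * w,
    add_mem (intAdele_mem_integralAdeles t) (mul_mem (intAdele_mem_integralAdeles _) hw), ?_⟩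
  rw [hy, sub_eq_iff_eq_add'.1 ht]
  simp only [intAdele, Submonoid.coe_mul, map_add, map_mul]
  ring

theorem dvd_of_mem_integralCoset {m : (𝓞 K)⁰} {n n' : 𝓞 K} {y : integralAdeles K}
    (h : y ∈ integralCoset m n) (h' : y ∈ integralCoset m n') : (m : 𝓞 K) ∣ n - n' := by
  obtain ⟨w, hw, h⟩ := h
  obtain ⟨w', hw', h'⟩ := h'
  refine dvd_of_intAdele_eq_mul (sub_mem hw' hw) ?_
  rw [h] at h'
  simp only [intAdele, map_sub]
  linear_combination h'

theorem integralCoset_nonempty (m : (𝓞 K)⁰) (n : 𝓞 K) : (integralCoset m n).Nonempty :=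
  ⟨⟨intAdele n, intAdele_mem_integralAdeles n⟩, 0, zero_mem _, by
    simp only [intAdele, mul_zero, add_zero]⟩

theorem exists_forall_mem_integralCoset {n : (𝓞 K)⁰ → 𝓞 K}
    (h : ∀ m k : (𝓞 K)⁰, (m : 𝓞 K) ∣ n (m * k) - n m) : ∃ y, ∀ m, y ∈ integralCoset m (n m) := by
  obtain ⟨y, hy⟩ := IsCompact.nonempty_iInter_of_directed_nonempty_isCompact_isClosed
    (fun m : (𝓞 K)⁰ => integralCoset m (n m))
    (fun k m => ⟨k * m, integralCoset_subset m (h k m), by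
      change integralCoset (k * m) (n (k * m)) ⊆ integralCoset m (n m)
      rw [mul_comm k m]
      exact integralCoset_subset k (h m k)⟩)
    (fun m => integralCoset_nonempty m _) (fun m => (isClopen_integralCoset m _).1.isCompact)
    (fun m => (isClopen_integralCoset m _).1)
  exact ⟨y, Set.mem_iInter.1 hy⟩

theorem exists_integralCoset_subset {y : integralAdeles K} {U : Set (integralAdeles K)}
    (hU : U ∈ nhds y) (c : (𝓞 K)⁰) :
    ∃ m n, y ∈ integralCoset (c * m) n ∧ integralCoset (c * m) n ⊆ U := by
  obtain ⟨V, hVU, hV, hyV⟩ := mem_nhds_iff.1 hU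
  obtain ⟨W, hW, rfl⟩ := isOpen_induced_iff.1 hV
  have hzero : (0 : FinAdele K) ∈ (fun t => (y : FinAdele K) + t) ⁻¹' W := by
    rw [Set.mem_preimage, add_zero]
    exact hyV
  obtain ⟨m, hm⟩ := exists_multiples_subset
    (hW.preimage (continuous_const.add continuous_id)) hzero
  obtain ⟨n, hn⟩ := exists_mem_integralCoset (c * m) y
  refine ⟨m, n, hn, fun y' hy' => hVU ?_⟩
  obtain ⟨w, hw, h⟩ := hn
  obtain ⟨w', hw', h'⟩ := hy'
  have hdiff : (y' : FinAdele K) - y ∈ multiples m := by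
    rw [h, h']
    refine multiples_mul_subset m c ⟨w' - w, sub_mem hw' hw, ?_⟩
    rw [mul_comm m c]
    change _ * _ = _
    ring
  have hy'W : (y : FinAdele K) + (y' - y) ∈ W := hm hdiff
  rwa [add_sub_cancel] at hy'W

theorem exists_forall_eq_indicator_integralCoset {F : Type*} [MonoidWithZero F] [IsCancelMulZero F]
    {q : (𝓞 K)⁰ → 𝓞 K → F} (hidem : ∀ m n, IsIdempotentElem (q m n))
    (hcongr : ∀ {m : (𝓞 K)⁰} {n n' : 𝓞 K}, (m : 𝓞 K) ∣ n - n' → q m n = q m n')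
    (horth : ∀ {m : (𝓞 K)⁰} {n n' : 𝓞 K}, ¬ (m : 𝓞 K) ∣ n - n' → q m n * q m n' = 0)
    (hne : ∀ m, ∃ n, q m n ≠ 0)
    (hrefine : ∀ m k n, q m n ≠ 0 → ∃ j, q (m * k) (n + m * j) ≠ 0) :
    ∃ y, ∀ m n, q m n = (integralCoset m n).indicator 1 y := by
  choose n hn using hne
  have hunique : ∀ {m a b}, q m a ≠ 0 → q m b ≠ 0 → (m : 𝓞 K) ∣ a - b := fun ha hb =>
    not_not.1 fun h => mul_ne_zero ha hb (horth h)
  obtain ⟨y, hy⟩ := exists_forall_mem_integralCoset (n := n) fun m k => by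
    obtain ⟨j, hj⟩ := hrefine m k _ (hn m)
    have hdvd : (m : 𝓞 K) ∣ n (m * k) - (n m + m * j) :=
      (Dvd.intro (k : 𝓞 K) rfl).trans (hunique (hn (m * k)) hj)
    rw [← sub_sub] at hdvd
    exact (dvd_sub_left (dvd_mul_right _ _)).1 hdvd
  refine ⟨y, fun m a => ?_⟩
  by_cases h : q m a = 0
  · rw [h, Set.indicator_of_notMem fun ha => hn m ?_]
    rw [hcongr (dvd_of_mem_integralCoset (hy m) ha), h]
  · have hmem : y ∈ integralCoset m a := by
      have hsub := integralCoset_subset 1 (hunique (hn m) h)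
      rw [mul_one] at hsub
      exact hsub (hy m)
    rw [Set.indicator_of_mem hmem]
    exact mul_left_cancel₀ h ((hidem m a).eq.trans (mul_one _).symm)

/-- The indicator function of the coset `n + m ô`. -/
def cosetIndicator (m : (𝓞 K)⁰) (n : 𝓞 K) : C(integralAdeles K, ℂ) where
  toFun := (integralCoset m n).indicator 1
  continuous_toFun := (isClopen_integralCoset m n).continuous_indicator continuous_const

theorem cosetIndicator_ne_zero_iff {m : (𝓞 K)⁰} {n : 𝓞 K} {y : integralAdeles K} :
    cosetIndicator m n y ≠ 0 ↔ y ∈ integralCoset m n :=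
  (Set.indicator_apply_ne_zero).trans (and_iff_left one_ne_zero)

theorem isTopologicalBasis_setOf_cosetIndicator_ne_zero :
    TopologicalSpace.IsTopologicalBasis (Set.range fun i : (𝓞 K)⁰ × 𝓞 K =>
      {y : integralAdeles K | cosetIndicator i.1 i.2 y ≠ 0}) := by
  simp only [cosetIndicator_ne_zero_iff, Set.ofPred_mem_eq]
  refine TopologicalSpace.isTopologicalBasis_of_isOpen_of_nhds ?_ fun y U hy hU => ?_
  · rintro _ ⟨i, rfl⟩
    exact (isClopen_integralCoset i.1 i.2).isOpen
  · obtain ⟨m, n, hmem, hsub⟩ := exists_integralCoset_subset (hU.mem_nhds hy) 1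
    exact ⟨_, ⟨(1 * m, n), rfl⟩, hmem, hsub⟩

theorem starAlgHom_ext_cosetIndicator {B : Type*} [CStarAlgebra B]
    {f g : C(integralAdeles K, ℂ) →⋆ₐ[ℂ] B} (c : (𝓞 K)⁰)
    (h : ∀ m n, f (cosetIndicator (c * m) n) = g (cosetIndicator (c * m) n)) : f = g := by
  let S : StarSubalgebra ℂ C(integralAdeles K, ℂ) :=
    StarAlgebra.adjoin ℂ {t | ∃ m n, t = cosetIndicator (c * m) n}
  have hsep : S.SeparatesPoints := by
    intro y y' hne
    obtain ⟨m, n, hy, hsub⟩ := exists_integralCoset_subset (isOpen_compl_singleton.mem_nhds hne) c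
    refine ⟨_, ⟨cosetIndicator (c * m) n, StarAlgebra.subset_adjoin ℂ _ ⟨m, n, rfl⟩, rfl⟩,
      fun heq => hsub ?_ rfl⟩
    change cosetIndicator (c * m) n y = cosetIndicator (c * m) n y' at heq
    rw [← cosetIndicator_ne_zero_iff] at hy ⊢
    rwa [← heq]
  have htop := ContinuousMap.starSubalgebra_topologicalClosure_eq_top_of_separatesPoints S hsep
  have hS : S ≤ StarAlgHom.equalizer f g := StarAlgebra.adjoin_le <| by
    rintro _ ⟨m, n, rfl⟩
    exact h m n
  have hclosed : IsClosed (StarAlgHom.equalizer f g : Set C(integralAdeles K, ℂ)) := by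
    open scoped CStarAlgebra in
    exact isClosed_eq (map_continuous f) (map_continuous g)
  ext t
  exact StarSubalgebra.topologicalClosure_minimal hS hclosed (htop ▸ StarSubalgebra.mem_top)

/-- Multiplication by a nonzero integer on `ô`. -/
def mulInt (c : (𝓞 K)⁰) : C(integralAdeles K, integralAdeles K) where
  toFun y := ⟨intAdele (c : 𝓞 K) * y, mul_mem (intAdele_mem_integralAdeles _) y.2⟩
  continuous_toFun := Continuous.subtype_mk (continuous_const.mul continuous_subtype_val) _

theorem mulInt_mem_integralCoset_iff (c m : (𝓞 K)⁰) (n : 𝓞 K) (y : integralAdeles K) :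
    mulInt c y ∈ integralCoset (c * m) (c * n) ↔ y ∈ integralCoset m n := by
  have hfactor : ∀ w : FinAdele K,
      intAdele ((c : 𝓞 K) * n) + intAdele ((c * m : (𝓞 K)⁰) : 𝓞 K) * w =
        intAdele (c : 𝓞 K) * (intAdele n + intAdele (m : 𝓞 K) * w) := fun w => by
    simp only [intAdele, Submonoid.coe_mul, map_mul]
    ring
  constructor
  · rintro ⟨w, hw, h⟩
    exact ⟨w, hw, intAdele_mul_injective c (h.trans (hfactor w))⟩
  · rintro ⟨w, hw, h⟩
    exact ⟨w, hw, (congrArg (intAdele (c : 𝓞 K) * ·) h).trans (hfactor w).symm⟩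

theorem dvd_of_mulInt_mem_integralCoset {c m : (𝓞 K)⁰} {n : 𝓞 K} {y : integralAdeles K}
    (h : mulInt c y ∈ integralCoset (c * m) n) : (c : 𝓞 K) ∣ n := by
  have hn : mulInt c y ∈ integralCoset c n := integralCoset_subset m (by rw [sub_self]; simp) h
  have hzero : mulInt c y ∈ integralCoset c 0 := ⟨y, y.2, by
    rw [map_zero, zero_add]
    rfl⟩
  rw [← sub_zero n]
  exact dvd_of_mem_integralCoset hn hzero

theorem cosetIndicator_comp_mulInt (c m : (𝓞 K)⁰) (k : 𝓞 K) :
    (cosetIndicator (c * m) (c * k)).comp (mulInt c) = cosetIndicator m k := by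
  classical
  ext y
  change Set.indicator _ _ _ = Set.indicator _ _ _
  simp only [Set.indicator_apply, mulInt_mem_integralCoset_iff, Pi.one_apply]

theorem cosetIndicator_comp_mulInt_of_not_dvd {c : (𝓞 K)⁰} (m : (𝓞 K)⁰) {n : 𝓞 K}
    (h : ¬ (c : 𝓞 K) ∣ n) : (cosetIndicator (c * m) n).comp (mulInt c) = 0 := by
  ext y
  exact Set.indicator_of_notMem (fun hy => h (dvd_of_mulInt_mem_integralCoset hy)) _

end Cosets

/-- By Gelfand duality, a map from the spectrum of `D` to `X` whose coordinates `f i` are given by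
elements `p i` of `D` defines a homomorphism `C(X) → D`. -/
theorem exists_starAlgHom_apply_eq_of_characterSpace {D ι X : Type*} [CommCStarAlgebra D]
    [TopologicalSpace X] {p : ι → D} {f : ι → C(X, ℂ)}
    (hbasis : TopologicalSpace.IsTopologicalBasis (Set.range fun i => {x | f i x ≠ 0}))
    (hpoint : ∀ χ : WeakDual.characterSpace ℂ D, ∃ x, ∀ i, χ (p i) = f i x) :
    ∃ α : C(X, ℂ) →⋆ₐ[ℂ] D, ∀ i, α (f i) = p i := by
  choose y hy using hpoint
  have hcont : Continuous y := hbasis.continuous_iff.2 <| by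
    rintro _ ⟨i, rfl⟩
    simp only [Set.preimage_ofPred_eq, ← hy]
    exact isOpen_ne.preimage (map_continuous (gelfandStarTransform D (p i)))
  refine ⟨((gelfandStarTransform D).symm : C(WeakDual.characterSpace ℂ D, ℂ) →⋆ₐ[ℂ] D).comp
    (ContinuousMap.compStarAlgHom' ℂ ℂ ⟨y, hcont⟩), fun i => ?_⟩
  change (gelfandStarTransform D).symm ((f i).comp ⟨y, hcont⟩) = p i
  rw [StarAlgEquiv.symm_apply_eq]
  ext χ
  exact (hy χ i).symm

theorem exists_starAlgHom_apply_eq_of_adjoin {B ι X : Type*} [CStarAlgebra B]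
    [TopologicalSpace X] {p : ι → B} {f : ι → C(X, ℂ)} (hp : ∀ i, IsSelfAdjoint (p i))
    (hcomm : ∀ i j, Commute (p i) (p j))
    (hbasis : TopologicalSpace.IsTopologicalBasis (Set.range fun i => {x | f i x ≠ 0}))
    (hpoint : ∀ χ : StarAlgebra.adjoin ℂ (Set.range p) →ₐ[ℂ] ℂ,
      ∃ x, ∀ i, χ ⟨p i, StarAlgebra.subset_adjoin ℂ _ ⟨i, rfl⟩⟩ = f i x) :
    ∃ α : C(X, ℂ) →⋆ₐ[ℂ] B, ∀ i, α (f i) = p i := by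
  let S := StarAlgebra.adjoin ℂ (Set.range p)
  have hS : IsMulCommutative S := by
    refine StarAlgebra.isMulCommutative_adjoin ℂ ?_ ?_
    · rintro _ ⟨i, rfl⟩ _ ⟨j, rfl⟩
      exact hcomm i j
    · rintro _ ⟨i, rfl⟩ _ ⟨j, rfl⟩
      rw [(hp j).star_eq]
      exact hcomm i j
  let _ : CommCStarAlgebra S.topologicalClosure :=
    { StarSubalgebra.cstarAlgebra S.topologicalClosure (h_closed := isClosed_closure) with
      mul_comm := (S.commRingTopologicalClosure hS.is_comm.comm).mul_comm }
  let inclusion := StarSubalgebra.inclusion S.le_topologicalClosure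
  obtain ⟨α, hα⟩ := exists_starAlgHom_apply_eq_of_characterSpace
    (p := fun i => inclusion ⟨p i, StarAlgebra.subset_adjoin ℂ _ ⟨i, rfl⟩⟩) hbasis
    fun χ => hpoint ((WeakDual.CharacterSpace.toAlgHom χ).comp inclusion.toAlgHom)
  exact ⟨S.topologicalClosure.subtype.comp α, fun i => congrArg Subtype.val (hα i)⟩

/-- The compression `a ↦ s^* α(a) s` of a representation `α` by an isometry `s` whose range
projection commutes with it. -/
def compressByIsometry {A B : Type*} [CStarAlgebra A] [CStarAlgebra B] (α : A →⋆ₐ[ℂ] B) {s : B}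
    (hs : star s * s = 1) (hcomm : ∀ a, Commute (s * star s) (α a)) : A →⋆ₐ[ℂ] B where
  toFun a := star s * α a * s
  map_one' := by rw [map_one, mul_one, hs]
  map_mul' a b := by
    calc star s * α (a * b) * s
        = star s * α a * α b * (s * star s) * s := by
          rw [map_mul, mul_assoc _ (s * star s), mul_assoc s, hs, mul_one]
          simp only [mul_assoc]
      _ = star s * α a * (α b * (s * star s)) * s := by simp only [mul_assoc]
      _ = star s * α a * s * (star s * α b * s) := by
          rw [← (hcomm b).eq]
          simp only [mul_assoc]
  map_zero' := by rw [map_zero, mul_zero, zero_mul]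
  map_add' a b := by rw [map_add, mul_add, add_mul]
  commutes' r := by
    rw [AlgHomClass.commutes, ← Algebra.commutes, mul_assoc, hs, mul_one]
  map_star' a := by rw [map_star, star_mul, star_mul, star_star, mul_assoc]

section FunctionRep

open RingCStarAlgebra

variable {K : Type u} [Field K] [NumberField K]

theorem exists_forall_apply_proj_eq_cosetIndicator
    (χ : StarAlgebra.adjoin ℂ (Set.range fun i : (𝓞 K)⁰ × 𝓞 K => proj i.1 i.2) →ₐ[ℂ] ℂ) :
    ∃ y, ∀ i : (𝓞 K)⁰ × 𝓞 K,
      χ ⟨proj i.1 i.2, StarAlgebra.subset_adjoin ℂ _ ⟨i, rfl⟩⟩ = cosetIndicator i.1 i.2 y := by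
  let S := StarAlgebra.adjoin ℂ (Set.range fun i : (𝓞 K)⁰ × 𝓞 K => proj i.1 i.2)
  let p (m : (𝓞 K)⁰) (n : 𝓞 K) : S := ⟨proj m n, StarAlgebra.subset_adjoin ℂ _ ⟨(m, n), rfl⟩⟩
  have hsummand : ∀ {ι : Type u} [Fintype ι] {a : ι → S} {b : S},
      (b : RingCStarAlgebra (𝓞 K)) = ∑ i, (a i : RingCStarAlgebra (𝓞 K)) →
      χ b ≠ 0 → ∃ i, χ (a i) ≠ 0 := by
    intro ι _ a b hab hb
    have hab' : b = ∑ i, a i := Subtype.ext (hab.trans (map_sum S.subtype a _).symm)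
    rw [hab', map_sum] at hb
    obtain ⟨i, -, hi⟩ := Finset.exists_ne_zero_of_sum_ne_zero hb
    exact ⟨i, hi⟩
  refine (exists_forall_eq_indicator_integralCoset (q := fun m n => χ (p m n)) (fun m n => ?_)
    (fun h => ?_) (fun h => ?_) (fun m => ?_) fun m k n h => ?_).imp fun y hy i => hy i.1 i.2
  · rw [IsIdempotentElem, ← map_mul]
    exact congrArg χ (Subtype.ext (isStarProjection_proj m n).isIdempotentElem)
  · exact congrArg χ (Subtype.ext (proj_congr h))
  · rw [← map_mul, ← map_zero χ]
    exact congrArg χ (Subtype.ext (proj_mul_proj_of_not_dvd h))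
  · have := Fintype.ofFinite (𝓞 K ⧸ Ideal.span {(m : 𝓞 K)})
    obtain ⟨c, hc⟩ := hsummand (a := fun c : 𝓞 K ⧸ Ideal.span {(m : 𝓞 K)} =>
      p m (Quotient.out c)) (b := 1) (sum_proj m).symm (by rw [map_one]; exact one_ne_zero)
    exact ⟨_, hc⟩
  · have := Fintype.ofFinite (𝓞 K ⧸ Ideal.span {(k : 𝓞 K)})
    obtain ⟨c, hc⟩ := hsummand (a := fun c : 𝓞 K ⧸ Ideal.span {(k : 𝓞 K)} =>
      p (m * k) (n + m * Quotient.out c)) (proj_eq_sum m k n) h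
    exact ⟨_, hc⟩

theorem exists_starAlgHom_cosetIndicator :
    ∃ α : C(integralAdeles K, ℂ) →⋆ₐ[ℂ] RingCStarAlgebra (𝓞 K), ∀ i : (𝓞 K)⁰ × 𝓞 K,
      α (cosetIndicator i.1 i.2) = proj i.1 i.2 :=
  exists_starAlgHom_apply_eq_of_adjoin (fun _ => (isStarProjection_proj _ _).isSelfAdjoint)
    (fun _ _ => commute_proj _ _ _ _) isTopologicalBasis_setOf_cosetIndicator_ne_zero
    exists_forall_apply_proj_eq_cosetIndicator

variable (K) in
/-- The representation `α` of `C(ô)` in `𝔄[o]` with `α(1_{n + m ô}) = u^n s_m s_m^* u^{-n}`. -/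
def functionRep : C(integralAdeles K, ℂ) →⋆ₐ[ℂ] RingCStarAlgebra (𝓞 K) :=
  exists_starAlgHom_cosetIndicator.choose

theorem functionRep_cosetIndicator (m : (𝓞 K)⁰) (n : 𝓞 K) :
    functionRep K (cosetIndicator m n) = proj m n :=
  exists_starAlgHom_cosetIndicator.choose_spec (m, n)

theorem commute_s_mul_star_s_functionRep (c : (𝓞 K)⁰) (g : C(integralAdeles K, ℂ)) :
    Commute (s c * star (s c)) (functionRep K g) := by
  rw [← proj_zero, ← functionRep_cosetIndicator]
  exact (Commute.all _ _).map _

theorem star_s_mul_functionRep_mul_s (c : (𝓞 K)⁰) (g : C(integralAdeles K, ℂ)) :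
    star (s c) * functionRep K g * s c = functionRep K (g.comp (mulInt c)) := by
  have hhom : compressByIsometry (functionRep K) (star_s_mul_s c)
      (commute_s_mul_star_s_functionRep c) =
        (functionRep K).comp (ContinuousMap.compStarAlgHom' ℂ ℂ (mulInt c)) := by
    refine starAlgHom_ext_cosetIndicator c fun m n => ?_
    change star (s c) * functionRep K (cosetIndicator (c * m) n) * s c =
      functionRep K ((cosetIndicator (c * m) n).comp (mulInt c))
    rw [functionRep_cosetIndicator]
    by_cases hn : (c : 𝓞 K) ∣ n
    · obtain ⟨k, rfl⟩ := hn
      rw [star_s_mul_proj_mul_s, cosetIndicator_comp_mulInt, functionRep_cosetIndicator]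
    · rw [star_s_mul_proj_mul_s_of_not_dvd m hn, cosetIndicator_comp_mulInt_of_not_dvd m hn,
        map_zero]
  exact DFunLike.congr_fun hhom g

theorem functionRep_mul_s (c : (𝓞 K)⁰) (g : C(integralAdeles K, ℂ)) :
    functionRep K g * s c = s c * functionRep K (g.comp (mulInt c)) := by
  rw [← star_s_mul_functionRep_mul_s, ← mul_assoc, ← mul_assoc,
    (commute_s_mul_star_s_functionRep c g).eq, mul_assoc, mul_assoc, star_s_mul_s, mul_one]

end FunctionRep

section CovariantPair

variable {K : Type u} [Field K] [NumberField K]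

/-- The classes whose representatives under the section `σ` are algebraic integers. -/
def integralClasses (σ : IdealGroup K →* Kˣ) : Submonoid (IdealGroup K) where
  carrier := {z | ∃ m : (𝓞 K)⁰, intUnit m = σ z}
  one_mem' := ⟨1, Units.ext (by simp)⟩
  mul_mem' := by
    rintro z w ⟨m, hm⟩ ⟨k, hk⟩
    exact ⟨m * k, by rw [intUnit_mul, hm, hk, map_mul]⟩

open Classical in
/-- The isometry `s_{σ z}`, if `σ z` is an algebraic integer; the value is `0` otherwise. -/
def classIsometry (σ : IdealGroup K →* Kˣ) (z : IdealGroup K) : RingCStarAlgebra (𝓞 K) :=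
  if h : ∃ m : (𝓞 K)⁰, intUnit m = σ z then RingCStarAlgebra.s h.choose else 0

theorem classIsometry_eq {σ : IdealGroup K →* Kˣ} {z : IdealGroup K} {m : (𝓞 K)⁰}
    (h : intUnit m = σ z) : classIsometry σ z = RingCStarAlgebra.s m := by
  have hex : ∃ m : (𝓞 K)⁰, intUnit m = σ z := ⟨m, h⟩
  rw [classIsometry, dif_pos hex]
  exact congrArg _ (intUnit_injective (hex.choose_spec.trans h.symm))

/-- The restriction of functions on `X` to `ô`, as a *-homomorphism. -/
def restrictHom : C₀(SpaceX K, ℂ) →⋆ₙₐ[ℂ] C(integralAdeles K, ℂ) where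
  toFun := restrictToIntegral
  map_smul' _ _ := rfl
  map_zero' := rfl
  map_add' _ _ := rfl
  map_mul' _ _ := rfl
  map_star' _ := rfl

theorem restrictHom_apply (f : C₀(SpaceX K, ℂ)) (y : integralAdeles K) :
    restrictHom f y = f (toX (y : FinAdele K)) := rfl

variable (K) in
/-- The representation of `C₀(X)` in `𝔄[o]` by restriction to `ô`. -/
def restrictRep : C₀(SpaceX K, ℂ) →⋆ₙₐ[ℂ] RingCStarAlgebra (𝓞 K) :=
  (functionRep K).toNonUnitalStarAlgHom.comp restrictHom

theorem restrictRep_apply (f : C₀(SpaceX K, ℂ)) :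
    restrictRep K f = functionRep K (restrictHom f) := rfl

variable {σ : IdealGroup K →* Kˣ}

theorem coe_diagFin_intUnit_mem_integralClasses
    (hσ : ∀ z, (diagFin K (σ z) : IdealGroup K) = z) (a : (𝓞 K)⁰) :
    (diagFin K (intUnit a) : IdealGroup K) ∈ integralClasses σ := by
  set x := σ (diagFin K (intUnit a) : IdealGroup K)
  have hunit : (diagFin K (intUnit a))⁻¹ * diagFin K x ∈ integralIdeles K :=
    QuotientGroup.eq.1 (hσ (diagFin K (intUnit a) : IdealGroup K)).symm
  have hx_mem : algebraMap K (FinAdele K) (x : K) ∈ integralAdeles K := by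
    have hmem : ((diagFin K (intUnit a) * ((diagFin K (intUnit a))⁻¹ * diagFin K x) :
        (FinAdele K)ˣ) : FinAdele K) ∈ integralAdeles K := by
      rw [Units.val_mul, coe_diagFin_intUnit]
      exact mul_mem (intAdele_mem_integralAdeles _) hunit.1
    rwa [mul_inv_cancel_left] at hmem
  obtain ⟨n, hn⟩ := exists_algebraMap_eq_of_mem_integralAdeles hx_mem
  have hn0 : n ≠ 0 := by
    rintro rfl
    exact x.ne_zero (hn.symm.trans (map_zero (algebraMap (𝓞 K) K)))
  exact ⟨⟨n, mem_nonZeroDivisors_of_ne_zero hn0⟩, Units.ext hn⟩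

theorem exists_intUnit_mul_inv_eq (x : Kˣ) : ∃ a b : (𝓞 K)⁰, intUnit a * (intUnit b)⁻¹ = x := by
  obtain ⟨a, b, hb, hab⟩ := IsFractionRing.div_surjective (A := 𝓞 K) (x : K)
  have ha : a ∈ (𝓞 K)⁰ := by
    refine mem_nonZeroDivisors_of_ne_zero ?_
    rintro rfl
    exact x.ne_zero (by rw [← hab, map_zero, zero_div])
  refine ⟨⟨a, ha⟩, ⟨b, hb⟩, Units.ext ?_⟩
  rw [← div_eq_mul_inv, Units.val_div_eq_div_val]
  exact hab

theorem exists_mem_integralClasses_eq_mul_inv (hσ : ∀ z, (diagFin K (σ z) : IdealGroup K) = z)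
    (z : IdealGroup K) : ∃ p ∈ integralClasses σ, ∃ q ∈ integralClasses σ, z = p * q⁻¹ := by
  obtain ⟨a, b, hab⟩ := exists_intUnit_mul_inv_eq (σ z)
  refine ⟨_, coe_diagFin_intUnit_mem_integralClasses hσ a,
    _, coe_diagFin_intUnit_mem_integralClasses hσ b, ?_⟩
  rw [← hσ z, ← hab, map_mul, map_inv]
  rfl

theorem idealActX_toX (hσ : ∀ z, (diagFin K (σ z) : IdealGroup K) = z)
    (hσU : ∀ z, finIdele K (diagFin K (σ z)) ∈ ideleU K) (z : IdealGroup K) (y : FinAdele K) :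
    idealActX K z (toX y) = toX ((diagFin K (σ z) : FinAdele K) * y) := by
  have := idealActX_coe_toX (hσU z) y
  rwa [hσ] at this

theorem restrictHom_translation_comp_mulInt (hσ : ∀ z, (diagFin K (σ z) : IdealGroup K) = z)
    (hσU : ∀ z, finIdele K (diagFin K (σ z)) ∈ ideleU K) {p : IdealGroup K} {m : (𝓞 K)⁰}
    (hm : intUnit m = σ p) (f : C₀(SpaceX K, ℂ)) :
    (restrictHom (translation (idealActX K) p f)).comp (mulInt m) = restrictHom f := by
  ext y
  change f (idealActX K p⁻¹ (toX (intAdele (m : 𝓞 K) * (y : FinAdele K)))) = f (toX y)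
  rw [← coe_diagFin_intUnit, hm, ← idealActX_toX hσ hσU, map_inv]
  exact congrArg f ((idealActX K p).symm_apply_apply _)

theorem inv_diagFin_intUnit_mul_mem_integralAdeles_iff {m : (𝓞 K)⁰} {y : integralAdeles K} :
    (((diagFin K (intUnit m))⁻¹ : (FinAdele K)ˣ) : FinAdele K) * (y : FinAdele K) ∈
      integralAdeles K ↔ y ∈ integralCoset m 0 := by
  rw [mem_integralCoset, intAdele, map_zero, sub_zero]
  constructor
  · exact fun h => ⟨_, h, Units.mul_inv_cancel_left (diagFin K (intUnit m)) (y : FinAdele K)⟩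
  · rintro ⟨w, hw, h⟩
    rw [← h]
    exact (Units.inv_mul_cancel_left (diagFin K (intUnit m)) w).symm ▸ hw

theorem restrictHom_translation_indicatorC₀ (hY : IsClopen (subsetY K) ∧ IsCompact (subsetY K))
    (hσ : ∀ z, (diagFin K (σ z) : IdealGroup K) = z)
    (hσU : ∀ z, finIdele K (diagFin K (σ z)) ∈ ideleU K) {p : IdealGroup K} {m : (𝓞 K)⁰}
    (hm : intUnit m = σ p) :
    restrictHom (translation (idealActX K) p (indicatorC₀ (subsetY K))) = cosetIndicator m 0 := by
  classical
  ext y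
  change indicatorC₀ (subsetY K) (idealActX K p⁻¹ (toX (y : FinAdele K))) =
    (integralCoset m 0).indicator 1 y
  rw [idealActX_toX hσ hσU, map_inv, map_inv, ← hm, indicatorC₀_apply hY, Set.indicator_apply,
    Set.indicator_apply, toX_mem_subsetY, inv_diagFin_intUnit_mul_mem_integralAdeles_iff]
  rfl

theorem isCovariantPair_restrictRep (hY : IsClopen (subsetY K) ∧ IsCompact (subsetY K))
    (hσ : ∀ z, (diagFin K (σ z) : IdealGroup K) = z)
    (hσU : ∀ z, finIdele K (diagFin K (σ z)) ∈ ideleU K) :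
    IsCovariantPair (translation (idealActX K)) (integralClasses σ) (indicatorC₀ (subsetY K))
      (restrictRep K) (classIsometry σ) where
  exists_fraction := exists_mem_integralClasses_eq_mul_inv hσ
  isometry := by
    rintro p ⟨m, hm⟩
    rw [classIsometry_eq hm, RingCStarAlgebra.star_s_mul_s]
  isometry_mul := by
    rintro p ⟨m, hm⟩ q ⟨k, hk⟩
    rw [classIsometry_eq hm, classIsometry_eq hk, RingCStarAlgebra.s_mul_s]
    exact classIsometry_eq (by rw [intUnit_mul, hm, hk, map_mul])
  covariant := by
    rintro p ⟨m, hm⟩ f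
    rw [classIsometry_eq hm, restrictRep_apply, restrictRep_apply, functionRep_mul_s,
      restrictHom_translation_comp_mulInt hσ hσU hm]
  range_proj := by
    rintro p ⟨m, hm⟩
    rw [classIsometry_eq hm, ← RingCStarAlgebra.proj_zero, ← functionRep_cosetIndicator,
      restrictRep_apply, restrictHom_translation_indicatorC₀ hY hσ hσU hm]
  proj_mul f := by
    rw [restrictRep_apply, restrictRep_apply]
    congr 1
    ext y
    change indicatorC₀ (subsetY K) (toX (y : FinAdele K)) * f (toX y) = f (toX y)
    rw [indicatorC₀_apply hY, Set.indicator_of_mem ((toX_mem_subsetY _).2 y.2), Pi.one_apply,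
      one_mul]
  proj_comm _ := mul_comm _ _
  proj_idem := indicatorC₀_mul_self _

theorem fracIsometry_eq_star_s_mul_s {e : C₀(SpaceX K, ℂ)}
    (h : IsCovariantPair (translation (idealActX K)) (integralClasses σ) e (restrictRep K)
      (classIsometry σ)) {z : IdealGroup K} {a b : (𝓞 K)⁰}
    (hab : σ z = intUnit a * (intUnit b)⁻¹) :
    h.fracIsometry z = star (RingCStarAlgebra.s b) * RingCStarAlgebra.s a := by
  obtain ⟨p, ⟨m, hm⟩, q, ⟨k, hk⟩, rfl⟩ := h.exists_fraction z
  rw [h.fracIsometry_mul_inv ⟨m, hm⟩ ⟨k, hk⟩, classIsometry_eq hm, classIsometry_eq hk]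
  refine star_mul_eq_star_mul_of_mul_eq_mul RingCStarAlgebra.star_s_mul_s
    (fun _ _ => (RingCStarAlgebra.s_mul_s _ _).symm) (intUnit_injective ?_)
  rw [map_mul, map_inv, ← hm, ← hk] at hab
  rw [intUnit_mul, intUnit_mul]
  exact mul_inv_eq_mul_inv_iff_mul_eq_mul.1 hab

theorem norm_finsuppSum_le_of_ringCStarAlgebra {A G R : Type u} [NonUnitalCStarAlgebra A]
    [CommGroup G] [CommRing R] {α : G →* (A →⋆ₙₐ[ℂ] A)} {P : Submonoid G} {e : A}
    {β : A →⋆ₙₐ[ℂ] RingCStarAlgebra R} {S : G → RingCStarAlgebra R}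
    (h : IsCovariantPair α P e β S) (c : G →₀ A) :
    ‖h.finsuppSum c‖ ≤ ‖CrossedProduct.ofFinsupp α c‖ :=
  RingCStarAlgebra.norm_le_of_forall_eval (norm_nonneg _) fun ρ => by
    rw [← h.comp_finsuppSum]
    exact (h.comp (RingCStarAlgebra.eval ρ)).norm_finsuppSum_le c

end CovariantPair

section Adjoint

variable {Ω Ω' : Type*}

theorem l2Comp_single_of_injective [DecidableEq Ω] [DecidableEq Ω'] {j : Ω → Ω'}
    (hj : Function.Injective j) (ω : Ω) :
    l2Comp ℂ j hj (lp.single 2 (j ω) (1 : ℂ)) = lp.single 2 ω (1 : ℂ) := by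
  refine lp.ext (funext fun η => ?_)
  rw [l2Comp_apply, lp.single_apply, lp.single_apply, Pi.single_apply, Pi.single_apply]
  simp only [hj.eq_iff]

theorem l2Comp_single_of_notMem_range [DecidableEq Ω'] {j : Ω → Ω'} (hj : Function.Injective j)
    {ω' : Ω'} (h : ω' ∉ Set.range j) : l2Comp ℂ j hj (lp.single 2 ω' (1 : ℂ)) = 0 := by
  refine lp.ext (funext fun η => ?_)
  rw [l2Comp_apply, lp.single_apply, Pi.single_apply, if_neg fun heq => h ⟨η, heq⟩]
  rfl

theorem inner_single_one [DecidableEq Ω] (ω : Ω) (ζ : lp (fun _ : Ω => ℂ) 2) :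
    inner ℂ (lp.single 2 ω (1 : ℂ)) ζ = ζ ω := by
  rw [lp.inner_single_left]
  simp

theorem adjoint_l2Comp_apply {j : Ω → Ω'} (hj : Function.Injective j)
    (ζ : lp (fun _ : Ω => ℂ) 2) (ω : Ω) :
    ContinuousLinearMap.adjoint (l2Comp ℂ j hj) ζ (j ω) = ζ ω := by
  classical
  rw [← inner_single_one (j ω), ContinuousLinearMap.adjoint_inner_right,
    l2Comp_single_of_injective, inner_single_one]

theorem adjoint_l2Comp_apply_of_notMem_range {j : Ω → Ω'} (hj : Function.Injective j)
    (ζ : lp (fun _ : Ω => ℂ) 2) {ω' : Ω'} (h : ω' ∉ Set.range j) :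
    ContinuousLinearMap.adjoint (l2Comp ℂ j hj) ζ ω' = 0 := by
  classical
  rw [← inner_single_one ω', ContinuousLinearMap.adjoint_inner_right,
    l2Comp_single_of_notMem_range hj h, inner_zero_left]

theorem clm_ext_lp {S T : lp (fun _ : Ω => ℂ) 2 →L[ℂ] lp (fun _ : Ω' => ℂ) 2}
    (h : ∀ ζ ω, S ζ ω = T ζ ω) : S = T :=
  ContinuousLinearMap.ext fun ζ => lp.ext (funext (h ζ))

end Adjoint

section RegularRep

variable {K : Type u} [Field K] [NumberField K]

/-- The Hilbert space `ℓ²(ô)` of the regular representation of `𝔄[o]`. -/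
abbrev RegularSpace (K : Type u) [Field K] [NumberField K] : Type u :=
  lp (fun _ : integralAdeles K => ℂ) 2

/-- A global integer as an element of `ô`. -/
def intPoint (n : 𝓞 K) : integralAdeles K := ⟨intAdele n, intAdele_mem_integralAdeles n⟩

theorem intPoint_add (n k : 𝓞 K) : intPoint (n + k) = intPoint n + intPoint k :=
  Subtype.ext (map_add _ _ _)

theorem intPoint_neg (n : 𝓞 K) : intPoint (-n) = -intPoint n :=
  Subtype.ext (map_neg _ _)

theorem mulInt_injective (m : (𝓞 K)⁰) : Function.Injective (mulInt m) := fun _ _ h =>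
  Subtype.ext (intAdele_mul_injective m (congrArg Subtype.val h))

theorem mulInt_mulInt (k m : (𝓞 K)⁰) (y : integralAdeles K) :
    mulInt k (mulInt m y) = mulInt (k * m) y := by
  refine Subtype.ext ?_
  change intAdele (k : 𝓞 K) * (intAdele (m : 𝓞 K) * (y : FinAdele K)) =
    intAdele ((k : 𝓞 K) * (m : 𝓞 K)) * y
  simp only [intAdele, map_mul, mul_assoc]

theorem mulInt_add_intPoint (m : (𝓞 K)⁰) (y : integralAdeles K) (n : 𝓞 K) :
    mulInt m (y + intPoint n) = mulInt m y + intPoint ((m : 𝓞 K) * n) := by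
  refine Subtype.ext ?_
  change intAdele (m : 𝓞 K) * ((y : FinAdele K) + intAdele n) =
    intAdele (m : 𝓞 K) * y + intAdele ((m : 𝓞 K) * n)
  simp only [intAdele, map_mul, mul_add]

theorem mulInt_sub_intPoint (m : (𝓞 K)⁰) (y : integralAdeles K) (n : 𝓞 K) :
    mulInt m y - intPoint ((m : 𝓞 K) * n) = mulInt m (y - intPoint n) := by
  rw [sub_eq_iff_eq_add, ← mulInt_add_intPoint, sub_add_cancel]

theorem mem_integralCoset_iff_sub_mem_range {m : (𝓞 K)⁰} {n : 𝓞 K} {y : integralAdeles K} :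
    y ∈ integralCoset m n ↔ y - intPoint n ∈ Set.range (mulInt m) := by
  rw [mem_integralCoset]
  constructor
  · rintro ⟨w, hw, h⟩
    exact ⟨⟨w, hw⟩, Subtype.ext h⟩
  · rintro ⟨w, h⟩
    exact ⟨w, w.2, congrArg Subtype.val h⟩

theorem mem_integralCoset_out_iff {m : (𝓞 K)⁰} {n : 𝓞 K} {y : integralAdeles K}
    (hy : y ∈ integralCoset m n) (c : 𝓞 K ⧸ Ideal.span {(m : 𝓞 K)}) :
    y ∈ integralCoset m (Quotient.out c) ↔ c = Ideal.Quotient.mk _ n := by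
  have mk_eq_iff (k : 𝓞 K) : Ideal.Quotient.mk (Ideal.span {(m : 𝓞 K)}) k =
      Ideal.Quotient.mk _ n ↔ (m : 𝓞 K) ∣ k - n := by
    rw [Ideal.Quotient.eq, Ideal.mem_span_singleton]
  rw [← Ideal.Quotient.mk_out c, mk_eq_iff, Ideal.Quotient.mk_out]
  refine ⟨fun h => dvd_of_mem_integralCoset h hy, fun h => ?_⟩
  rw [← mul_one m] at hy
  exact integralCoset_subset 1 ((dvd_sub_comm).1 h) hy

theorem sum_indicator_integralCoset_out (m : (𝓞 K)⁰)
    [Fintype (𝓞 K ⧸ Ideal.span {(m : 𝓞 K)})] (y : integralAdeles K) :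
    ∑ c : 𝓞 K ⧸ Ideal.span {(m : 𝓞 K)},
      (integralCoset m (Quotient.out c)).indicator (1 : integralAdeles K → ℂ) y = 1 := by
  classical
  obtain ⟨n, hn⟩ := exists_mem_integralCoset m y
  simp only [Set.indicator_apply, mem_integralCoset_out_iff hn, Finset.sum_ite_eq',
    Finset.mem_univ, if_true, Pi.one_apply]

/-- The isometry `ξ_y ↦ ξ_{m y}` on `ℓ²(ô)`. -/
def regularS (m : (𝓞 K)⁰) : RegularSpace K →L[ℂ] RegularSpace K :=
  ContinuousLinearMap.adjoint (l2Comp ℂ (mulInt m) (mulInt_injective m))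

/-- The unitary operator `ξ_y ↦ ξ_{y + n}` on `ℓ²(ô)`. -/
def regularU (n : 𝓞 K) : unitary (RegularSpace K →L[ℂ] RegularSpace K) :=
  Unitary.linearIsometryEquiv.symm (l2Perm ℂ (Equiv.addRight (intPoint n)))

theorem regularU_apply (n : 𝓞 K) (ζ : RegularSpace K) (y : integralAdeles K) :
    (regularU n : RegularSpace K →L[ℂ] RegularSpace K) ζ y = ζ (y - intPoint n) := by
  rw [sub_eq_add_neg]
  rfl

theorem regularS_apply (m : (𝓞 K)⁰) (ζ : RegularSpace K) (y : integralAdeles K) :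
    regularS m ζ (mulInt m y) = ζ y :=
  adjoint_l2Comp_apply _ ζ y

theorem regularS_apply_of_notMem_range {m : (𝓞 K)⁰} (ζ : RegularSpace K) {y : integralAdeles K}
    (hy : y ∉ Set.range (mulInt m)) : regularS m ζ y = 0 :=
  adjoint_l2Comp_apply_of_notMem_range _ ζ hy

theorem star_regularS_apply (m : (𝓞 K)⁰) (ζ : RegularSpace K) (y : integralAdeles K) :
    star (regularS m) ζ y = ζ (mulInt m y) := by
  rw [ContinuousLinearMap.star_eq_adjoint, regularS, ContinuousLinearMap.adjoint_adjoint,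
    l2Comp_apply]

theorem star_regularS_mul_regularS (m : (𝓞 K)⁰) : star (regularS m) * regularS m = 1 :=
  clm_ext_lp fun ζ y => by
    rw [mul_apply_eq_comp, star_regularS_apply, regularS_apply]
    rfl

theorem regularS_mul_regularS (k m : (𝓞 K)⁰) : regularS k * regularS m = regularS (k * m) := by
  rw [← star_inj, star_mul]
  refine clm_ext_lp fun ζ y => ?_
  rw [mul_apply_eq_comp, star_regularS_apply, star_regularS_apply,
    star_regularS_apply, mulInt_mulInt]

theorem regularU_mul_regularU (l n : 𝓞 K) :
    (regularU l * regularU n : RegularSpace K →L[ℂ] RegularSpace K) = regularU (l + n) :=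
  clm_ext_lp fun ζ y => by
    rw [mul_apply_eq_comp, regularU_apply, regularU_apply, regularU_apply,
      intPoint_add, sub_sub]

theorem regularS_mul_regularU (m : (𝓞 K)⁰) (n : 𝓞 K) :
    regularS m * (regularU n : RegularSpace K →L[ℂ] RegularSpace K) =
      (regularU ((m : 𝓞 K) * n) : RegularSpace K →L[ℂ] RegularSpace K) * regularS m :=
  clm_ext_lp fun ζ y => by
    rw [mul_apply_eq_comp, mul_apply_eq_comp,
      regularU_apply]
    by_cases hy : y ∈ Set.range (mulInt m)
    · obtain ⟨w, rfl⟩ := hy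
      rw [mulInt_sub_intPoint, regularS_apply, regularS_apply, regularU_apply]
    · rw [regularS_apply_of_notMem_range _ hy, regularS_apply_of_notMem_range]
      rintro ⟨w, hw⟩
      exact hy ⟨w + intPoint n, by rw [mulInt_add_intPoint, hw, sub_add_cancel]⟩

theorem regular_proj_apply (m : (𝓞 K)⁰) (n : 𝓞 K) (ζ : RegularSpace K) (y : integralAdeles K) :
    ((regularU n : RegularSpace K →L[ℂ] RegularSpace K) * (regularS m * star (regularS m)) *
      (regularU (-n) : RegularSpace K →L[ℂ] RegularSpace K)) ζ y =
      (integralCoset m n).indicator 1 y * ζ y := by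
  change (regularU n : RegularSpace K →L[ℂ] RegularSpace K) (regularS m (star (regularS m)
    ((regularU (-n) : RegularSpace K →L[ℂ] RegularSpace K) ζ))) y = _
  rw [regularU_apply]
  by_cases hy : y ∈ integralCoset m n
  · obtain ⟨w, hw⟩ := mem_integralCoset_iff_sub_mem_range.1 hy
    rw [← hw, regularS_apply, star_regularS_apply, regularU_apply, hw, Set.indicator_of_mem hy,
      intPoint_neg, sub_neg_eq_add, sub_add_cancel, Pi.one_apply, one_mul]
  · rw [regularS_apply_of_notMem_range _ (mt mem_integralCoset_iff_sub_mem_range.2 hy),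
      Set.indicator_of_notMem hy, zero_mul]

variable (K) in
/-- The representation `s_m ξ_y = ξ_{m y}`, `u^n ξ_y = ξ_{y + n}` of `𝔄[o]` on `ℓ²(ô)`. -/
def regularRep : RingRep (𝓞 K) where
  H := RegularSpace K
  nontrivial := by
    classical
    exact ⟨lp.single 2 0 (1 : ℂ), 0, norm_ne_zero_iff.1 (by simp [lp.norm_single])⟩
  s := regularS
  u n := regularU n
  isometry_s := star_regularS_mul_regularS
  unitary_u n := (regularU n).2
  s_mul := regularS_mul_regularS
  u_mul := regularU_mul_regularU
  s_mul_u := regularS_mul_regularU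
  sum_eq_one m := by
    have := Fintype.ofFinite (𝓞 K ⧸ Ideal.span {(m : 𝓞 K)})
    rw [finsum_eq_sum_of_fintype]
    refine clm_ext_lp fun ζ y => ?_
    rw [sum_apply, lp.coeFn_sum, Finset.sum_apply]
    simp only [regular_proj_apply]
    rw [← Finset.sum_mul, sum_indicator_integralCoset_out, one_mul]
    rfl

variable (K) in
/-- The representation of `C(ô)` on `ℓ²(ô)` by multiplication operators. -/
def multiplicationRep : C(integralAdeles K, ℂ) →⋆ₐ[ℂ] (RegularSpace K →L[ℂ] RegularSpace K) :=
  let φ : C(integralAdeles K, ℂ) →⋆ₙₐ[ℂ] (RegularSpace K →L[ℂ] RegularSpace K) :=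
    diagonalRep fun y => ((StarAlgHom.ofId ℂ (ℂ →L[ℂ] ℂ)).comp
      (ContinuousMap.evalStarAlgHom ℂ ℂ y)).toNonUnitalStarAlgHom
  { φ with
    map_one' := clm_ext_lp fun ζ y => one_mul (ζ y)
    commutes' _ := clm_ext_lp fun _ _ => rfl }

theorem multiplicationRep_apply (g : C(integralAdeles K, ℂ)) (ζ : RegularSpace K)
    (y : integralAdeles K) : multiplicationRep K g ζ y = g y * ζ y := rfl

variable (K) in
/-- The *-homomorphism from `𝔄[o]` to the operators on `ℓ²(ô)` defined by `regularRep`. -/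
def regularEval : RingCStarAlgebra (𝓞 K) →⋆ₐ[ℂ] (RegularSpace K →L[ℂ] RegularSpace K) :=
  RingCStarAlgebra.eval (regularRep K)

theorem regularEval_s (m : (𝓞 K)⁰) : regularEval K (RingCStarAlgebra.s m) = regularS m := rfl

theorem regularEval_functionRep (g : C(integralAdeles K, ℂ)) :
    regularEval K (functionRep K g) = multiplicationRep K g := by
  have hhom : (regularEval K).comp (functionRep K) = multiplicationRep K := by
    refine starAlgHom_ext_cosetIndicator 1 fun m n => ?_
    change regularEval K (functionRep K (cosetIndicator (1 * m) n)) = _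
    rw [functionRep_cosetIndicator]
    exact clm_ext_lp fun ζ y => regular_proj_apply _ _ ζ y
  exact DFunLike.congr_fun hhom g

end RegularRep

section Embedding

variable {K : Type u} [Field K] [NumberField K]

theorem eq_of_mulInt_eq {k m : (𝓞 K)⁰} {y : integralAdeles K} (hy : y ≠ 0)
    (h : mulInt k y = mulInt m y) : k = m := by
  by_contra hne
  have hsub : (k : 𝓞 K) - (m : 𝓞 K) ∈ (𝓞 K)⁰ :=
    mem_nonZeroDivisors_of_ne_zero (sub_ne_zero.2 fun heq => hne (Subtype.ext heq))
  refine hy (Subtype.ext (intAdele_mul_injective ⟨_, hsub⟩ ?_))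
  have hval : intAdele (k : 𝓞 K) * (y : FinAdele K) = intAdele (m : 𝓞 K) * y :=
    congrArg Subtype.val h
  change intAdele ((k : 𝓞 K) - (m : 𝓞 K)) * (y : FinAdele K) =
    intAdele ((k : 𝓞 K) - (m : 𝓞 K)) * 0
  rw [mul_zero, intAdele, map_sub, sub_mul, hval, sub_self]

open Classical in
/-- The diagonal coefficient at `y` of an element of `𝔄[o]` in the representation on `ℓ²(ô)`. -/
def diagCoeff (y : integralAdeles K) : RingCStarAlgebra (𝓞 K) →ₗ[ℂ] ℂ where
  toFun x := regularEval K x (lp.single 2 y (1 : ℂ)) y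
  map_add' x x' := by
    rw [map_add]
    rfl
  map_smul' t x := by
    rw [map_smul]
    rfl

open Classical in
theorem diagCoeff_apply (y : integralAdeles K) (x : RingCStarAlgebra (𝓞 K)) :
    diagCoeff y x = regularEval K x (lp.single 2 y (1 : ℂ)) y := rfl

theorem norm_diagCoeff_le (y : integralAdeles K) (x : RingCStarAlgebra (𝓞 K)) :
    ‖diagCoeff y x‖ ≤ ‖x‖ := by
  classical
  let T := regularEval K x
  calc ‖diagCoeff y x‖ = ‖T (lp.single 2 y (1 : ℂ)) y‖ := by rw [diagCoeff_apply]
    _ ≤ ‖T (lp.single 2 y (1 : ℂ))‖ := lp.norm_apply_le_norm two_ne_zero _ y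
    _ ≤ ‖T‖ * ‖(lp.single 2 y (1 : ℂ) : RegularSpace K)‖ := T.le_opNorm _
    _ = ‖T‖ := by rw [lp.norm_single two_pos, norm_one, mul_one]
    _ ≤ ‖x‖ := NonUnitalStarAlgHom.norm_apply_le (regularEval K) x

theorem diagCoeff_functionRep_mul_star_s_mul_s [DecidableEq (𝓞 K)⁰] {y : integralAdeles K}
    (hy : y ≠ 0) (g : C(integralAdeles K, ℂ)) (k m : (𝓞 K)⁰) :
    diagCoeff y (functionRep K g * (star (RingCStarAlgebra.s k) * RingCStarAlgebra.s m)) =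
      if k = m then g y else 0 := by
  classical
  have coeff_eq : diagCoeff y
      (functionRep K g * (star (RingCStarAlgebra.s k) * RingCStarAlgebra.s m)) =
        g y * regularS m (lp.single 2 y (1 : ℂ)) (mulInt k y) := by
    rw [diagCoeff_apply, map_mul, map_mul, map_star, regularEval_s, regularEval_s,
      regularEval_functionRep, mul_apply_eq_comp, mul_apply_eq_comp, multiplicationRep_apply,
      star_regularS_apply]
  rw [coeff_eq]
  split_ifs with hkm
  · rw [hkm, regularS_apply, lp.single_apply_self, mul_one]
  · by_cases hrange : mulInt k y ∈ Set.range (mulInt m)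
    · obtain ⟨w, hw⟩ := hrange
      have hwy : w ≠ y := by
        rintro rfl
        exact hkm (eq_of_mulInt_eq hy hw).symm
      rw [← hw, regularS_apply, lp.single_apply_ne 2 y 1 hwy, mul_zero]
    · rw [regularS_apply_of_notMem_range _ hrange, mul_zero]

section Coefficient

variable {σ : IdealGroup K →* Kˣ} {e : C₀(SpaceX K, ℂ)} {y : integralAdeles K}

theorem diagCoeff_restrictRep_mul_fracIsometry [DecidableEq (IdealGroup K)]
    (hσ : ∀ z, (diagFin K (σ z) : IdealGroup K) = z)
    (h : IsCovariantPair (translation (idealActX K)) (integralClasses σ) e (restrictRep K)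
      (classIsometry σ)) (hy : y ≠ 0) (a : C₀(SpaceX K, ℂ)) (g : IdealGroup K) :
    diagCoeff y (restrictRep K a * h.fracIsometry g) =
      if g = 1 then a (toX (y : FinAdele K)) else 0 := by
  classical
  obtain ⟨m, k, hmk⟩ := exists_intUnit_mul_inv_eq (σ g)
  have eq_iff : k = m ↔ g = 1 := by
    have hσ_injective : Function.Injective σ :=
      Function.LeftInverse.injective (g := fun x => (diagFin K x : IdealGroup K)) hσ
    rw [← map_eq_one_iff σ hσ_injective, ← hmk, mul_inv_eq_one, intUnit_injective.eq_iff, eq_comm]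
  rw [fracIsometry_eq_star_s_mul_s h hmk.symm, restrictRep_apply,
    diagCoeff_functionRep_mul_star_s_mul_s hy, restrictHom_apply]
  simp only [eq_iff]

theorem diagCoeff_finsuppSum (hσ : ∀ z, (diagFin K (σ z) : IdealGroup K) = z)
    (h : IsCovariantPair (translation (idealActX K)) (integralClasses σ) e (restrictRep K)
      (classIsometry σ)) (hy : y ≠ 0) (c : IdealGroup K →₀ C₀(SpaceX K, ℂ)) :
    diagCoeff y (h.finsuppSum c) = c 1 (toX (y : FinAdele K)) := by
  classical
  rw [h.finsuppSum_apply, map_sum]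
  simp only [diagCoeff_restrictRep_mul_fracIsometry hσ h hy, Finset.sum_ite_eq',
    Finsupp.mem_support_iff]
  split_ifs with hc
  · rfl
  · rw [not_not.1 hc]
    rfl

end Coefficient

instance : Nontrivial (FinAdele K) := by
  by_contra h
  have := not_nontrivial_iff_subsingleton.1 h
  refine RingOfIntegers.not_isField K ⟨⟨0, 1, zero_ne_one⟩, mul_comm, fun {a} ha => ?_⟩
  obtain ⟨b, hb⟩ := dvd_of_intAdele_eq_mul (n := 1) (m := ⟨a, mem_nonZeroDivisors_of_ne_zero ha⟩)
    (w := 0) (zero_mem _) (Subsingleton.elim _ _)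
  exact ⟨b, hb.symm⟩

theorem norm_apply_toX_le {f : C₀(SpaceX K, ℂ)} {C : ℝ}
    (h : ∀ y : integralAdeles K, y ≠ 0 → ‖f (toX (y : FinAdele K))‖ ≤ C)
    (y : integralAdeles K) : ‖f (toX (y : FinAdele K))‖ ≤ C := by
  by_contra! hlt
  obtain rfl : y = 0 := by_contra fun hy => hlt.not_ge (h y hy)
  have hopen : IsOpen {y : FinAdele K | C < ‖f (toX y)‖} :=
    isOpen_lt continuous_const (f.continuous.comp continuous_toX).norm
  obtain ⟨m, hm⟩ := exists_multiples_subset hopen hlt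
  have hm0 : intPoint (m : 𝓞 K) ≠ 0 := fun h0 => by
    have heq : intAdele (m : 𝓞 K) * 1 = intAdele (m : 𝓞 K) * 0 := by
      rw [mul_one, mul_zero]
      exact congrArg Subtype.val h0
    exact one_ne_zero (intAdele_mul_injective m heq)
  exact (h _ hm0).not_gt (hm ⟨1, one_mem _, mul_one _⟩)

theorem norm_indicatorC₀_subsetY_mul_le (hK : NumberField.classNumber K = 1)
    (hr : NumberField.InfinitePlace.nrRealPlaces K ≤ 1)
    (hY : IsClopen (subsetY K) ∧ IsCompact (subsetY K)) {f : C₀(SpaceX K, ℂ)} {C : ℝ} (hC : 0 ≤ C)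
    (h : ∀ y : integralAdeles K, y ≠ 0 → ‖f (toX (y : FinAdele K))‖ ≤ C) :
    ‖indicatorC₀ (subsetY K) * f‖ ≤ C := by
  rw [← ZeroAtInftyContinuousMap.norm_toBCF_eq_norm, BoundedContinuousFunction.norm_le hC]
  intro x
  obtain ⟨y, rfl⟩ := surjective_toX hK hr x
  change ‖indicatorC₀ (subsetY K) (toX y) * f (toX y)‖ ≤ C
  rw [indicatorC₀_apply hY]
  by_cases hy : y ∈ integralAdeles K
  · rw [Set.indicator_of_mem ((toX_mem_subsetY y).2 hy), Pi.one_apply, one_mul]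
    exact norm_apply_toX_le h ⟨y, hy⟩
  · rwa [Set.indicator_of_notMem (mt (toX_mem_subsetY y).1 hy), zero_mul, norm_zero]

theorem embedsInRingCStarAlgebra (hK : NumberField.classNumber K = 1)
    (hr : NumberField.InfinitePlace.nrRealPlaces K ≤ 1) {G : Subgroup Kˣ}
    (hG : IsTotallyPositive G) (hG' : ∀ x : Kˣ, x ∈ G ∨ -x ∈ G) :
    EmbedsInRingCStarAlgebra G := by
  obtain ⟨σ, hσ⟩ := exists_section hK G hG'
  have hY : IsClopen (subsetY K) ∧ IsCompact (subsetY K) :=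
    ⟨isClopen_subsetY, isCompact_subsetY hK hr⟩
  have hpair := isCovariantPair_restrictRep hY (fun z => (hσ z).2)
    fun z => finIdele_diagFin_mem _ (hG _ (hσ z).1)
  have hnorm := norm_finsuppSum_le_of_ringCStarAlgebra hpair
  have he := isStarProjection_indicatorElt (idealActX K) (subsetY K)
  refine ⟨σ, hσ, functionRep K, fun m n g hg => ?_, hpair.cornerHom hnorm he, ?_,
    fun f z a b hab => ?_⟩
  · obtain rfl : g = cosetIndicator m n := ContinuousMap.ext hg
    exact functionRep_cosetIndicator m n
  · refine hpair.injective_cornerHom hnorm he fun c =>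
      norm_indicatorC₀_subsetY_mul_le hK hr hY (norm_nonneg _) fun y hy => ?_
    rw [← diagCoeff_finsuppSum (fun z => (hσ z).2) hpair hy]
    exact norm_diagCoeff_le y _
  · have hab' : σ z = intUnit a * (intUnit b)⁻¹ := Units.ext (hab.trans (div_eq_mul_inv _ _))
    rw [← fracIsometry_eq_star_s_mul_s hpair hab']
    exact (hpair.integratedForm_compress hnorm _).trans (hpair.integratedForm_mk hnorm f z)

end Embedding

theorem mem_or_neg_mem_positiveScalars {K : Type*} [Field K] (σ : K →+* ℝ) (x : Kˣ) :
    x ∈ positiveScalars σ ∨ -x ∈ positiveScalars σ := by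
  rcases ((map_ne_zero σ).2 x.ne_zero).lt_or_gt with hneg | hpos
  · refine Or.inr ?_
    change 0 < σ ((-x : Kˣ) : K)
    rwa [Units.val_neg, map_neg, neg_pos]
  · exact Or.inl hpos

end BostConnes

end

theorem mainTheorem6 (K : Type*) [Field K] [NumberField K]
    (hK : NumberField.classNumber K = 1)
    (hr : NumberField.InfinitePlace.nrRealPlaces K ≤ 1) :
    (IsClopen (BostConnes.subsetY K) ∧ IsCompact (BostConnes.subsetY K)) ∧
    (IsClopen (BostConnes.integralQuot K) ∧ IsCompact (BostConnes.integralQuot K)) ∧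
    (∀ h0 : NumberField.InfinitePlace.nrRealPlaces K = 0,
      BostConnes.PhiStarInducesIsos (⊤ : Subgroup Kˣ) (BostConnes.isTotallyPositive_top h0) ∧
      BostConnes.EmbedsInRingCStarAlgebra (⊤ : Subgroup Kˣ)) ∧
    (∀ σ : K →+* ℝ,
      BostConnes.PhiStarInducesIsos (BostConnes.positiveScalars σ)
        (BostConnes.isTotallyPositive_positiveScalars hr σ) ∧
      BostConnes.EmbedsInRingCStarAlgebra (BostConnes.positiveScalars σ)) := by
  have mem_or_neg_mem_top (x : Kˣ) : x ∈ (⊤ : Subgroup Kˣ) ∨ -x ∈ (⊤ : Subgroup Kˣ) :=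
    Or.inl (Subgroup.mem_top x)
  refine ⟨⟨BostConnes.isClopen_subsetY, BostConnes.isCompact_subsetY hK hr⟩,
    ⟨BostConnes.isClopen_integralQuot, BostConnes.isCompact_integralQuot⟩,
    fun h0 => ⟨?_, ?_⟩, fun σ => ⟨?_, ?_⟩⟩
  · exact BostConnes.phiStarInducesIsos hK hr _ mem_or_neg_mem_top
  · exact BostConnes.embedsInRingCStarAlgebra hK hr (BostConnes.isTotallyPositive_top h0)
      mem_or_neg_mem_top
  · exact BostConnes.phiStarInducesIsos hK hr _ (BostConnes.mem_or_neg_mem_positiveScalars σ)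
  · exact BostConnes.embedsInRingCStarAlgebra hK hr
      (BostConnes.isTotallyPositive_positiveScalars hr σ)
      (BostConnes.mem_or_neg_mem_positiveScalars σ)
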